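/- For a Schwartz function $f:\mathbb R\to\mathbb C$ let $\hat f(\xi)=\frac1{\sqrt{2\pi}}\int_{\mathbb R} e^{-i\xi x}f(x)\,dx$ and, for $s\in\mathbb R$ and $1\le r<\infty$, let $$\|f\|_{B^{s,2}_r}=\Bigl[\|\hat f\|_{L^2(|\xi|\le 1)}^r+\sum_{N\in\{1,2,4,8,\dots\}}N^{rs}\,\|\hat f\|_{L^2(N<|\xi|\le 2N)}^r\Bigr]^{1/r},$$ while for $r=\infty$ let $\|f\|_{B^{s,2}_\infty}=\max\bigl\{\|\hat f\|_{L^2(|\xi|\le 1)},\ \sup_{N\in\{1,2,4,\dots\}}N^{s}\|\hat f\|_{L^2(N<|\xi|\le 2N)}\bigr\}$. Fix $-\frac12<s<0$ and $1\le r\le\infty$. There is a constant $C$, depending only on $s$ and $r$, such that the following holds. Let $q:\mathbb R\to\mathcal S(\mathbb R;\mathbb C)$, $t\mapsto q(t)$, be a (global) Schwartz solution, that is, a curve differentiable in the topology of Schwartz space, of the cubic nonlinear Schrödinger equation $$-i\,\tfrac{d}{dt}q=-q''\pm2|q|^2q$$ or of the modified Korteweg–de Vries equation of Hirota $$\tfrac{d}{dt}q=-q'''\pm6|q|^2q',$$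 with either choice of the sign, where primes denote derivatives in $x$. Then, for every $t\in\mathbb R$, $$\|q(t)\|_{B^{s,2}_r}\le C\,\|q(0)\|_{B^{s,2}_r}\Bigl(1+\|q(0)\|_{B^{s,2}_r}^2\Bigr)^{\frac{|s|}{1-2|s|}}.$$ -/

import Mathlib

open MeasureTheory SchwartzMap Filter
open scoped ENNReal NNReal Topology

/-- The unitary Fourier transform in angular frequency,
`(2π)^(-1/2) ∫ exp(-iξx) f(x) dx`. -/
noncomputable def fourierHat (f : ℝ → ℂ) (ξ : ℝ) : ℂ :=
  ((1 / Real.sqrt (2 * Real.pi) : ℝ) : ℂ) *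
    ∫ x : ℝ, Complex.exp (-(Complex.I * (ξ : ℂ) * (x : ℂ))) * f x

/-- The `L²` norm of the Fourier transform of `f` over the set `A` of frequencies. -/
noncomputable def freqNorm (f : ℝ → ℂ) (A : Set ℝ) : ℝ≥0∞ :=
  eLpNorm (fourierHat f) 2 (volume.restrict A)

/-- The Besov norm `B^{s,2}_r` on the line with sharp dyadic frequency cutoffs, valued in
`[0, ∞]`. The summation index `k` stands for the dyadic frequency `N = 2 ^ k`. For `r = ∞` the
`ℓ^r` norm is the supremum. -/
noncomputable def besovNorm (s : ℝ) (r : ℝ≥0∞) (f : ℝ → ℂ) : ℝ≥0∞ :=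
  if r = ∞ then
    max (freqNorm f {ξ | |ξ| ≤ 1})
      (⨆ k : ℕ, ((2 : ℝ≥0∞) ^ k) ^ s * freqNorm f {ξ | 2 ^ k < |ξ| ∧ |ξ| ≤ 2 * 2 ^ k})
  else
    (freqNorm f {ξ | |ξ| ≤ 1} ^ r.toReal +
      ∑' k : ℕ, ((2 : ℝ≥0∞) ^ k) ^ (r.toReal * s) *
        freqNorm f {ξ | 2 ^ k < |ξ| ∧ |ξ| ≤ 2 * 2 ^ k} ^ r.toReal) ^ (1 / r.toReal)

/-- The curve `t ↦ q t` in Schwartz space has time derivative `v` at `t`: the difference quotients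
converge to `v` in the topology of Schwartz space. -/
def HasSchwartzDerivAt (q : ℝ → 𝓢(ℝ, ℂ)) (v : 𝓢(ℝ, ℂ)) (t : ℝ) : Prop :=
  Tendsto (fun h : ℝ => h⁻¹ • (q (t + h) - q t)) (𝓝[≠] 0) (𝓝 v)

/-- Global Schwartz solutions of the cubic NLS `-i q_t = -q'' + 2 ε |q|² q`: curves `t ↦ q t` that
are differentiable in the topology of Schwartz space and satisfy the equation. Defocusing for
`ε = 1`, focusing for `ε = -1`. -/
def IsSchwartzSolutionNLS (ε : ℝ) (q : ℝ → 𝓢(ℝ, ℂ)) : Prop :=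
  ∀ t : ℝ, ∃ v : 𝓢(ℝ, ℂ), HasSchwartzDerivAt q v t ∧
    ∀ x : ℝ, -Complex.I * v x =
      -iteratedDeriv 2 (q t) x + (ε : ℂ) * 2 * ((‖q t x‖ ^ 2 : ℝ) : ℂ) * q t x

/-- Global Schwartz solutions of the mKdV equation of Hirota,
`q_t = -q''' + 6 ε |q|² q'`, for complex-valued `q`. -/
def IsSchwartzSolutionHirota (ε : ℝ) (q : ℝ → 𝓢(ℝ, ℂ)) : Prop :=
  ∀ t : ℝ, ∃ v : 𝓢(ℝ, ℂ), HasSchwartzDerivAt q v t ∧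
    ∀ x : ℝ, v x =
      -iteratedDeriv 3 (q t) x + (ε : ℂ) * 6 * ((‖q t x‖ ^ 2 : ℝ) : ℂ) * deriv (q t) x

open scoped FourierTransform

/-! Both equations are AKNS flows for the pair (q, p) with p = ε conj q, so they share conservation
laws indexed by a spectral parameter l > 0. The law used here is ∫ p w, where w is the bounded
decaying solution of the Riccati equation w' = -l w + q - p w². Its part quadratic in q comes from w
≈ (l + d/dx)⁻¹ q. After multiplication by ε l, its real part is the square of `leadNorm l q`, which
is the L² norm of q̂ with the multiplier l / (l² + ξ²)^{1/2} in angular frequency. This is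
essentially the part of q at frequencies up to l.

If l^{-1/2} `errNorm l σ q` is small for some 0 ≤ σ < 1/2, then w is constructed by Picard iteration
in H^{1-σ} (`exists_isDecayingRiccati`), and the remainder of the conserved quantity is at most (η
`errNorm l σ q`)² (`leadNorm_sq_approx`). Conservation itself (`hasDerivAt_integral_density`) rests
on the zero-curvature form: the time derivative of w is an explicit expression in w, and p w has a
local conservation law. No regularity of w in time is assumed, because bounded solutions of the
Riccati equation depend stably on the potentials (`norm_le_of_linear_ode`). Together these give
almost conservation of the leading term at one scale (`leadNorm_le_of_small`).

The Besov norm is recovered by taking l = 2·2^k, weighting `leadNorm` by 2^{sk} and taking the ℓ^r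
norm over k ≥ k₀. The error norm at scale k is a sum, with decay 2^{-σm}, of leading norms at the
higher scales k + m. Hence for σ > |s| the tail of the errors is controlled by the same tail of the
leading terms (`exists_seqNorm_errSeq_le`). The smallness needed at all scales k ≥ k₀ follows once
2^{(1/2+s)k₀} dominates a multiple of (1 + ‖q(0)‖²)^{1/2}. A continuity argument
(`le_of_continuous_bootstrap`) then bounds the tail norm for all times
(`exists_seqNorm_leadSeq_bound`). Passing back to the full Besov norm costs 2^{|s|k₀}
(`exists_besovNorm_le`), and the optimal k₀ turns this into the power |s|/(1-2|s|). -/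

/-! ### L² norms and convolutions of nonnegative functions -/

/-- The `L²` norm of a nonnegative function on the line. -/
noncomputable def l2 (F : ℝ → ℝ≥0∞) : ℝ≥0∞ := (∫⁻ x, F x ^ (2 : ℝ)) ^ (1 / 2 : ℝ)

/-- The convolution of nonnegative functions on the line. -/
noncomputable def nconv (F G : ℝ → ℝ≥0∞) (ξ : ℝ) : ℝ≥0∞ := ∫⁻ η, F (ξ - η) * G η

lemma l2_mono {F G : ℝ → ℝ≥0∞} (h : ∀ x, F x ≤ G x) : l2 F ≤ l2 G := by
  unfold l2
  gcongr with x
  exact h x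

lemma l2_const_mul (c : ℝ≥0∞) {F : ℝ → ℝ≥0∞} (hF : Measurable F) :
    l2 (fun x => c * F x) = c * l2 F := by
  unfold l2
  simp_rw [ENNReal.mul_rpow_of_nonneg _ _ (by norm_num : (0 : ℝ) ≤ 2)]
  rw [lintegral_const_mul _ (by fun_prop), ENNReal.mul_rpow_of_nonneg _ _ (by norm_num),
    ← ENNReal.rpow_mul]
  norm_num

lemma l2_add_le {F G : ℝ → ℝ≥0∞} (hF : Measurable F) (hG : Measurable G) :
    l2 (fun x => F x + G x) ≤ l2 F + l2 G :=
  ENNReal.lintegral_Lp_add_le hF.aemeasurable hG.aemeasurable (by norm_num)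

lemma lintegral_mul_le_l2 {F G : ℝ → ℝ≥0∞} (hF : Measurable F) (hG : Measurable G) :
    ∫⁻ x, F x * G x ≤ l2 F * l2 G :=
  ENNReal.lintegral_mul_le_Lp_mul_Lq volume Real.HolderConjugate.two_two
    hF.aemeasurable hG.aemeasurable

lemma l2_sq (F : ℝ → ℝ≥0∞) : l2 F ^ (2 : ℝ) = ∫⁻ x, F x ^ (2 : ℝ) := by
  unfold l2
  rw [← ENNReal.rpow_mul]
  norm_num

lemma l2_comp_sub_left (F : ℝ → ℝ≥0∞) (ξ : ℝ) : l2 (fun η => F (ξ - η)) = l2 F := by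
  unfold l2
  rw [lintegral_sub_left_eq_self (fun η => F η ^ (2 : ℝ)) ξ]

lemma l2_comp_neg (F : ℝ → ℝ≥0∞) : l2 (fun η => F (-η)) = l2 F := by
  simpa using l2_comp_sub_left F 0

lemma measurable_nconv {F G : ℝ → ℝ≥0∞} (hF : Measurable F) (hG : Measurable G) :
    Measurable (nconv F G) := by
  unfold nconv
  apply Measurable.lintegral_prod_right'
    (f := fun z : ℝ × ℝ => F (z.1 - z.2) * G z.2)
  fun_prop

lemma nconv_le_l2 {F G : ℝ → ℝ≥0∞} (hF : Measurable F) (hG : Measurable G) (ξ : ℝ) :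
    nconv F G ξ ≤ l2 F * l2 G := by
  refine (lintegral_mul_le_l2 (by fun_prop) hG).trans_eq ?_
  rw [l2_comp_sub_left]

/-- Young's inequality: Cauchy–Schwarz with respect to the measure G dη, then Tonelli and
translation invariance. -/
lemma l2_nconv_le {F G : ℝ → ℝ≥0∞} (hF : Measurable F) (hG : Measurable G) :
    l2 (nconv F G) ≤ l2 F * ∫⁻ x, G x := by
  have key (ξ : ℝ) : nconv F G ξ ^ (2 : ℝ) ≤
      (∫⁻ x, G x) * ∫⁻ η, F (ξ - η) ^ (2 : ℝ) * G η := by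
    have h1 : nconv F G ξ ≤ (∫⁻ x, G x) ^ (1 / 2 : ℝ) *
        (∫⁻ η, F (ξ - η) ^ (2 : ℝ) * G η) ^ (1 / 2 : ℝ) := by
      have h2 := lintegral_mul_le_l2 (F := fun η => G η ^ (1 / 2 : ℝ))
        (G := fun η => F (ξ - η) * G η ^ (1 / 2 : ℝ)) (by fun_prop) (by fun_prop)
      have e1 (x : ℝ≥0∞) : (x ^ (1 / 2 : ℝ)) ^ (2 : ℝ) = x := by
        rw [← ENNReal.rpow_mul]; norm_num
      have e2 (x : ℝ≥0∞) : x ^ (1 / 2 : ℝ) * x ^ (1 / 2 : ℝ) = x := by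
        rw [← ENNReal.rpow_add_of_nonneg _ _ (by norm_num) (by norm_num)]; norm_num
      unfold l2 at h2
      simp_rw [ENNReal.mul_rpow_of_nonneg _ _ (by norm_num : (0 : ℝ) ≤ 2), e1] at h2
      refine le_trans (le_of_eq ?_) h2
      unfold nconv
      congr 1
      ext η
      rw [mul_left_comm, e2]
    calc nconv F G ξ ^ (2 : ℝ) ≤ ((∫⁻ x, G x) ^ (1 / 2 : ℝ) *
        (∫⁻ η, F (ξ - η) ^ (2 : ℝ) * G η) ^ (1 / 2 : ℝ)) ^ (2 : ℝ) := by gcongr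
      _ = _ := by
        rw [ENNReal.mul_rpow_of_nonneg _ _ (by norm_num : (0 : ℝ) ≤ 2), ← ENNReal.rpow_mul,
          ← ENNReal.rpow_mul]
        norm_num
  have hsq : ∫⁻ ξ, nconv F G ξ ^ (2 : ℝ) ≤ ((∫⁻ x, F x ^ (2 : ℝ)) * (∫⁻ x, G x) ^ (2 : ℝ)) := by
    calc ∫⁻ ξ, nconv F G ξ ^ (2 : ℝ)
        ≤ ∫⁻ ξ, (∫⁻ x, G x) * ∫⁻ η, F (ξ - η) ^ (2 : ℝ) * G η := lintegral_mono key
      _ = (∫⁻ x, G x) * ∫⁻ ξ, ∫⁻ η, F (ξ - η) ^ (2 : ℝ) * G η := by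
        rw [lintegral_const_mul]
        apply Measurable.lintegral_prod_right'
          (f := fun z : ℝ × ℝ => F (z.1 - z.2) ^ (2 : ℝ) * G z.2)
        fun_prop
      _ = (∫⁻ x, G x) * ∫⁻ η, ∫⁻ ξ, F (ξ - η) ^ (2 : ℝ) * G η := by
        rw [lintegral_lintegral_swap]
        refine Measurable.aemeasurable ?_
        change Measurable (fun z : ℝ × ℝ => F (z.1 - z.2) ^ (2 : ℝ) * G z.2)
        fun_prop
      _ = (∫⁻ x, G x) * ∫⁻ η, (∫⁻ x, F x ^ (2 : ℝ)) * G η := by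
        congr 2
        ext η
        rw [lintegral_mul_const _ (by fun_prop),
          lintegral_sub_right_eq_self (fun ξ => F ξ ^ (2 : ℝ)) η]
      _ = _ := by
        rw [lintegral_const_mul _ hG]
        rw [show (2 : ℝ) = ((2 : ℕ) : ℝ) by norm_num, ENNReal.rpow_natCast]
        ring
  calc l2 (nconv F G) ≤ ((∫⁻ x, F x ^ (2 : ℝ)) * (∫⁻ x, G x) ^ (2 : ℝ)) ^ (1 / 2 : ℝ) := by
        unfold l2; gcongr
    _ = _ := by
        rw [ENNReal.mul_rpow_of_nonneg _ _ (by norm_num), ← ENNReal.rpow_mul]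
        norm_num [l2]

/-! ### The frequency weight at scale l -/

/-- The Fourier symbol of `λ + d/dx`. -/
noncomputable def resSymbol (l ξ : ℝ) : ℂ := (l : ℂ) + 2 * Real.pi * ξ * Complex.I

/-- The inhomogeneous frequency weight at scale `l`. -/
noncomputable def jap (l ξ : ℝ) : ℝ := ‖resSymbol l ξ‖

/-- Powers of the frequency weight, as extended nonnegative numbers. -/
noncomputable def japPow (l θ ξ : ℝ) : ℝ≥0∞ := ENNReal.ofReal (jap l ξ ^ θ)

lemma jap_nonneg (l ξ : ℝ) : 0 ≤ jap l ξ := norm_nonneg _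

lemma jap_sq (l ξ : ℝ) : jap l ξ ^ 2 = l ^ 2 + (2 * Real.pi * ξ) ^ 2 := by
  unfold jap resSymbol
  rw [← Complex.normSq_eq_norm_sq, Complex.normSq_apply]
  simp
  ring

lemma le_jap (l ξ : ℝ) : l ≤ jap l ξ := by
  refine le_of_abs_le (abs_le_of_sq_le_sq ?_ (norm_nonneg _))
  have := jap_sq l ξ
  nlinarith [sq_nonneg (2 * Real.pi * ξ)]

lemma jap_pos {l : ℝ} (hl : 0 < l) (ξ : ℝ) : 0 < jap l ξ := hl.trans_le (le_jap l ξ)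

lemma jap_neg (l ξ : ℝ) : jap l (-ξ) = jap l ξ := by
  have h := jap_sq l (-ξ)
  rw [show (2 * Real.pi * -ξ) ^ 2 = (2 * Real.pi * ξ) ^ 2 by ring, ← jap_sq] at h
  exact (sq_eq_sq₀ (norm_nonneg _) (norm_nonneg _)).1 h

lemma jap_le_add {l : ℝ} (ξ η : ℝ) : jap l ξ ≤ jap l (ξ - η) + jap l η := by
  have h1 : resSymbol l ξ = resSymbol l (ξ - η) + (2 * Real.pi * η : ℝ) * Complex.I := by
    unfold resSymbol; push_cast; ring
  have h2 : ‖((2 * Real.pi * η : ℝ) : ℂ) * Complex.I‖ ≤ jap l η := by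
    rw [norm_mul, Complex.norm_I, mul_one, Complex.norm_real, Real.norm_eq_abs]
    refine abs_le_of_sq_le_sq ?_ (norm_nonneg _)
    rw [jap_sq]
    nlinarith [sq_nonneg l]
  unfold jap at *
  rw [h1]
  exact (norm_add_le _ _).trans (by gcongr)

@[fun_prop]
lemma continuous_jap (l : ℝ) : Continuous (jap l) := by
  unfold jap resSymbol
  fun_prop

@[fun_prop]
lemma measurable_japPow (l θ : ℝ) : Measurable (japPow l θ) := by
  unfold japPow
  have := (continuous_jap l).measurable
  fun_prop

lemma japPow_neg (l θ ξ : ℝ) : japPow l θ (-ξ) = japPow l θ ξ := by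
  rw [japPow, jap_neg, japPow]

lemma japPow_mul {l : ℝ} (hl : 0 < l) (θ θ' ξ : ℝ) :
    japPow l θ ξ * japPow l θ' ξ = japPow l (θ + θ') ξ := by
  unfold japPow
  rw [← ENNReal.ofReal_mul (Real.rpow_nonneg (jap_pos hl ξ).le _), ← Real.rpow_add (jap_pos hl ξ)]

lemma japPow_zero (l ξ : ℝ) : japPow l 0 ξ = 1 := by simp [japPow]

lemma japPow_subadditive {l : ℝ} (hl : 0 < l) {θ : ℝ} (h0 : 0 ≤ θ) (h1 : θ ≤ 1) (ξ η : ℝ) :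
    japPow l θ ξ ≤ japPow l θ (ξ - η) + japPow l θ η := by
  unfold japPow
  have := jap_pos hl
  rw [← ENNReal.ofReal_add (by have := this (ξ - η); positivity) (by have := this η; positivity)]
  apply ENNReal.ofReal_le_ofReal
  calc jap l ξ ^ θ ≤ (jap l (ξ - η) + jap l η) ^ θ :=
        Real.rpow_le_rpow (this ξ).le (jap_le_add ξ η) h0
    _ ≤ _ := Real.rpow_add_le_add_rpow (this _).le (this _).le h0 h1

/-- Only z^σ must be estimated. If y ≤ x, it is at most 2 x^σ and the first summand suffices. If x ≤
y, it is at most 2 y^σ, and x^{-σ} = x^{1-2σ} x^{-(1-σ)} with x^{1-2σ} ≤ y^{1-2σ}; this is where σ ≤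
1/2 enters. -/
lemma rpow_trilinear {x y z σ : ℝ} (hx : 0 < x) (hy : 0 < y) (hz : 0 < z) (h : z ≤ x + y)
    (h0 : 0 ≤ σ) (h1 : σ ≤ 1 / 2) :
    x ^ (-σ) ≤ 2 * (z ^ (-σ) * (y ^ (1 - σ) * (y ^ (-(1 - σ)) + x ^ (-(1 - σ))))) := by
  have hzσ : z ^ σ * z ^ (-σ) = 1 := by rw [← Real.rpow_add hz]; simp
  have hyσ : y ^ (1 - σ) * y ^ (-(1 - σ)) = 1 := by rw [← Real.rpow_add hy]; simp
  have h2 : (2 : ℝ) ^ σ ≤ 2 := by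
    calc (2 : ℝ) ^ σ ≤ 2 ^ (1 : ℝ) := Real.rpow_le_rpow_of_exponent_le (by norm_num) (by linarith)
      _ = 2 := by simp
  have main : x ^ (-σ) * z ^ σ ≤ 2 * (y ^ (1 - σ) * (y ^ (-(1 - σ)) + x ^ (-(1 - σ)))) := by
    have hA : 0 < y ^ (1 - σ) * x ^ (-(1 - σ)) := by positivity
    rcases le_total y x with hxy | hxy
    · have : z ^ σ ≤ 2 * x ^ σ := by
        calc z ^ σ ≤ (2 * x) ^ σ := Real.rpow_le_rpow hz.le (by linarith) h0
          _ = 2 ^ σ * x ^ σ := Real.mul_rpow (by norm_num) hx.le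
          _ ≤ _ := by gcongr
      calc x ^ (-σ) * z ^ σ ≤ x ^ (-σ) * (2 * x ^ σ) := by gcongr
        _ = 2 * (x ^ (-σ) * x ^ σ) := by ring
        _ = 2 := by rw [← Real.rpow_add hx]; simp
        _ ≤ _ := by rw [mul_add, hyσ]; linarith
    · have : z ^ σ ≤ 2 * y ^ σ := by
        calc z ^ σ ≤ (2 * y) ^ σ := Real.rpow_le_rpow hz.le (by linarith) h0
          _ = 2 ^ σ * y ^ σ := Real.mul_rpow (by norm_num) hy.le
          _ ≤ _ := by gcongr
      have e1 : x ^ (-σ) = x ^ (1 - 2 * σ) * x ^ (-(1 - σ)) := by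
        rw [← Real.rpow_add hx]; ring_nf
      have e2 : y ^ (1 - σ) = y ^ (1 - 2 * σ) * y ^ σ := by
        rw [← Real.rpow_add hy]; ring_nf
      calc x ^ (-σ) * z ^ σ ≤ x ^ (-σ) * (2 * y ^ σ) := by gcongr
        _ = 2 * (x ^ (1 - 2 * σ) * y ^ σ * x ^ (-(1 - σ))) := by rw [e1]; ring
        _ ≤ 2 * (y ^ (1 - 2 * σ) * y ^ σ * x ^ (-(1 - σ))) := by
          gcongr
          linarith
        _ = 2 * (y ^ (1 - σ) * x ^ (-(1 - σ))) := by rw [e2]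
        _ ≤ _ := by rw [mul_add (y ^ (1 - σ)), hyσ]; linarith
  calc x ^ (-σ) = (x ^ (-σ) * z ^ σ) * z ^ (-σ) := by rw [mul_assoc, hzσ, mul_one]
    _ ≤ (2 * (y ^ (1 - σ) * (y ^ (-(1 - σ)) + x ^ (-(1 - σ))))) * z ^ (-σ) := by gcongr
    _ = _ := by ring

lemma japPow_trilinear {l σ : ℝ} (hl : 0 < l) (h0 : 0 ≤ σ) (h1 : σ ≤ 1 / 2) (ξ η : ℝ) :
    japPow l (-σ) ξ ≤ 2 * (japPow l (-σ) (ξ - η) * (japPow l (1 - σ) η *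
      (japPow l (-(1 - σ)) η + japPow l (-(1 - σ)) ξ))) := by
  have hx := jap_pos hl ξ
  have hy := jap_pos hl η
  have hz := jap_pos hl (ξ - η)
  have h : jap l (ξ - η) ≤ jap l ξ + jap l η := by
    have := jap_le_add (l := l) (ξ - η) (-η)
    rwa [jap_neg, sub_neg_eq_add, sub_add_cancel] at this
  have := ENNReal.ofReal_le_ofReal (rpow_trilinear hx hy hz h h0 h1)
  rw [ENNReal.ofReal_mul (by norm_num), ENNReal.ofReal_mul (by positivity),
    ENNReal.ofReal_mul (by positivity), ENNReal.ofReal_add (by positivity) (by positivity),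
    ENNReal.ofReal_ofNat] at this
  exact this

/-! ### Products and weighted Sobolev norms on the Fourier side -/

/-- The pointwise product of Schwartz functions. -/
noncomputable def schwartzMul (f g : 𝓢(ℝ, ℂ)) : 𝓢(ℝ, ℂ) :=
  pairing (ContinuousLinearMap.mul ℂ ℂ) f g

@[simp] lemma schwartzMul_apply (f g : 𝓢(ℝ, ℂ)) (x : ℝ) : schwartzMul f g x = f x * g x := rfl

/-- The complex conjugate of a Schwartz function. -/
noncomputable def schwartzConj (f : 𝓢(ℝ, ℂ)) : 𝓢(ℝ, ℂ) :=
  f.postcompCLM (Complex.conjCLE : ℂ →L[ℝ] ℂ)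

@[simp] lemma schwartzConj_apply (f : 𝓢(ℝ, ℂ)) (x : ℝ) :
    schwartzConj f x = (starRingEnd ℂ) (f x) := rfl

@[fun_prop]
lemma measurable_enorm_fourier (f : 𝓢(ℝ, ℂ)) : Measurable (fun ξ => ‖𝓕 f ξ‖ₑ) :=
  (𝓕 f).continuous.enorm.measurable

lemma fourier_schwartzMul (f g : 𝓢(ℝ, ℂ)) (ξ : ℝ) :
    𝓕 (schwartzMul f g) ξ = ∫ η, 𝓕 f (ξ - η) * 𝓕 g η := by
  have h1 : schwartzMul f g = 𝓕 (SchwartzMap.convolution (ContinuousLinearMap.mul ℂ ℂ) (𝓕⁻ f) (𝓕⁻ g)) := by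
    rw [fourier_convolution]
    simp [schwartzMul]
  have h2 (h : 𝓢(ℝ, ℂ)) (ξ : ℝ) : 𝓕 h ξ = 𝓕⁻ h (-ξ) := by
    rw [fourierInv_coe, Real.fourierInv_eq_fourier_neg, neg_neg, fourier_coe]
  rw [h2, h1, FourierTransform.fourierInv_fourier_eq, convolution_apply,
    MeasureTheory.convolution_def, ← integral_neg_eq_self, ← integral_sub_left_eq_self _ _ ξ]
  congr 1
  ext η
  simp only [h2, ContinuousLinearMap.mul_apply']
  congr 2
  ring

lemma enorm_fourier_schwartzMul_le (f g : 𝓢(ℝ, ℂ)) (ξ : ℝ) :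
    ‖𝓕 (schwartzMul f g) ξ‖ₑ ≤ nconv (fun ξ => ‖𝓕 f ξ‖ₑ) (fun ξ => ‖𝓕 g ξ‖ₑ) ξ := by
  rw [fourier_schwartzMul]
  refine (enorm_integral_le_lintegral_enorm _).trans_eq ?_
  simp [nconv]

lemma fourier_schwartzConj (f : 𝓢(ℝ, ℂ)) (ξ : ℝ) :
    𝓕 (schwartzConj f) ξ = (starRingEnd ℂ) (𝓕 f (-ξ)) := by
  rw [fourier_coe, fourier_coe, Real.fourier_eq', Real.fourier_eq', ← integral_conj]
  congr 1
  ext x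
  simp [← Complex.exp_conj, Complex.conj_ofNat]

/-- The weighted `L²` norm `‖(l² + |∂|²)^{θ/2} f‖` on the frequency side. -/
noncomputable def sob (l θ : ℝ) (f : 𝓢(ℝ, ℂ)) : ℝ≥0∞ :=
  l2 (fun ξ => ‖𝓕 f ξ‖ₑ * japPow l θ ξ)

lemma sob_schwartzConj (l θ : ℝ) (f : 𝓢(ℝ, ℂ)) : sob l θ (schwartzConj f) = sob l θ f := by
  unfold sob
  rw [← l2_comp_neg]
  congr 1
  ext ξ
  rw [fourier_schwartzConj, neg_neg, japPow_neg, RCLike.enorm_conj]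

lemma sob_const_smul (l θ : ℝ) (c : ℂ) (f : 𝓢(ℝ, ℂ)) : sob l θ (c • f) = ‖c‖ₑ * sob l θ f := by
  unfold sob
  rw [← l2_const_mul _ (by fun_prop)]
  congr 1
  ext ξ
  rw [FourierTransform.fourier_smul]
  simp [mul_assoc]

lemma sob_add_le (l θ : ℝ) (f g : 𝓢(ℝ, ℂ)) : sob l θ (f + g) ≤ sob l θ f + sob l θ g := by
  unfold sob
  refine le_trans (l2_mono fun ξ => ?_) (l2_add_le (by fun_prop) (by fun_prop))
  rw [← add_mul, FourierTransform.fourier_add]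
  gcongr
  exact enorm_add_le _ _

/-- The `L²` norm of the weight of order `-(1 - σ)`; it governs the embedding of `H^{1-σ}`
into the Wiener algebra. -/
noncomputable def embConst (l σ : ℝ) : ℝ≥0∞ := l2 (japPow l (-(1 - σ)))

/-- Cauchy–Schwarz after inserting the weight of order 1 - σ and its inverse. -/
lemma lintegral_le_embConst {l σ : ℝ} (hl : 0 < l) {F : ℝ → ℝ≥0∞} (hF : Measurable F) :
    ∫⁻ ξ, F ξ ≤ embConst l σ * l2 (fun ξ => F ξ * japPow l (1 - σ) ξ) := by
  refine le_trans (le_of_eq ?_) (lintegral_mul_le_l2 (by fun_prop) (by fun_prop))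
  congr 1
  ext ξ
  rw [mul_left_comm, japPow_mul hl, neg_add_cancel, japPow_zero, mul_one]

lemma enorm_apply_le_sob {l σ : ℝ} (hl : 0 < l) (u : 𝓢(ℝ, ℂ)) (x : ℝ) :
    ‖u x‖ₑ ≤ embConst l σ * sob l (1 - σ) u := by
  have h : u x = 𝓕⁻ (𝓕 u) x := by simp
  rw [h, fourierInv_coe, Real.fourierInv_eq']
  refine (enorm_integral_le_lintegral_enorm _).trans ?_
  refine le_trans (le_of_eq ?_) (lintegral_le_embConst hl (by fun_prop))
  congr 1
  ext ξ
  rw [enorm_smul]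
  have : ‖Complex.exp (((2 * Real.pi * inner ℝ ξ x : ℝ) : ℂ) * Complex.I)‖ₑ = 1 := by
    rw [← ofReal_norm, Complex.norm_exp_ofReal_mul_I, ENNReal.ofReal_one]
  rw [this, one_mul]

/-- The weight of order 1 - σ ∈ [0, 1] is subadditive, so it can be moved onto either factor. The
other factor is then integrable by the embedding, and Young's inequality applies. This is the
algebra property of H^{1-σ}. -/
lemma l2_nconv_japPow_le {l σ : ℝ} (hl : 0 < l) (h0 : 0 ≤ σ) (h1 : σ ≤ 1) {F G : ℝ → ℝ≥0∞}
    (hF : Measurable F) (hG : Measurable G) :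
    l2 (fun ξ => nconv F G ξ * japPow l (1 - σ) ξ) ≤
      2 * (embConst l σ * (l2 (fun ξ => F ξ * japPow l (1 - σ) ξ) *
        l2 (fun ξ => G ξ * japPow l (1 - σ) ξ))) := by
  set U : ℝ → ℝ≥0∞ := fun ξ => F ξ * japPow l (1 - σ) ξ with hU
  set V : ℝ → ℝ≥0∞ := fun ξ => G ξ * japPow l (1 - σ) ξ with hV
  have mU : Measurable U := by fun_prop
  have mV : Measurable V := by fun_prop
  have key (ξ : ℝ) : nconv F G ξ * japPow l (1 - σ) ξ ≤ nconv U G ξ + nconv V F ξ := by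
    have e : nconv V F ξ = ∫⁻ η, F (ξ - η) * V η := by
      unfold nconv
      rw [← lintegral_sub_left_eq_self _ ξ]
      congr 1
      ext η
      rw [sub_sub_cancel, mul_comm]
    rw [e]
    unfold nconv
    rw [← lintegral_add_left (by fun_prop), ← lintegral_mul_const _ (by fun_prop)]
    refine lintegral_mono fun η => ?_
    calc _ ≤ F (ξ - η) * G η * (japPow l (1 - σ) (ξ - η) + japPow l (1 - σ) η) := by
          gcongr
          exact japPow_subadditive hl (by linarith) (by linarith) ξ η
      _ = _ := by simp only [hU, hV]; ring
  calc _ ≤ _ := l2_mono key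
    _ ≤ _ := l2_add_le (measurable_nconv mU hG) (measurable_nconv mV hF)
    _ ≤ l2 U * (embConst l σ * l2 V) + l2 V * (embConst l σ * l2 U) := by
      refine add_le_add ?_ ?_
      · refine (l2_nconv_le mU hG).trans ?_
        gcongr
        exact lintegral_le_embConst hl hG
      · refine (l2_nconv_le mV hF).trans ?_
        gcongr
        exact lintegral_le_embConst hl hF
    _ = _ := by ring

lemma sob_mul_le {l σ : ℝ} (hl : 0 < l) (h0 : 0 ≤ σ) (h1 : σ ≤ 1) (u v : 𝓢(ℝ, ℂ)) :
    sob l (1 - σ) (schwartzMul u v) ≤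
      2 * (embConst l σ * (sob l (1 - σ) u * sob l (1 - σ) v)) := by
  refine (l2_mono fun ξ => ?_).trans (l2_nconv_japPow_le hl h0 h1
    (measurable_enorm_fourier u) (measurable_enorm_fourier v))
  gcongr
  exact enorm_fourier_schwartzMul_le u v ξ

/-- The two summands of `japPow_trilinear` are treated differently. In the first, the smoother
factor lies in the Wiener algebra and Young's inequality applies. In the second, the convolution is
bounded pointwise by Cauchy–Schwarz, and the remaining weight in the output frequency has L² norm
`embConst`. -/
lemma l2_nconv_japPow_neg_le {l σ : ℝ} (hl : 0 < l) (h0 : 0 ≤ σ) (h1 : σ ≤ 1 / 2)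
    {P V : ℝ → ℝ≥0∞} (mP : Measurable P) (mV : Measurable V) :
    l2 (fun ξ => nconv P V ξ * japPow l (-σ) ξ) ≤
      4 * (embConst l σ * (l2 (fun ξ => P ξ * japPow l (-σ) ξ) *
        l2 (fun ξ => V ξ * japPow l (1 - σ) ξ))) := by
  set F : ℝ → ℝ≥0∞ := fun ξ => P ξ * japPow l (-σ) ξ with hF
  set U : ℝ → ℝ≥0∞ := fun ξ => V ξ * japPow l (1 - σ) ξ with hU
  have mF : Measurable F := by fun_prop
  have mU : Measurable U := by fun_prop
  have hUV (ξ : ℝ) : U ξ * japPow l (-(1 - σ)) ξ = V ξ := by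
    simp only [hU]
    rw [mul_assoc, japPow_mul hl, add_neg_cancel, japPow_zero, mul_one]
  have key (ξ : ℝ) : nconv P V ξ * japPow l (-σ) ξ ≤
      2 * (nconv F V ξ + (l2 F * l2 U) * japPow l (-(1 - σ)) ξ) := by
    calc _ = ∫⁻ η, P (ξ - η) * V η * japPow l (-σ) ξ := by
          unfold nconv
          rw [lintegral_mul_const _ (by fun_prop)]
      _ ≤ ∫⁻ η, 2 * (F (ξ - η) * V η + F (ξ - η) * U η * japPow l (-(1 - σ)) ξ) := by
          refine lintegral_mono fun η => ?_
          calc _ ≤ P (ξ - η) * V η * (2 * (japPow l (-σ) (ξ - η) *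
                (japPow l (1 - σ) η * (japPow l (-(1 - σ)) η + japPow l (-(1 - σ)) ξ)))) := by
                gcongr
                exact japPow_trilinear hl h0 h1 ξ η
            _ = 2 * (F (ξ - η) * (U η * japPow l (-(1 - σ)) η) +
                  F (ξ - η) * U η * japPow l (-(1 - σ)) ξ) := by
                simp only [hF, hU]; ring
            _ = _ := by rw [hUV]
      _ = 2 * (nconv F V ξ + nconv F U ξ * japPow l (-(1 - σ)) ξ) := by
          unfold nconv
          rw [lintegral_const_mul _ (by fun_prop), lintegral_add_left (by fun_prop),
            lintegral_mul_const _ (by fun_prop)]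
      _ ≤ _ := by
          gcongr
          exact nconv_le_l2 mF mU ξ
  have mN : Measurable (nconv F V) := measurable_nconv mF mV
  calc _ ≤ _ := l2_mono key
    _ ≤ 2 * (l2 (nconv F V) + (l2 F * l2 U) * embConst l σ) := by
      rw [l2_const_mul _ (by fun_prop)]
      gcongr
      refine (l2_add_le mN (by fun_prop)).trans_eq ?_
      rw [l2_const_mul _ (by fun_prop), embConst]
    _ ≤ 2 * (l2 F * (embConst l σ * l2 U) + (l2 F * l2 U) * embConst l σ) := by
      gcongr
      refine (l2_nconv_le mF mV).trans ?_
      gcongr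
      exact lintegral_le_embConst hl mV
    _ = _ := by ring

lemma sob_neg_mul_le {l σ : ℝ} (hl : 0 < l) (h0 : 0 ≤ σ) (h1 : σ ≤ 1 / 2) (p u : 𝓢(ℝ, ℂ)) :
    sob l (-σ) (schwartzMul p u) ≤
      4 * (embConst l σ * (sob l (-σ) p * sob l (1 - σ) u)) := by
  refine (l2_mono fun ξ => ?_).trans (l2_nconv_japPow_neg_le hl h0 h1
    (measurable_enorm_fourier p) (measurable_enorm_fourier u))
  gcongr
  exact enorm_fourier_schwartzMul_le p u ξ

/-- Duality pairing of H^{-σ} with H^{1-σ}. The weights leave a surplus factor of order 2σ - 1 ≤ 0,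
which is at most l^{2σ-1} because the weight is at least l. -/
lemma nconv_zero_le {l σ : ℝ} (hl : 0 < l) (h1 : σ ≤ 1 / 2) {F G : ℝ → ℝ≥0∞}
    (hF : Measurable F) (hG : Measurable G) :
    nconv F G 0 ≤ ENNReal.ofReal (l ^ (2 * σ - 1)) *
      (l2 (fun ξ => F ξ * japPow l (-σ) ξ) * l2 (fun ξ => G ξ * japPow l (1 - σ) ξ)) := by
  have hw (ξ : ℝ) : japPow l (2 * σ - 1) ξ ≤ ENNReal.ofReal (l ^ (2 * σ - 1)) :=
    ENNReal.ofReal_le_ofReal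
      (Real.rpow_le_rpow_of_nonpos hl (le_jap l ξ) (by linarith))
  calc _ ≤ ∫⁻ η, ENNReal.ofReal (l ^ (2 * σ - 1)) *
        ((F (-η) * japPow l (-σ) (-η)) * (G η * japPow l (1 - σ) η)) := by
        refine lintegral_mono fun η => ?_
        calc F (0 - η) * G η = japPow l (2 * σ - 1) η *
              ((F (-η) * japPow l (-σ) (-η)) * (G η * japPow l (1 - σ) η)) := by
              have : japPow l (2 * σ - 1) η * (japPow l (-σ) η * japPow l (1 - σ) η) = 1 := by
                rw [japPow_mul hl, japPow_mul hl, ← japPow_zero l η]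
                ring_nf
              rw [zero_sub, japPow_neg]
              calc _ = F (-η) * G η * 1 := by ring
                _ = _ := by rw [← this]; ring
          _ ≤ _ := by gcongr; exact hw η
    _ = ENNReal.ofReal (l ^ (2 * σ - 1)) * ∫⁻ η,
        ((F (-η) * japPow l (-σ) (-η)) * (G η * japPow l (1 - σ) η)) := by
        rw [lintegral_const_mul _ (by fun_prop)]
    _ ≤ _ := by
        gcongr
        refine (lintegral_mul_le_l2 (by fun_prop) (by fun_prop)).trans_eq ?_
        rw [l2_comp_neg (fun η => F η * japPow l (-σ) η)]

lemma enorm_integral_mul_le {l σ : ℝ} (hl : 0 < l) (h1 : σ ≤ 1 / 2) (p u : 𝓢(ℝ, ℂ)) :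
    ‖∫ x, p x * u x‖ₑ ≤
      ENNReal.ofReal (l ^ (2 * σ - 1)) * (sob l (-σ) p * sob l (1 - σ) u) := by
  have e : ∫ x, p x * u x = 𝓕 (schwartzMul p u) 0 := by
    rw [fourier_coe, Real.fourier_eq']
    simp
  rw [e]
  exact (enorm_fourier_schwartzMul_le p u 0).trans
    (nconv_zero_le hl h1 (measurable_enorm_fourier p) (measurable_enorm_fourier u))

/-! ### The resolvent, and the scaling of the embedding constant -/

lemma resSymbol_ne_zero {l : ℝ} (hl : 0 < l) (ξ : ℝ) : resSymbol l ξ ≠ 0 :=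
  norm_pos_iff.1 (jap_pos hl ξ)

/-- Rationalising the denominator writes the inverse as the polynomial l - 2πiξ times l⁻² (1 +
(2πξ/l)²)⁻¹, and both factors have temperate growth. -/
lemma hasTemperateGrowth_inv_resSymbol {l : ℝ} (hl : 0 < l) :
    Function.HasTemperateGrowth (fun ξ => (resSymbol l ξ)⁻¹) := by
  have h1 : Function.HasTemperateGrowth
      (fun ξ : ℝ => (1 + ‖(2 * Real.pi / l) * ξ‖ ^ 2) ^ (-1 : ℝ)) :=
    (Function.hasTemperateGrowth_one_add_norm_sq_rpow ℝ (-1)).comp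
      (g := fun x : ℝ => (1 + ‖x‖ ^ 2) ^ (-1 : ℝ)) (by fun_prop)
  have h2 : Function.HasTemperateGrowth
      (fun ξ : ℝ => (((1 + ‖(2 * Real.pi / l) * ξ‖ ^ 2) ^ (-1 : ℝ) : ℝ) : ℂ)) :=
    Function.Complex.hasTemperateGrowth_ofReal.comp h1
  have h3 : Function.HasTemperateGrowth (fun ξ : ℝ => (ξ : ℂ)) := Function.Complex.hasTemperateGrowth_ofReal
  have h4 : (fun ξ => (resSymbol l ξ)⁻¹) = fun ξ : ℝ =>
      ((l : ℂ) + (-2 * Real.pi * Complex.I) * ξ) * (((l : ℂ) ^ 2)⁻¹ *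
        (((1 + ‖(2 * Real.pi / l) * ξ‖ ^ 2) ^ (-1 : ℝ) : ℝ) : ℂ)) := by
    ext ξ
    have hl' : (l : ℂ) ≠ 0 := by exact_mod_cast hl.ne'
    have e1 : resSymbol l ξ * ((l : ℂ) + (-2 * Real.pi * Complex.I) * ξ) =
        (l : ℂ) ^ 2 * (1 + ((2 * Real.pi / l) * ξ) ^ 2) := by
      unfold resSymbol
      field_simp
      ring_nf
      rw [Complex.I_sq]
      ring
    have e2 : (1 + ((2 * Real.pi / l : ℂ) * ξ) ^ 2) ≠ 0 := by
      have : (0 : ℝ) < 1 + ((2 * Real.pi / l) * ξ) ^ 2 := by positivity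
      exact_mod_cast this.ne'
    rw [Real.rpow_neg_one, Real.norm_eq_abs, sq_abs]
    push_cast
    symm
    refine eq_inv_of_mul_eq_one_right ?_
    rw [← mul_assoc, e1]
    generalize 1 + ((2 * Real.pi / l : ℂ) * ξ) ^ 2 = B at e2 ⊢
    field_simp
  rw [h4]
  fun_prop

/-- The resolvent `(l + d/dx)⁻¹` on Schwartz functions. -/
noncomputable def resolv (l : ℝ) : 𝓢(ℝ, ℂ) →L[ℂ] 𝓢(ℝ, ℂ) :=
  fourierMultiplierCLM ℂ (fun ξ => (resSymbol l ξ)⁻¹)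

lemma fourier_resolv {l : ℝ} (hl : 0 < l) (f : 𝓢(ℝ, ℂ)) (ξ : ℝ) :
    𝓕 (resolv l f) ξ = (resSymbol l ξ)⁻¹ * 𝓕 f ξ := by
  rw [resolv, fourierMultiplierCLM_apply, FourierTransform.fourier_fourierInv_eq,
    smulLeftCLM_apply_apply (hasTemperateGrowth_inv_resSymbol hl), smul_eq_mul]

lemma hasDerivAt_resolv {l : ℝ} (hl : 0 < l) (f : 𝓢(ℝ, ℂ)) (x : ℝ) :
    HasDerivAt (resolv l f) (-(l : ℂ) * resolv l f x + f x) x := by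
  set u := resolv l f with hu
  have h : 𝓕 (derivCLM ℂ ℂ u + (l : ℂ) • u) = 𝓕 f := by
    ext ξ
    rw [FourierTransform.fourier_add, FourierTransform.fourier_smul]
    have h1 : 𝓕 (derivCLM ℂ ℂ u) ξ = (2 * Real.pi * Complex.I * ξ) * 𝓕 u ξ := by
      rw [fourier_coe, fourier_coe]
      have : (derivCLM ℂ ℂ u : ℝ → ℂ) = deriv u := by ext x; simp
      rw [this, Real.fourier_deriv u.integrable u.differentiable]
      · rfl
      · rw [← this]
        exact (derivCLM ℂ ℂ u).integrable
    simp only [add_apply, smul_apply, smul_eq_mul]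
    rw [h1, hu, fourier_resolv hl]
    have := resSymbol_ne_zero hl ξ
    have e : 2 * (Real.pi : ℂ) * Complex.I * ξ = resSymbol l ξ - l := by unfold resSymbol; ring
    rw [e]
    field_simp
    ring
  have h' : derivCLM ℂ ℂ u + (l : ℂ) • u = f := by
    have := congrArg (fun g : 𝓢(ℝ, ℂ) => 𝓕⁻ g) h
    simpa using this
  have h2 := u.hasDerivAt x
  have h3 : deriv u x = -(l : ℂ) * u x + f x := by
    rw [← h']
    simp
  rwa [h3] at h2

/-- The gain of one derivative is an exact isometry, since `jap` is the modulus of the resolvent's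
denominator. -/
lemma sob_resolv {l : ℝ} (hl : 0 < l) (θ : ℝ) (f : 𝓢(ℝ, ℂ)) :
    sob l (θ + 1) (resolv l f) = sob l θ f := by
  unfold sob
  congr 1
  ext ξ
  rw [fourier_resolv hl, enorm_mul, ← japPow_mul hl, enorm_inv (resSymbol_ne_zero hl ξ)]
  have : japPow l 1 ξ = ‖resSymbol l ξ‖ₑ := by
    rw [japPow, Real.rpow_one, jap, ofReal_norm]
  rw [this]
  have h0 : ‖resSymbol l ξ‖ₑ ≠ 0 := by simpa using resSymbol_ne_zero hl ξ
  calc _ = (‖resSymbol l ξ‖ₑ * ‖resSymbol l ξ‖ₑ⁻¹) * (‖𝓕 f ξ‖ₑ * japPow l θ ξ) := by ring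
    _ = _ := by rw [ENNReal.mul_inv_cancel h0 (by simp), one_mul]

lemma lintegral_comp_mul_left_real {c : ℝ} (hc : 0 < c) (F : ℝ → ℝ≥0∞) :
    ∫⁻ x, F (c * x) = ENNReal.ofReal c⁻¹ * ∫⁻ x, F x := by
  have h := Real.map_volume_mul_left hc.ne'
  have e := lintegral_map_equiv (μ := volume) F (Homeomorph.mulLeft₀ c hc.ne').toMeasurableEquiv
  have h' : Measure.map (Homeomorph.mulLeft₀ c hc.ne').toMeasurableEquiv volume =
      ENNReal.ofReal |c⁻¹| • (volume : Measure ℝ) := h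
  rw [h', lintegral_smul_measure, abs_of_pos (inv_pos.2 hc)] at e
  exact e.symm

/-- Dilation ξ ↦ ξ/l: the weight contributes l^{-(1-σ)} and the Jacobian, under the square root,
l^{1/2}. -/
lemma embConst_eq {l : ℝ} (hl : 0 < l) (σ : ℝ) :
    embConst l σ = ENNReal.ofReal (l ^ (σ - 1 / 2)) * embConst 1 σ := by
  have hj (ξ : ℝ) : jap l ξ = l * jap 1 (l⁻¹ * ξ) := by
    rw [← sq_eq_sq₀ (jap_nonneg _ _) (mul_nonneg hl.le (jap_nonneg _ _)), mul_pow, jap_sq, jap_sq]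
    field_simp
  have hjp (ξ : ℝ) : japPow l (-(1 - σ)) ξ =
      ENNReal.ofReal (l ^ (-(1 - σ))) * japPow 1 (-(1 - σ)) (l⁻¹ * ξ) := by
    unfold japPow
    rw [hj, Real.mul_rpow hl.le (jap_nonneg _ _), ENNReal.ofReal_mul (by positivity)]
  have e1 : embConst l σ = ENNReal.ofReal (l ^ (-(1 - σ))) *
      l2 (fun ξ => japPow 1 (-(1 - σ)) (l⁻¹ * ξ)) := by
    rw [embConst, ← l2_const_mul _ (by fun_prop)]
    congr 1
    ext ξ
    exact hjp ξ
  have e2 : l2 (fun ξ => japPow 1 (-(1 - σ)) (l⁻¹ * ξ)) =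
      ENNReal.ofReal (l ^ (1 / 2 : ℝ)) * embConst 1 σ := by
    unfold embConst l2
    rw [lintegral_comp_mul_left_real (inv_pos.2 hl) (fun ξ => japPow 1 (-(1 - σ)) ξ ^ (2 : ℝ)),
      ENNReal.mul_rpow_of_nonneg _ _ (by norm_num), inv_inv,
      ENNReal.ofReal_rpow_of_nonneg hl.le (by norm_num)]
  rw [e1, e2, ← mul_assoc, ← ENNReal.ofReal_mul (by positivity), ← Real.rpow_add hl]
  congr 3
  ring

lemma embConst_one_lt_top {σ : ℝ} (h1 : σ < 1 / 2) : embConst 1 σ < ∞ := by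
  unfold embConst l2
  refine ENNReal.rpow_lt_top_of_nonneg (by norm_num) (ne_of_lt ?_)
  have hint : Integrable (fun x : ℝ => (1 + ‖x‖ ^ 2) ^ (-(2 * (1 - σ)) / 2)) :=
    integrable_rpow_neg_one_add_norm_sq (by simp; linarith)
  have hint2 : ∫⁻ x : ℝ, ENNReal.ofReal ((1 + ‖x‖ ^ 2) ^ (-(2 * (1 - σ)) / 2)) < ∞ := by
    have := hint.hasFiniteIntegral
    rw [hasFiniteIntegral_iff_ofReal (ae_of_all _ fun x => by positivity)] at this
    exact this
  refine lt_of_le_of_lt (lintegral_mono fun ξ => ?_)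
    ((lintegral_comp_mul_left_real Real.two_pi_pos _).trans_lt
      (ENNReal.mul_lt_top ENNReal.ofReal_lt_top hint2))
  unfold japPow
  rw [ENNReal.ofReal_rpow_of_nonneg (Real.rpow_nonneg (jap_nonneg _ _) _) (by norm_num)]
  apply ENNReal.ofReal_le_ofReal
  rw [← Real.rpow_mul (jap_nonneg _ _), Real.norm_eq_abs, sq_abs]
  have : 1 + (2 * Real.pi * ξ) ^ 2 = jap 1 ξ ^ (2 : ℝ) := by
    rw [Real.rpow_two, jap_sq]; ring
  rw [this, ← Real.rpow_mul (jap_nonneg _ _)]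
  apply le_of_eq
  congr 1
  ring

/-! ### Solving the Riccati equation -/

/-- Picard iterates for the Riccati equation `w' = -l w + q - p w²`. -/
noncomputable def riccatiIter (l : ℝ) (p q : 𝓢(ℝ, ℂ)) : ℕ → 𝓢(ℝ, ℂ)
  | 0 => 0
  | n + 1 => resolv l (q - schwartzMul p
      (schwartzMul (riccatiIter l p q n) (riccatiIter l p q n)))

/-- `w` is a bounded solution of the Riccati equation `w' = -l w + q - p w²` vanishing at
infinity. -/
structure IsDecayingRiccati (l : ℝ) (p q w : ℝ → ℂ) : Prop where
  hasDerivAt : ∀ x, HasDerivAt w (-(l : ℂ) * w x + q x - p x * w x ^ 2) x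
  norm_le : ∀ x, ‖w x‖ ≤ 1
  tendsto : Tendsto w (cocompact ℝ) (𝓝 0)

lemma sob_sub_le (l θ : ℝ) (f g : 𝓢(ℝ, ℂ)) : sob l θ (f - g) ≤ sob l θ f + sob l θ g := by
  have h := sob_add_le l θ f ((-1 : ℂ) • g)
  rw [sob_const_smul] at h
  simpa [sub_eq_add_neg] using h

lemma sob_neg_mul_mul_le {l σ : ℝ} (hl : 0 < l) (h0 : 0 ≤ σ) (h1 : σ ≤ 1 / 2)
    (p u v : 𝓢(ℝ, ℂ)) :
    sob l (-σ) (schwartzMul p (schwartzMul u v)) ≤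
      8 * (embConst l σ * embConst l σ * sob l (-σ) p * (sob l (1 - σ) u * sob l (1 - σ) v)) := by
  refine (sob_neg_mul_le hl h0 h1 p _).trans ?_
  calc _ ≤ 4 * (embConst l σ * (sob l (-σ) p *
        (2 * (embConst l σ * (sob l (1 - σ) u * sob l (1 - σ) v))))) := by
        gcongr
        exact sob_mul_le hl h0 (by linarith) u v
    _ = _ := by ring

lemma sob_one_sub_resolv {l : ℝ} (hl : 0 < l) (σ : ℝ) (f : 𝓢(ℝ, ℂ)) :
    sob l (1 - σ) (resolv l f) = sob l (-σ) f := by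
  have := sob_resolv hl (-σ) f
  rwa [neg_add_eq_sub] at this

/-- The ball of radius 2b is preserved: the linear part contributes b, and the smallness hypothesis
makes the cubic part at most b. -/
lemma sob_riccatiIter_le {l σ : ℝ} (hl : 0 < l) (h0 : 0 ≤ σ) (h1 : σ ≤ 1 / 2)
    {p q : 𝓢(ℝ, ℂ)} {b : ℝ≥0∞} (hp : sob l (-σ) p ≤ b) (hq : sob l (-σ) q ≤ b)
    (hb : 16 * (embConst l σ * b) ≤ 1) (n : ℕ) :
    sob l (1 - σ) (riccatiIter l p q n) ≤ 2 * b := by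
  induction n with
  | zero =>
    have : sob l (1 - σ) (0 : 𝓢(ℝ, ℂ)) = 0 := by
      have := sob_const_smul l (1 - σ) 0 (0 : 𝓢(ℝ, ℂ))
      simpa using this
    simp [riccatiIter, this]
  | succ n ih =>
    rw [riccatiIter, sob_one_sub_resolv hl]
    calc _ ≤ _ := sob_sub_le _ _ _ _
      _ ≤ b + 8 * (embConst l σ * embConst l σ * b * ((2 * b) * (2 * b))) := by
        gcongr
        refine (sob_neg_mul_mul_le hl h0 h1 _ _ _).trans ?_
        gcongr
      _ = b + 32 * ((embConst l σ * b) * (embConst l σ * b)) * b := by ring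
      -- The constant is raised to 256 = 16² so that `hb` can be applied twice.
      _ ≤ b + 256 * ((embConst l σ * b) * (embConst l σ * b)) * b := by
        gcongr
        norm_num
      _ = b + ((16 * (embConst l σ * b)) * (16 * (embConst l σ * b))) * b := by ring
      _ ≤ b + (1 * 1) * b := by gcongr
      _ = 2 * b := by ring

/-- Contraction, via u² - v² = (u + v)(u - v). The geometric factor stays on the left to avoid
division by it. -/
lemma sob_riccatiIter_sub_le {l σ : ℝ} (hl : 0 < l) (h0 : 0 ≤ σ) (h1 : σ ≤ 1 / 2)
    {p q : 𝓢(ℝ, ℂ)} {b : ℝ≥0∞} (hp : sob l (-σ) p ≤ b) (hq : sob l (-σ) q ≤ b)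
    (hb : 16 * (embConst l σ * b) ≤ 1) (n : ℕ) :
    2 ^ n * sob l (1 - σ) (riccatiIter l p q (n + 1) - riccatiIter l p q n) ≤ 2 * b := by
  induction n with
  | zero =>
    simpa [riccatiIter] using sob_riccatiIter_le hl h0 h1 hp hq hb 1
  | succ n ih =>
    set u := riccatiIter l p q (n + 1) with hu
    set v := riccatiIter l p q n with hv
    have e : riccatiIter l p q (n + 1 + 1) - u =
        resolv l ((-1 : ℂ) • schwartzMul p (schwartzMul (u + v) (u - v))) := by
      change resolv l (q - schwartzMul p (schwartzMul u u)) -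
        resolv l (q - schwartzMul p (schwartzMul v v)) = _
      rw [← map_sub]
      congr 1
      ext x
      simp
      ring
    rw [e, sob_one_sub_resolv hl, sob_const_smul]
    have huv : sob l (1 - σ) (u + v) ≤ 2 * b + 2 * b :=
      (sob_add_le _ _ _ _).trans (add_le_add (sob_riccatiIter_le hl h0 h1 hp hq hb _)
        (sob_riccatiIter_le hl h0 h1 hp hq hb _))
    calc _ = 2 ^ (n + 1) * sob l (-σ) (schwartzMul p (schwartzMul (u + v) (u - v))) := by simp
      _ ≤ 2 ^ (n + 1) * (8 * (embConst l σ * embConst l σ * b *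
            ((2 * b + 2 * b) * sob l (1 - σ) (u - v)))) := by
        gcongr
        refine (sob_neg_mul_mul_le hl h0 h1 _ _ _).trans ?_
        gcongr
      _ = 64 * ((embConst l σ * b) * (embConst l σ * b)) * (2 ^ n * sob l (1 - σ) (u - v)) := by
        ring
      _ ≤ 256 * ((embConst l σ * b) * (embConst l σ * b)) * (2 * b) := by
        gcongr
        norm_num
      _ = ((16 * (embConst l σ * b)) * (16 * (embConst l σ * b))) * (2 * b) := by ring
      _ ≤ (1 * 1) * (2 * b) := by gcongr
      _ = 2 * b := by ring

/-- The iterates converge geometrically in H^{1-σ}, hence uniformly, so the limit lies in C₀. Its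
integral against p minus the quadratic part is the limit of -∫ p (l + d/dx)⁻¹(p wₙ²), estimated by
duality and the product bounds. -/
lemma exists_isDecayingRiccati {l σ : ℝ} (hl : 0 < l) (h0 : 0 ≤ σ) (h1 : σ ≤ 1 / 2)
    {p q : 𝓢(ℝ, ℂ)} {b : ℝ≥0∞} (hp : sob l (-σ) p ≤ b) (hq : sob l (-σ) q ≤ b)
    (hb : 16 * (embConst l σ * b) ≤ 1) :
    ∃ w : ℝ → ℂ, IsDecayingRiccati l p q w ∧
      ‖(∫ x, p x * w x) - ∫ x, p x * resolv l q x‖ₑ ≤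
        32 * ENNReal.ofReal (l ^ (2 * σ - 1)) * (embConst l σ * b) ^ 2 * b ^ 2 := by
  set W : ℕ → ZeroAtInftyContinuousMap ℝ ℂ := fun n => (riccatiIter l p q n).toZeroAtInfty with hW
  have hdist (n : ℕ) : dist (W n) (W (n + 1)) ≤ 2 / 2 / 2 ^ n := by
    rw [dist_comm]
    rw [← ZeroAtInftyContinuousMap.dist_toBCF_eq_dist]
    refine (BoundedContinuousFunction.dist_le (by positivity)).2 fun x => ?_
    have h := enorm_apply_le_sob hl (σ := σ)
      (riccatiIter l p q (n + 1) - riccatiIter l p q n) x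
    have h' : 2 ^ n * ‖(riccatiIter l p q (n + 1) - riccatiIter l p q n) x‖ₑ ≤ 1 := by
      calc _ ≤ 2 ^ n * (embConst l σ *
            sob l (1 - σ) (riccatiIter l p q (n + 1) - riccatiIter l p q n)) := by gcongr
        _ = embConst l σ * (2 ^ n *
            sob l (1 - σ) (riccatiIter l p q (n + 1) - riccatiIter l p q n)) := by ring
        _ ≤ embConst l σ * (2 * b) := by
          gcongr embConst l σ * ?_
          exact sob_riccatiIter_sub_le hl h0 h1 hp hq hb n
        _ = 2 * (embConst l σ * b) := by ring
        _ ≤ 16 * (embConst l σ * b) := by gcongr; norm_num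
        _ ≤ 1 := hb
    rw [← ofReal_norm, show (2 : ℝ≥0∞) ^ n = ENNReal.ofReal (2 ^ n) by
      rw [ENNReal.ofReal_pow (by norm_num), ENNReal.ofReal_ofNat],
      ← ENNReal.ofReal_mul (by positivity), ENNReal.ofReal_le_one] at h'
    rw [div_self two_ne_zero, le_div_iff₀ (by positivity), mul_comm, dist_eq_norm]
    exact h'
  obtain ⟨w, hw⟩ := cauchySeq_tendsto_of_complete (cauchySeq_of_le_geometric_two hdist)
  have hconv (n : ℕ) (x : ℝ) : ‖riccatiIter l p q n x - w x‖ ≤ 2 / 2 ^ n := by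
    have h := dist_le_of_le_geometric_two_of_tendsto hdist hw n
    rw [← ZeroAtInftyContinuousMap.dist_toBCF_eq_dist] at h
    have := (BoundedContinuousFunction.dist_le (by positivity)).1 h x
    rwa [dist_eq_norm] at this
  have hlim : Tendsto (fun n : ℕ => (2 : ℝ) / 2 ^ n) atTop (𝓝 0) := by
    simpa [div_eq_mul_inv] using
      (tendsto_pow_atTop_nhds_zero_of_lt_one (r := (2 : ℝ)⁻¹) (by norm_num) (by norm_num)).const_mul 2
  have hpt (x : ℝ) : Tendsto (fun n => riccatiIter l p q n x) atTop (𝓝 (w x)) := by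
    rw [tendsto_iff_norm_sub_tendsto_zero]
    exact squeeze_zero (fun _ => norm_nonneg _) (fun n => hconv n x) hlim
  have hbd (n : ℕ) (x : ℝ) : ‖riccatiIter l p q n x‖ ≤ 1 := by
    have h := enorm_apply_le_sob hl (σ := σ) (riccatiIter l p q n) x
    have h' : ‖riccatiIter l p q n x‖ₑ ≤ 1 := by
      calc _ ≤ _ := h
        _ ≤ embConst l σ * (2 * b) := by
          gcongr
          exact sob_riccatiIter_le hl h0 h1 hp hq hb n
        _ = 2 * (embConst l σ * b) := by ring
        _ ≤ 16 * (embConst l σ * b) := by gcongr; norm_num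
        _ ≤ 1 := hb
    rwa [← ofReal_norm, ENNReal.ofReal_le_one] at h'
  have hwbd (x : ℝ) : ‖w x‖ ≤ 1 :=
    le_of_tendsto (hpt x).norm (Eventually.of_forall fun n => hbd n x)
  refine ⟨w, ⟨?_, hwbd, w.zero_at_infty'⟩, ?_⟩
  · set M := SchwartzMap.seminorm ℝ 0 0 p with hM
    have hMp (x : ℝ) : ‖p x‖ ≤ M := norm_le_seminorm ℝ p x
    have hM0 : 0 ≤ M := (norm_nonneg _).trans (hMp 0)
    -- The derivative of the iterate n + 1 is explicit in the iterates n + 1 and n, so it converges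
    -- uniformly along with them.
    refine hasDerivAt_of_tendstoUniformly (l := atTop)
      (f := fun n => riccatiIter l p q (n + 1))
      (f' := fun n x => -(l : ℂ) * riccatiIter l p q (n + 1) x +
        (q x - p x * riccatiIter l p q n x ^ 2)) ?_ ?_ ?_
    · rw [Metric.tendstoUniformly_iff]
      intro ε hε
      have hlim2 : Tendsto (fun n : ℕ => (l + 2 * M) * ((2 : ℝ) / 2 ^ n)) atTop (𝓝 0) := by
        simpa using hlim.const_mul (l + 2 * M)
      filter_upwards [(tendsto_order.1 hlim2).2 ε hε] with n hn x
      refine lt_of_le_of_lt ?_ hn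
      rw [dist_eq_norm]
      set u := riccatiIter l p q (n + 1) x
      set v := riccatiIter l p q n x with hv
      have hu : ‖u - w x‖ ≤ 2 / 2 ^ n := (hconv (n + 1) x).trans (by
        gcongr
        · norm_num
        · omega)
      have hv' : ‖v - w x‖ ≤ 2 / 2 ^ n := hconv n x
      have e : -(l : ℂ) * w x + q x - p x * w x ^ 2 - (-(l : ℂ) * u + (q x - p x * v ^ 2)) =
          l * (u - w x) + p x * ((v - w x) * (v + w x)) := by ring
      rw [e]
      calc _ ≤ ‖(l : ℂ) * (u - w x)‖ + ‖p x * ((v - w x) * (v + w x))‖ := norm_add_le _ _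
        _ = l * ‖u - w x‖ + ‖p x‖ * (‖v - w x‖ * ‖v + w x‖) := by
          simp [abs_of_pos hl]
        _ ≤ l * (2 / 2 ^ n) + M * ((2 / 2 ^ n) * 2) := by
          gcongr
          · exact hMp x
          · refine (norm_add_le _ _).trans ?_
            have := hbd n x
            have := hwbd x
            linarith
        _ = _ := by ring
    · refine Eventually.of_forall fun n x => ?_
      have := hasDerivAt_resolv hl (q - schwartzMul p
        (schwartzMul (riccatiIter l p q n) (riccatiIter l p q n))) x
      refine this.congr_deriv ?_
      rw [riccatiIter]
      simp only [sub_apply, schwartzMul_apply]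
      ring
    · exact fun x => (hpt x).comp (tendsto_add_atTop_nat 1)
  · have hint : Tendsto (fun n => ∫ x, p x * riccatiIter l p q (n + 1) x) atTop
        (𝓝 (∫ x, p x * w x)) := by
      refine tendsto_integral_of_dominated_convergence (fun x => ‖p x‖) (fun n => ?_)
        p.integrable.norm (fun n => ae_of_all _ fun x => ?_) (ae_of_all _ fun x => ?_)
      · exact (p.continuous.mul (riccatiIter l p q (n + 1)).continuous).aestronglyMeasurable
      · rw [norm_mul]
        exact mul_le_of_le_one_right (norm_nonneg _) (hbd _ _)
      · exact ((hpt x).comp (tendsto_add_atTop_nat 1)).const_mul _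
    refine le_of_tendsto ((hint.sub_const _).enorm) (Eventually.of_forall fun n => ?_)
    set g := schwartzMul p (schwartzMul (riccatiIter l p q n) (riccatiIter l p q n)) with hg
    have e : (∫ x, p x * riccatiIter l p q (n + 1) x) - ∫ x, p x * resolv l q x =
        ∫ x, p x * resolv l ((-1 : ℂ) • g) x := by
      have i1 : Integrable (fun x => p x * riccatiIter l p q (n + 1) x) :=
        (schwartzMul p (riccatiIter l p q (n + 1))).integrable
      have i2 : Integrable (fun x => p x * resolv l q x) := (schwartzMul p (resolv l q)).integrable
      rw [← integral_sub i1 i2]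
      congr 1
      ext x
      simp [riccatiIter, ← hg]
      ring
    rw [e]
    calc _ ≤ _ := enorm_integral_mul_le hl h1 _ _
      _ = ENNReal.ofReal (l ^ (2 * σ - 1)) * (sob l (-σ) p * sob l (-σ) g) := by
        rw [sob_one_sub_resolv hl, sob_const_smul]
        simp
      _ ≤ ENNReal.ofReal (l ^ (2 * σ - 1)) * (b *
          (8 * (embConst l σ * embConst l σ * b * ((2 * b) * (2 * b))))) := by
        gcongr
        refine (sob_neg_mul_mul_le hl h0 h1 _ _ _).trans ?_
        gcongr <;> exact sob_riccatiIter_le hl h0 h1 hp hq hb n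
      _ = _ := by ring

/-! ### Bounded solutions of linear equations and L¹ bounds -/

/-- Duhamel's formula from -∞. Since l > 0, the integrating factor decays backwards, so boundedness
of e removes the homogeneous part and the bound does not involve M. This yields both uniqueness and
stability of bounded Riccati solutions. -/
lemma norm_le_of_linear_ode {l : ℝ} (hl : 0 < l) {e θ r : ℝ → ℂ} {M K R : ℝ}
    (he : ∀ x, HasDerivAt e (-(l + θ x) * e x + r x) x) (hM : ∀ x, ‖e x‖ ≤ M)
    (cθ : Continuous θ) (iθ : Integrable θ) (hK : ∫ x, ‖θ x‖ ≤ K)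
    (cr : Continuous r) (ir : Integrable r) (hR : ∫ x, ‖r x‖ ≤ R) (x : ℝ) :
    ‖e x‖ ≤ Real.exp K * R := by
  set m : ℝ → ℂ := fun y => Complex.exp (l * (y - x) + ∫ s in x..y, θ s) with hm
  have dm (y : ℝ) : HasDerivAt m ((l + θ y) * m y) y := by
    have h1 : HasDerivAt (fun y : ℝ => ∫ s in x..y, θ s) (θ y) y :=
      intervalIntegral.integral_hasDerivAt_right (cθ.intervalIntegrable _ _)
        (cθ.stronglyMeasurableAtFilter _ _) cθ.continuousAt
    have h2 : HasDerivAt (fun y : ℝ => (l : ℂ) * (y - x)) l y := by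
      simpa using ((Complex.ofRealCLM.hasDerivAt (x := y)).sub_const (x : ℂ)).const_mul (l : ℂ)
    exact ((h2.add h1).cexp).congr_deriv (mul_comm _ _)
  have cm : Continuous m := continuous_iff_continuousAt.2 fun y => (dm y).continuousAt
  have nm (y : ℝ) (hy : y ≤ x) : ‖m y‖ ≤ Real.exp (l * (y - x)) * Real.exp K := by
    rw [hm, Complex.norm_exp, ← Real.exp_add]
    apply Real.exp_le_exp.2
    rw [Complex.add_re, ← Complex.ofReal_sub, ← Complex.ofReal_mul, Complex.ofReal_re]
    gcongr
    calc (∫ s in x..y, θ s).re ≤ ‖∫ s in x..y, θ s‖ := Complex.re_le_norm _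
      _ ≤ ∫ s in Set.uIoc x y, ‖θ s‖ := intervalIntegral.norm_integral_le_integral_norm_uIoc
      _ ≤ ∫ s, ‖θ s‖ := setIntegral_le_integral iθ.norm (ae_of_all _ fun _ => norm_nonneg _)
      _ ≤ K := hK
  have main (a : ℝ) (ha : a ≤ x) : ‖e x‖ ≤ Real.exp (l * (a - x)) * Real.exp K * M
      + Real.exp K * R := by
    have hd (y : ℝ) : HasDerivAt (fun y => m y * e y) (m y * r y) y :=
      ((dm y).mul (he y)).congr_deriv (by ring)
    have hi := intervalIntegral.integral_eq_sub_of_hasDerivAt (a := a) (b := x)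
      (fun y _ => hd y) ((cm.mul cr).intervalIntegrable _ _)
    have hx : m x = 1 := by simp [hm]
    have h3 : e x = m a * e a + ∫ y in a..x, m y * r y := by
      rw [hi, hx]; ring
    rw [h3]
    refine (norm_add_le _ _).trans (add_le_add ?_ ?_)
    · rw [norm_mul]
      gcongr
      · exact nm a ha
      · exact hM a
    · rw [intervalIntegral.integral_of_le ha]
      calc _ ≤ ∫ y in Set.Ioc a x, ‖m y * r y‖ := norm_integral_le_integral_norm _
        _ ≤ ∫ y in Set.Ioc a x, Real.exp K * ‖r y‖ := by
          refine setIntegral_mono_on ?_ ((ir.norm.const_mul _).integrableOn) measurableSet_Ioc ?_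
          · exact ((cm.mul cr).norm.integrableOn_Icc).mono_set Set.Ioc_subset_Icc_self
          · intro y hy
            rw [norm_mul]
            gcongr
            refine (nm y hy.2).trans (mul_le_of_le_one_left (Real.exp_pos _).le ?_)
            rw [Real.exp_le_one_iff]
            exact mul_nonpos_of_nonneg_of_nonpos hl.le (by linarith [hy.2])
        _ ≤ ∫ y, Real.exp K * ‖r y‖ :=
          setIntegral_le_integral (ir.norm.const_mul _) (ae_of_all _ fun _ => by positivity)
        _ ≤ _ := by
          rw [integral_const_mul]
          gcongr
  have hlim : Tendsto (fun a : ℝ => Real.exp (l * (a - x)) * Real.exp K * M + Real.exp K * R) atBot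
      (𝓝 (0 * Real.exp K * M + Real.exp K * R)) := by
    refine ((Tendsto.mul_const _ (Tendsto.mul_const _ ?_))).add_const _
    refine Real.tendsto_exp_atBot.comp (Tendsto.const_mul_atBot hl ?_)
    exact tendsto_atBot_add_const_right _ _ tendsto_id
  rw [zero_mul, zero_mul, zero_add] at hlim
  exact ge_of_tendsto hlim ((eventually_le_atBot x).mono main)

/-- The `L¹` norm of a Schwartz function. -/
noncomputable def schwartzL1 (f : 𝓢(ℝ, ℂ)) : ℝ := ∫ x, ‖f x‖

lemma continuous_schwartzL1 : Continuous schwartzL1 := by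
  have h : schwartzL1 = fun f => ‖f.toLpCLM ℂ ℂ 1 volume‖ := by
    ext f
    rw [toLpCLM_apply, norm_toLp, eLpNorm_one_eq_lintegral_enorm, schwartzL1,
      integral_norm_eq_lintegral_enorm f.continuous.aestronglyMeasurable]
  rw [h]
  fun_prop

lemma schwartzL1_add_le (f g : 𝓢(ℝ, ℂ)) : schwartzL1 (f + g) ≤ schwartzL1 f + schwartzL1 g := by
  unfold schwartzL1
  rw [← integral_add f.integrable.norm g.integrable.norm]
  exact integral_mono (f + g).integrable.norm (f.integrable.norm.add g.integrable.norm)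
    fun x => norm_add_le _ _

lemma SchwartzMap.integrable_mul_of_norm_le (f : 𝓢(ℝ, ℂ)) {g : ℝ → ℂ} (cg : Continuous g) {C : ℝ}
    (hg : ∀ x, ‖g x‖ ≤ C) : Integrable (fun x => f x * g x) :=
  f.integrable.mul_bdd cg.aestronglyMeasurable (ae_of_all _ hg)

lemma integral_norm_mul_le (f : 𝓢(ℝ, ℂ)) {g : ℝ → ℂ} (cg : Continuous g) {C : ℝ}
    (hg : ∀ x, ‖g x‖ ≤ C) : ∫ x, ‖f x * g x‖ ≤ C * schwartzL1 f := by
  unfold schwartzL1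
  rw [← integral_const_mul]
  refine integral_mono (f.integrable_mul_of_norm_le cg hg).norm (f.integrable.norm.const_mul _)
    fun x => ?_
  simp only [norm_mul]
  rw [mul_comm]
  gcongr
  exact hg x

lemma norm_integral_mul_le (f : 𝓢(ℝ, ℂ)) {g : ℝ → ℂ} (cg : Continuous g) {C : ℝ}
    (hg : ∀ x, ‖g x‖ ≤ C) : ‖∫ x, f x * g x‖ ≤ C * schwartzL1 f :=
  (norm_integral_le_integral_norm _).trans (integral_norm_mul_le f cg hg)

/-! ### Zero curvature and the conservation law -/

/-- Zero-curvature representation for the AKNS system: with `a' = q c - p b`, the velocities of `q`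
and `p` are `b' + l b + 2 (α + a) q` and `c' - l c - 2 (α + a) p`. -/
structure IsZeroCurvature (l : ℝ) (α : ℂ) (p q pt qt a b c : 𝓢(ℝ, ℂ)) : Prop where
  deriv_a : ∀ x, deriv a x = q x * c x - b x * p x
  qt_eq : ∀ x, qt x = deriv b x + l * b x + 2 * (α + a x) * q x
  pt_eq : ∀ x, pt x = deriv c x - l * c x - 2 * (α + a x) * p x

namespace IsZeroCurvature

variable {l : ℝ} {α : ℂ} {p q pt qt a b c : 𝓢(ℝ, ℂ)}

/-- The expression b + 2(α + a)w - c w² is the candidate for the time derivative of w: it satisfies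
the equation obtained by differentiating the Riccati equation formally in time. -/
lemma hasDerivAt_velocity (h : IsZeroCurvature l α p q pt qt a b c) {w : ℝ → ℂ}
    (hw : IsDecayingRiccati l p q w) (x : ℝ) :
    HasDerivAt (fun x => b x + 2 * (α + a x) * w x - c x * w x ^ 2)
      (-(l + 2 * p x * w x) * (b x + 2 * (α + a x) * w x - c x * w x ^ 2)
        + qt x - pt x * w x ^ 2) x := by
  have dw := hw.hasDerivAt x
  have := ((b.hasDerivAt x).add ((((a.hasDerivAt x).const_add α).const_mul 2).mul dw)).sub
    ((c.hasDerivAt x).mul (dw.pow 2))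
  refine this.congr_deriv ?_
  rw [h.qt_eq, h.pt_eq, h.deriv_a]
  simp only [Pi.pow_apply, Nat.cast_ofNat, Nat.add_one_sub_one, pow_one]
  ring

lemma continuous_riccati {w : ℝ → ℂ} (hw : IsDecayingRiccati l p q w) : Continuous w :=
  continuous_iff_continuousAt.2 fun y => (hw.hasDerivAt y).continuousAt

lemma exists_norm_velocity_le {w : ℝ → ℂ} (hw : IsDecayingRiccati l p q w) (α : ℂ)
    (a b c : 𝓢(ℝ, ℂ)) :
    ∃ M, ∀ x, ‖b x + 2 * (α + a x) * w x - c x * w x ^ 2‖ ≤ M := by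
  refine ⟨SchwartzMap.seminorm ℝ 0 0 b + 2 * (‖α‖ + SchwartzMap.seminorm ℝ 0 0 a) * 1 +
    SchwartzMap.seminorm ℝ 0 0 c * 1 ^ 2, fun x => ?_⟩
  refine (norm_sub_le _ _).trans (add_le_add ((norm_add_le _ _).trans (add_le_add ?_ ?_)) ?_)
  · exact norm_le_seminorm ℝ b x
  · rw [norm_mul, norm_mul, Complex.norm_ofNat]
    have := (norm_add_le α (a x)).trans (add_le_add_right (norm_le_seminorm ℝ a x) _)
    have := hw.norm_le x
    gcongr
  · rw [norm_mul, norm_pow]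
    have := norm_le_seminorm ℝ c x
    have := hw.norm_le x
    have : 0 ≤ SchwartzMap.seminorm ℝ 0 0 c := apply_nonneg _ _
    gcongr

/-- The integrand, formally the time derivative of p w, is the x-derivative of c w - a, which
vanishes at both ends of the line. -/
lemma integral_density_velocity (h : IsZeroCurvature l α p q pt qt a b c) {w : ℝ → ℂ}
    (hw : IsDecayingRiccati l p q w) :
    ∫ x, (pt x * w x + p x * (b x + 2 * (α + a x) * w x - c x * w x ^ 2)) = 0 := by
  have cw := continuous_riccati hw
  obtain ⟨M, hM⟩ := exists_norm_velocity_le hw α a b c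
  have cP : Continuous (fun x => b x + 2 * (α + a x) * w x - c x * w x ^ 2) :=
    continuous_iff_continuousAt.2 fun y => (h.hasDerivAt_velocity hw y).continuousAt
  have hlim : Tendsto (fun x => c x * w x - a x) (cocompact ℝ) (𝓝 0) := by
    simpa using (c.tendsto_cocompact.mul hw.tendsto).sub a.tendsto_cocompact
  rw [cocompact_eq_atBot_atTop, tendsto_sup] at hlim
  have := integral_of_hasDerivAt_of_tendsto (f := fun x => c x * w x - a x)
    (f' := fun x => pt x * w x + p x * (b x + 2 * (α + a x) * w x - c x * w x ^ 2)) ?_ ?_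
    hlim.1 hlim.2
  · rw [this, sub_zero]
  · intro x
    refine (((c.hasDerivAt x).mul (hw.hasDerivAt x)).sub (a.hasDerivAt x)).congr_deriv ?_
    rw [h.pt_eq, h.deriv_a]
    ring
  · exact (pt.integrable_mul_of_norm_le cw hw.norm_le).add (p.integrable_mul_of_norm_le cP hM)

end IsZeroCurvature

/-! ### Differentiating the conserved quantity in time -/

lemma HasSchwartzDerivAt.tendsto_schwartzL1 {q : ℝ → 𝓢(ℝ, ℂ)} {v : 𝓢(ℝ, ℂ)} {t : ℝ}
    (h : HasSchwartzDerivAt q v t) :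
    Tendsto (fun h : ℝ => schwartzL1 (h⁻¹ • (q (t + h) - q t) - v)) (𝓝[≠] 0) (𝓝 0) := by
  have h0 : schwartzL1 0 = 0 := by simp [schwartzL1]
  have h1 : Tendsto (fun h : ℝ => h⁻¹ • (q (t + h) - q t) - v) (𝓝[≠] 0) (𝓝 0) := by
    simpa using Tendsto.sub_const h v
  simpa [h0, Function.comp_def] using (continuous_schwartzL1.tendsto 0).comp h1

lemma HasSchwartzDerivAt.tendsto_sub {q : ℝ → 𝓢(ℝ, ℂ)} {v : 𝓢(ℝ, ℂ)} {t : ℝ}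
    (h : HasSchwartzDerivAt q v t) :
    Tendsto (fun h : ℝ => q (t + h) - q t) (𝓝[≠] 0) (𝓝 0) := by
  have h1 : Tendsto (fun h : ℝ => h • h⁻¹ • (q (t + h) - q t)) (𝓝[≠] 0) (𝓝 ((0 : ℝ) • v)) :=
    (tendsto_nhdsWithin_of_tendsto_nhds tendsto_id).smul h
  rw [zero_smul] at h1
  refine h1.congr' ?_
  filter_upwards [self_mem_nhdsWithin] with h hh
  rw [smul_inv_smul₀ hh]

lemma HasSchwartzDerivAt.tendsto_schwartzL1_sub {q : ℝ → 𝓢(ℝ, ℂ)} {v : 𝓢(ℝ, ℂ)} {t : ℝ}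
    (h : HasSchwartzDerivAt q v t) :
    Tendsto (fun h : ℝ => schwartzL1 (q (t + h) - q t)) (𝓝[≠] 0) (𝓝 0) := by
  have h0 : schwartzL1 0 = 0 := by simp [schwartzL1]
  simpa [h0, Function.comp_def] using (continuous_schwartzL1.tendsto 0).comp h.tendsto_sub

lemma integral_norm_add_le {f g : ℝ → ℂ} (hf : Integrable f) (hg : Integrable g) :
    ∫ x, ‖f x + g x‖ ≤ (∫ x, ‖f x‖) + ∫ x, ‖g x‖ := by
  rw [← integral_add hf.norm hg.norm]
  exact integral_mono (hf.add hg).norm (hf.norm.add hg.norm) fun x => norm_add_le _ _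

lemma integral_norm_sub_le {f g : ℝ → ℂ} (hf : Integrable f) (hg : Integrable g) :
    ∫ x, ‖f x - g x‖ ≤ (∫ x, ‖f x‖) + ∫ x, ‖g x‖ := by
  rw [← integral_add hf.norm hg.norm]
  exact integral_mono (hf.sub hg).norm (hf.norm.add hg.norm) fun x => norm_sub_le _ _

/-- The difference w₂ - w₁ solves a linear equation with coefficient l + p₂(w₁ + w₂), forced by the
differences of the potentials. The factor 2 in `hK` comes from |w₁ + w₂| ≤ 2. -/
lemma norm_riccati_sub_le {l : ℝ} (hl : 0 < l) {p₁ q₁ p₂ q₂ : 𝓢(ℝ, ℂ)} {w₁ w₂ : ℝ → ℂ}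
    (h₁ : IsDecayingRiccati l p₁ q₁ w₁) (h₂ : IsDecayingRiccati l p₂ q₂ w₂) {K : ℝ}
    (hK : 2 * schwartzL1 p₂ ≤ K) (x : ℝ) :
    ‖w₂ x - w₁ x‖ ≤ Real.exp K * (schwartzL1 (q₂ - q₁) + schwartzL1 (p₂ - p₁)) := by
  have c₁ := IsZeroCurvature.continuous_riccati h₁
  have c₂ := IsZeroCurvature.continuous_riccati h₂
  have b₁ := h₁.norm_le
  have b₂ := h₂.norm_le
  have b₃ (x : ℝ) : ‖w₁ x + w₂ x‖ ≤ 2 := (norm_add_le _ _).trans (by linarith [b₁ x, b₂ x])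
  have b₄ (x : ℝ) : ‖w₁ x ^ 2‖ ≤ 1 := by
    rw [norm_pow]; exact pow_le_one₀ (norm_nonneg _) (b₁ x)
  have i₃ := (p₂ - p₁).integrable_mul_of_norm_le (c₁.pow 2) b₄
  refine norm_le_of_linear_ode hl (e := fun x => w₂ x - w₁ x) (M := 2)
    (θ := fun x => p₂ x * (w₁ x + w₂ x))
    (r := fun x => (q₂ - q₁) x - (p₂ - p₁) x * w₁ x ^ 2) (fun x => ?_) (fun x => ?_) ?_ ?_ ?_ ?_ ?_ ?_ x
  · refine ((h₂.hasDerivAt x).sub (h₁.hasDerivAt x)).congr_deriv ?_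
    simp only [sub_apply]
    ring
  · exact (norm_sub_le _ _).trans (by linarith [b₁ x, b₂ x])
  · exact p₂.continuous.mul (c₁.add c₂)
  · exact p₂.integrable_mul_of_norm_le (c₁.add c₂) b₃
  · exact (integral_norm_mul_le p₂ (c₁.add c₂) b₃).trans hK
  · exact (q₂ - q₁).continuous.sub ((p₂ - p₁).continuous.mul (c₁.pow 2))
  · exact (q₂ - q₁).integrable.sub i₃
  · exact (integral_norm_sub_le (q₂ - q₁).integrable i₃).trans (add_le_add le_rfl
      ((integral_norm_mul_le (p₂ - p₁) (c₁.pow 2) b₄).trans_eq (one_mul _)))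

/-- The difference quotient and the candidate velocity solve linear equations with coefficients l +
p₂(w₁ + w₂) and l + 2p₁w₁. The mismatch (p₂ - p₁)(w₁ + w₂) + p₁(w₂ - w₁), times the velocity, joins
the forcing term; it accounts for the two terms containing M. -/
lemma norm_riccati_slope_sub_le {l : ℝ} (hl : 0 < l) {p₁ q₁ p₂ q₂ pv qv a b c : 𝓢(ℝ, ℂ)} {α : ℂ}
    {w₁ w₂ : ℝ → ℂ} (h₁ : IsDecayingRiccati l p₁ q₁ w₁) (h₂ : IsDecayingRiccati l p₂ q₂ w₂)
    (hz : IsZeroCurvature l α p₁ q₁ pv qv a b c) {K M S h : ℝ}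
    (hK : 2 * schwartzL1 p₂ ≤ K) (hS : ∀ x, ‖w₂ x - w₁ x‖ ≤ S)
    (hM : ∀ x, ‖b x + 2 * (α + a x) * w₁ x - c x * w₁ x ^ 2‖ ≤ M) (x : ℝ) :
    ‖(h : ℂ)⁻¹ * (w₂ x - w₁ x) - (b x + 2 * (α + a x) * w₁ x - c x * w₁ x ^ 2)‖ ≤
      Real.exp K * (schwartzL1 (h⁻¹ • (q₂ - q₁) - qv) + schwartzL1 (h⁻¹ • (p₂ - p₁) - pv) +
        (2 * M * schwartzL1 (p₂ - p₁) + S * M * schwartzL1 p₁)) := by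
  set P : ℝ → ℂ := fun x => b x + 2 * (α + a x) * w₁ x - c x * w₁ x ^ 2 with hP
  have dP (x : ℝ) : HasDerivAt P (-(l + 2 * p₁ x * w₁ x) * P x + qv x - pv x * w₁ x ^ 2) x :=
    hz.hasDerivAt_velocity h₁ x
  have cP : Continuous P := continuous_iff_continuousAt.2 fun y => (dP y).continuousAt
  have c₁ := IsZeroCurvature.continuous_riccati h₁
  have c₂ := IsZeroCurvature.continuous_riccati h₂
  have b₁ := h₁.norm_le
  have b₂ := h₂.norm_le
  have b₃ (x : ℝ) : ‖w₁ x + w₂ x‖ ≤ 2 := (norm_add_le _ _).trans (by linarith [b₁ x, b₂ x])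
  have b₄ (x : ℝ) : ‖w₁ x ^ 2‖ ≤ 1 := by
    rw [norm_pow]; exact pow_le_one₀ (norm_nonneg _) (b₁ x)
  have hM0 : 0 ≤ M := (norm_nonneg _).trans (hM 0)
  have hS0 : 0 ≤ S := (norm_nonneg _).trans (hS 0)
  have b₅ (x : ℝ) : ‖(w₁ x + w₂ x) * P x‖ ≤ 2 * M := by
    rw [norm_mul]; exact mul_le_mul (b₃ x) (hM x) (norm_nonneg _) (by norm_num)
  have b₆ (x : ℝ) : ‖(w₂ x - w₁ x) * P x‖ ≤ S * M := by
    rw [norm_mul]; exact mul_le_mul (hS x) (hM x) (norm_nonneg _) hS0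
  set Q := h⁻¹ • (q₂ - q₁) - qv with hQ
  set R := h⁻¹ • (p₂ - p₁) - pv with hR
  have i₁ := R.integrable_mul_of_norm_le (c₁.pow 2) b₄
  have i₂ := (p₂ - p₁).integrable_mul_of_norm_le ((c₁.add c₂).mul cP) b₅
  have i₃ := p₁.integrable_mul_of_norm_le ((c₂.sub c₁).mul cP) b₆
  have ir := (Q.integrable.sub i₁).sub (i₂.add i₃)
  refine norm_le_of_linear_ode hl
    (e := fun x => (h : ℂ)⁻¹ * (w₂ x - w₁ x) - P x) (M := ‖(h : ℂ)⁻¹‖ * S + M)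
    (θ := fun x => p₂ x * (w₁ x + w₂ x))
    (r := fun x => (Q x - R x * w₁ x ^ 2) -
      ((p₂ - p₁) x * ((w₁ x + w₂ x) * P x) + p₁ x * ((w₂ x - w₁ x) * P x)))
    (fun x => ?_) (fun x => ?_) ?_ ?_ ?_ ?_ ?_ ?_ x
  · refine ((((h₂.hasDerivAt x).sub (h₁.hasDerivAt x)).const_mul (h : ℂ)⁻¹).sub
      (dP x)).congr_deriv ?_
    simp only [hQ, hR, sub_apply, smul_apply, Complex.real_smul, Complex.ofReal_inv]
    ring
  · refine (norm_sub_le _ _).trans (add_le_add ?_ (hM x))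
    rw [norm_mul]
    gcongr
    exact hS x
  · exact p₂.continuous.mul (c₁.add c₂)
  · exact p₂.integrable_mul_of_norm_le (c₁.add c₂) b₃
  · exact (integral_norm_mul_le p₂ (c₁.add c₂) b₃).trans hK
  · have := Q.continuous
    have := R.continuous
    have := p₁.continuous
    have := (p₂ - p₁).continuous
    fun_prop
  · exact ir
  · refine (integral_norm_sub_le (Q.integrable.sub i₁) (i₂.add i₃)).trans (add_le_add
      ((integral_norm_sub_le Q.integrable i₁).trans (add_le_add le_rfl ?_))
      ((integral_norm_add_le i₂ i₃).trans (add_le_add ?_ ?_)))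
    · exact (integral_norm_mul_le R (c₁.pow 2) b₄).trans_eq (one_mul _)
    · exact integral_norm_mul_le _ ((c₁.add c₂).mul cP) b₅
    · exact integral_norm_mul_le _ ((c₂.sub c₁).mul cP) b₆

/-- Conservation of `∫ p w` along a flow with a zero-curvature representation. -/
theorem hasDerivAt_integral_density {l : ℝ} (hl : 0 < l) {p q : ℝ → 𝓢(ℝ, ℂ)}
    {pv qv a b c : 𝓢(ℝ, ℂ)} {α : ℂ} {t : ℝ} (hp : HasSchwartzDerivAt p pv t)
    (hq : HasSchwartzDerivAt q qv t) {w : ℝ → ℝ → ℂ}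
    (hw : ∀ᶠ τ in 𝓝 t, IsDecayingRiccati l (p τ) (q τ) (w τ))
    (hz : IsZeroCurvature l α (p t) (q t) pv qv a b c) :
    HasDerivAt (fun τ => ∫ x, p τ x * w τ x) 0 t := by
  have h₁ := hw.self_of_nhds
  obtain ⟨M, hM⟩ := IsZeroCurvature.exists_norm_velocity_le h₁ α a b c
  set P : ℝ → ℂ := fun x => b x + 2 * (α + a x) * w t x - c x * w t x ^ 2 with hP
  have cP : Continuous P :=
    continuous_iff_continuousAt.2 fun y => (hz.hasDerivAt_velocity h₁ y).continuousAt
  have c₁ := IsZeroCurvature.continuous_riccati h₁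
  -- The added 1 leaves room for p at nearby times, whose L¹ norm exceeds that of p t by less than
  -- 1.
  set K : ℝ := 2 * (schwartzL1 (p t) + 1) with hK
  have tq := hq.tendsto_schwartzL1_sub
  have tp := hp.tendsto_schwartzL1_sub
  have tq' := hq.tendsto_schwartzL1
  have tp' := hp.tendsto_schwartzL1
  set S : ℝ → ℝ := fun h => Real.exp K *
    (schwartzL1 (q (t + h) - q t) + schwartzL1 (p (t + h) - p t)) with hS
  have tS : Tendsto S (𝓝[≠] 0) (𝓝 0) := by
    simpa using (tq.add tp).const_mul (Real.exp K)
  set R : ℝ → ℝ := fun h => Real.exp K * (schwartzL1 (h⁻¹ • (q (t + h) - q t) - qv) +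
    schwartzL1 (h⁻¹ • (p (t + h) - p t) - pv) +
    (2 * M * schwartzL1 (p (t + h) - p t) + S h * M * schwartzL1 (p t))) with hR
  have tR : Tendsto R (𝓝[≠] 0) (𝓝 0) := by
    simpa using ((tq'.add tp').add ((tp.const_mul (2 * M)).add
      ((tS.mul_const M).mul_const (schwartzL1 (p t))))).const_mul (Real.exp K)
  rw [hasDerivAt_iff_tendsto_slope_zero, tendsto_iff_norm_sub_tendsto_zero]
  have tall : Tendsto (fun h => 1 * schwartzL1 (h⁻¹ • (p (t + h) - p t) - pv) +
      S h * schwartzL1 pv + R h * schwartzL1 (p t)) (𝓝[≠] 0) (𝓝 0) := by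
    simpa using ((tp'.const_mul 1).add (tS.mul_const (schwartzL1 pv))).add
      (tR.mul_const (schwartzL1 (p t)))
  have hshift : Tendsto (fun h : ℝ => t + h) (𝓝[≠] 0) (𝓝 t) := by
    have : Tendsto (fun h : ℝ => t + h) (𝓝 0) (𝓝 (t + 0)) := tendsto_id.const_add t
    rw [add_zero] at this
    exact this.mono_left nhdsWithin_le_nhds
  refine squeeze_zero' (Eventually.of_forall fun _ => norm_nonneg _) ?_ tall
  filter_upwards [hshift.eventually hw, (tendsto_order.1 tp).2 1 one_pos] with h h₂ hsmall
  have c₂ := IsZeroCurvature.continuous_riccati h₂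
  have hK' : 2 * schwartzL1 (p (t + h)) ≤ K := by
    have := schwartzL1_add_le (p t) (p (t + h) - p t)
    rw [add_sub_cancel] at this
    rw [hK]
    linarith
  have bS (x : ℝ) : ‖w (t + h) x - w t x‖ ≤ S h := norm_riccati_sub_le hl h₁ h₂ hK' x
  have bR (x : ℝ) : ‖(h : ℂ)⁻¹ * (w (t + h) x - w t x) - P x‖ ≤ R h :=
    norm_riccati_slope_sub_le hl h₁ h₂ hz hK' bS hM x
  set D := h⁻¹ • (p (t + h) - p t) - pv with hD
  have cR : Continuous fun x => (h : ℂ)⁻¹ * (w (t + h) x - w t x) - P x := by fun_prop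
  have i₁ := D.integrable_mul_of_norm_le c₂ h₂.norm_le
  have i₂ := pv.integrable_mul_of_norm_le (c₂.sub c₁) bS
  have i₃ := (p t).integrable_mul_of_norm_le cR bR
  have i₄ := (p (t + h)).integrable_mul_of_norm_le c₂ h₂.norm_le
  have i₅ := (p t).integrable_mul_of_norm_le c₁ h₁.norm_le
  have i₆ : Integrable fun x => pv x * w t x + p t x * P x :=
    (pv.integrable_mul_of_norm_le c₁ h₁.norm_le).add ((p t).integrable_mul_of_norm_le cP hM)
  -- Subtracting the vanishing integral `hzero` leaves three terms, each containing a quantity that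
  -- tends to 0.
  have e : h⁻¹ • ((∫ x, p (t + h) x * w (t + h) x) - ∫ x, p t x * w t x) - 0 =
      (∫ x, D x * w (t + h) x) + (∫ x, pv x * (w (t + h) x - w t x)) +
        ∫ x, p t x * ((h : ℂ)⁻¹ * (w (t + h) x - w t x) - P x) := by
    have hzero := hz.integral_density_velocity h₁
    have e₁ : h⁻¹ • ((∫ x, p (t + h) x * w (t + h) x) - ∫ x, p t x * w t x) =
        ∫ x, h⁻¹ • (p (t + h) x * w (t + h) x - p t x * w t x) := by
      rw [integral_smul, integral_sub i₄ i₅]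
    have j : Integrable fun x => h⁻¹ • (p (t + h) x * w (t + h) x - p t x * w t x) :=
      (i₄.sub i₅).smul h⁻¹
    have e₂ := integral_sub j i₆
    have e₃ := integral_add i₁ i₂
    have e₄ := integral_add (i₁.add i₂) i₃
    simp only [Pi.add_apply, Pi.sub_apply] at e₃ e₄
    rw [e₁, ← hzero, ← e₂, ← e₃, ← e₄]
    congr 1
    ext x
    simp only [hD, sub_apply, smul_apply, Complex.real_smul, Complex.ofReal_inv]
    ring
  rw [e]
  refine (norm_add_le _ _).trans (add_le_add ((norm_add_le _ _).trans (add_le_add ?_ ?_)) ?_)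
  · exact norm_integral_mul_le D c₂ h₂.norm_le
  · exact norm_integral_mul_le pv (c₂.sub c₁) bS
  · exact norm_integral_mul_le (p t) cR bR

/-! ### The two equations as AKNS flows -/

/-- The second AKNS potential `p = ε conj q`. -/
noncomputable def conjPot (ε : ℝ) (q : 𝓢(ℝ, ℂ)) : 𝓢(ℝ, ℂ) := (ε : ℂ) • schwartzConj q

lemma conjPot_apply (ε : ℝ) (q : 𝓢(ℝ, ℂ)) (x : ℝ) :
    conjPot ε q x = ε * (starRingEnd ℂ) (q x) := rfl

lemma sob_conjPot (l θ : ℝ) {ε : ℝ} (hε : ε = 1 ∨ ε = -1) (q : 𝓢(ℝ, ℂ)) :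
    sob l θ (conjPot ε q) = sob l θ q := by
  rw [conjPot, sob_const_smul, sob_schwartzConj]
  rcases hε with rfl | rfl <;> simp

lemma HasSchwartzDerivAt.conjPot (ε : ℝ) {q : ℝ → 𝓢(ℝ, ℂ)} {v : 𝓢(ℝ, ℂ)} {t : ℝ}
    (h : HasSchwartzDerivAt q v t) :
    HasSchwartzDerivAt (fun t => conjPot ε (q t)) (conjPot ε v) t := by
  have hc : Continuous (fun f : 𝓢(ℝ, ℂ) => _root_.conjPot ε f) :=
    (SchwartzMap.postcompCLM (E := ℝ) (Complex.conjCLE : ℂ →L[ℝ] ℂ)).continuous.const_smul (ε : ℂ)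
  refine ((hc.tendsto v).comp h).congr fun τ => ?_
  ext x
  simp only [Function.comp_apply, conjPot_apply, smul_apply, sub_apply, Complex.real_smul,
    map_mul, map_sub, Complex.conj_ofReal]
  ring

lemma hasDerivAt_derivCLM (q : 𝓢(ℝ, ℂ)) (x : ℝ) : HasDerivAt q (derivCLM ℂ ℂ q x) x :=
  q.hasDerivAt x

lemma hasDerivAt_conjPot (ε : ℝ) (q : 𝓢(ℝ, ℂ)) (x : ℝ) :
    HasDerivAt (conjPot ε q) (conjPot ε (derivCLM ℂ ℂ q) x) x :=
  ((hasDerivAt_derivCLM q x).star).const_mul (ε : ℂ)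

lemma coe_derivCLM (q : 𝓢(ℝ, ℂ)) : (derivCLM ℂ ℂ q : ℝ → ℂ) = deriv q := by
  ext x; simp

lemma isZeroCurvature_nls (l ε : ℝ) {q v : 𝓢(ℝ, ℂ)}
    (h : ∀ x : ℝ, -Complex.I * v x =
      -iteratedDeriv 2 q x + (ε : ℂ) * 2 * ((‖q x‖ ^ 2 : ℝ) : ℂ) * q x) :
    ∃ α : ℂ, ∃ a b c : 𝓢(ℝ, ℂ), IsZeroCurvature l α (conjPot ε q) q (conjPot ε v) v a b c := by
  set q₁ := derivCLM ℂ ℂ q with hq₁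
  set q₂ := derivCLM ℂ ℂ q₁ with hq₂
  have hv (x : ℝ) : v x = -Complex.I * q₂ x + 2 * Complex.I * (conjPot ε q x * q x) * q x := by
    have h1 := h x
    rw [iteratedDeriv_succ, iteratedDeriv_one, ← coe_derivCLM, ← coe_derivCLM, ← hq₁, ← hq₂,
      ← Complex.normSq_eq_norm_sq, Complex.normSq_eq_conj_mul_self] at h1
    rw [conjPot_apply]
    linear_combination Complex.I * h1 + v x * Complex.I_sq
  have d₀ := hasDerivAt_derivCLM q
  have d₁ := hasDerivAt_derivCLM q₁
  have e₀ := hasDerivAt_conjPot ε q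
  have e₁ := hasDerivAt_conjPot ε q₁
  rw [← hq₁] at d₀ e₀
  rw [← hq₂] at d₁ e₁
  -- The constant α cancels the term i l² q arising from l b; it is kept apart so that a remains a
  -- Schwartz function.
  refine ⟨-(Complex.I * l ^ 2 / 2), Complex.I • schwartzMul (conjPot ε q) q,
    (Complex.I * l) • q - Complex.I • q₁,
    (Complex.I * l) • conjPot ε q + Complex.I • conjPot ε q₁, fun x => ?_, fun x => ?_,
    fun x => ?_⟩
  · have := ((e₀ x).mul (d₀ x)).const_mul Complex.I
    refine this.deriv.trans ?_
    simp only [add_apply, sub_apply, smul_apply, smul_eq_mul]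
    ring
  · have := ((d₀ x).const_mul (Complex.I * l)).sub ((d₁ x).const_mul Complex.I)
    rw [show deriv ((Complex.I * l) • q - Complex.I • q₁ : 𝓢(ℝ, ℂ)) x = _ from this.deriv, hv]
    simp only [sub_apply, smul_apply, smul_eq_mul, schwartzMul_apply]
    ring
  · have := ((e₀ x).const_mul (Complex.I * l)).add ((e₁ x).const_mul Complex.I)
    rw [show deriv ((Complex.I * l) • conjPot ε q + Complex.I • conjPot ε q₁ : 𝓢(ℝ, ℂ)) x = _
      from this.deriv, conjPot_apply ε v, hv]
    simp only [add_apply, smul_apply, smul_eq_mul, schwartzMul_apply, conjPot_apply, map_add,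
      map_mul, map_neg, Complex.conj_I, Complex.conj_ofReal, Complex.conj_conj, Complex.conj_ofNat]
    ring

lemma isZeroCurvature_hirota (l ε : ℝ) {q v : 𝓢(ℝ, ℂ)}
    (h : ∀ x : ℝ, v x =
      -iteratedDeriv 3 q x + (ε : ℂ) * 6 * ((‖q x‖ ^ 2 : ℝ) : ℂ) * deriv q x) :
    ∃ α : ℂ, ∃ a b c : 𝓢(ℝ, ℂ), IsZeroCurvature l α (conjPot ε q) q (conjPot ε v) v a b c := by
  set q₁ := derivCLM ℂ ℂ q with hq₁
  set q₂ := derivCLM ℂ ℂ q₁ with hq₂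
  set q₃ := derivCLM ℂ ℂ q₂ with hq₃
  have hv (x : ℝ) : v x = -q₃ x + 6 * (conjPot ε q x * q x) * q₁ x := by
    have h1 := h x
    rw [iteratedDeriv_succ, iteratedDeriv_succ, iteratedDeriv_one, ← coe_derivCLM, ← coe_derivCLM,
      ← coe_derivCLM, ← hq₁, ← hq₂, ← hq₃, ← Complex.normSq_eq_norm_sq,
      Complex.normSq_eq_conj_mul_self] at h1
    rw [conjPot_apply, h1]
    ring
  have d₀ := hasDerivAt_derivCLM q
  have d₁ := hasDerivAt_derivCLM q₁
  have d₂ := hasDerivAt_derivCLM q₂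
  have e₀ := hasDerivAt_conjPot ε q
  have e₁ := hasDerivAt_conjPot ε q₁
  have e₂ := hasDerivAt_conjPot ε q₂
  rw [← hq₁] at d₀ e₀
  rw [← hq₂] at d₁ e₁
  rw [← hq₃] at d₂ e₂
  set p := conjPot ε q with hp
  set p₁ := conjPot ε q₁ with hp₁
  set p₂ := conjPot ε q₂ with hp₂
  -- Here α cancels -l³ q from l b. The lower powers of l cancel between the derivative terms, l b
  -- and 2 a q.
  refine ⟨(l : ℂ) ^ 3 / 2,
    schwartzMul p q₁ - schwartzMul p₁ q - (l : ℂ) • schwartzMul p q,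
    -q₂ + (l : ℂ) • q₁ - ((l : ℂ) ^ 2) • q + (2 : ℂ) • schwartzMul p (schwartzMul q q),
    -p₂ - (l : ℂ) • p₁ - ((l : ℂ) ^ 2) • p + (2 : ℂ) • schwartzMul (schwartzMul p p) q,
    fun x => ?_, fun x => ?_, fun x => ?_⟩
  · have := (((e₀ x).mul (d₁ x)).sub ((e₁ x).mul (d₀ x))).sub
      (((e₀ x).mul (d₀ x)).const_mul (l : ℂ))
    refine this.deriv.trans ?_
    simp only [add_apply, sub_apply, neg_apply, smul_apply, smul_eq_mul, schwartzMul_apply]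
    ring
  · have := (((d₂ x).neg.add ((d₁ x).const_mul (l : ℂ))).sub ((d₀ x).const_mul ((l : ℂ) ^ 2))).add
      (((e₀ x).mul ((d₀ x).mul (d₀ x))).const_mul 2)
    rw [show deriv (-q₂ + (l : ℂ) • q₁ - ((l : ℂ) ^ 2) • q +
      (2 : ℂ) • schwartzMul p (schwartzMul q q) : 𝓢(ℝ, ℂ)) x = _ from this.deriv, hv]
    simp only [add_apply, sub_apply, neg_apply, smul_apply, smul_eq_mul, schwartzMul_apply,
      Pi.mul_apply]
    ring
  · have := (((e₂ x).neg.sub ((e₁ x).const_mul (l : ℂ))).sub ((e₀ x).const_mul ((l : ℂ) ^ 2))).add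
      ((((e₀ x).mul (e₀ x)).mul (d₀ x)).const_mul 2)
    rw [show deriv (-p₂ - (l : ℂ) • p₁ - ((l : ℂ) ^ 2) • p +
      (2 : ℂ) • schwartzMul (schwartzMul p p) q : 𝓢(ℝ, ℂ)) x = _ from this.deriv,
      conjPot_apply ε v, hv]
    simp only [add_apply, sub_apply, neg_apply, smul_apply, smul_eq_mul, schwartzMul_apply,
      Pi.mul_apply, hp, hp₁, hp₂, conjPot_apply, map_add,
      map_mul, map_neg, Complex.conj_ofReal, Complex.conj_conj, Complex.conj_ofNat]
    ring

lemma exists_isZeroCurvature {ε : ℝ} {q : ℝ → 𝓢(ℝ, ℂ)}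
    (h : IsSchwartzSolutionNLS ε q ∨ IsSchwartzSolutionHirota ε q) (l t : ℝ) :
    ∃ v : 𝓢(ℝ, ℂ), HasSchwartzDerivAt q v t ∧ ∃ α : ℂ, ∃ a b c : 𝓢(ℝ, ℂ),
      IsZeroCurvature l α (conjPot ε (q t)) (q t) (conjPot ε v) v a b c := by
  rcases h with h | h
  · obtain ⟨v, hv, hx⟩ := h t
    exact ⟨v, hv, isZeroCurvature_nls l ε hx⟩
  · obtain ⟨v, hv, hx⟩ := h t
    exact ⟨v, hv, isZeroCurvature_hirota l ε hx⟩

/-! ### Almost conservation at a single scale -/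

/-- The square root of the leading term of the conserved quantity at scale `l`. -/
noncomputable def leadNorm (l : ℝ) (f : 𝓢(ℝ, ℂ)) : ℝ≥0∞ := ENNReal.ofReal l * sob l (-1) f

/-- The scale-invariant form of the `H^{-σ}` norm at scale `l`. -/
noncomputable def errNorm (l σ : ℝ) (f : 𝓢(ℝ, ℂ)) : ℝ≥0∞ := ENNReal.ofReal (l ^ σ) * sob l (-σ) f

lemma sob_zero_eq (l : ℝ) (f : 𝓢(ℝ, ℂ)) : sob l 0 f = ‖(𝓕 f).toLpCLM ℂ ℂ 2 volume‖ₑ := by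
  rw [toLpCLM_apply, ← ofReal_norm, norm_toLp, ENNReal.ofReal_toReal ((𝓕 f).eLpNorm_lt_top _ _).ne,
    eLpNorm_eq_lintegral_rpow_enorm_toReal (by norm_num) (by norm_num)]
  simp [sob, l2, japPow_zero]

lemma continuous_sob_zero (l : ℝ) : Continuous (sob l 0) := by
  rw [funext (sob_zero_eq l)]
  fun_prop

/-- The reverse triangle inequality bounds the variation of N by C times the L² norm of the
difference, and that norm is continuous on Schwartz space. -/
lemma continuous_of_subadditive {l : ℝ} {N : 𝓢(ℝ, ℂ) → ℝ≥0∞} {C : ℝ≥0∞} (hC : C ≠ ∞)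
    (hadd : ∀ f g, N (f + g) ≤ N f + N g) (hneg : ∀ f, N (-f) = N f)
    (hle : ∀ f, N f ≤ C * sob l 0 f) : Continuous N := by
  have hfin (f) : N f ≠ ∞ := by
    refine ne_top_of_le_ne_top (ENNReal.mul_ne_top hC ?_) (hle f)
    rw [sob_zero_eq]
    exact enorm_ne_top
  refine continuous_iff_continuousAt.2 fun g => ?_
  rw [ContinuousAt, ENNReal.tendsto_nhds (hfin g)]
  intro δ hδ
  have h0 : sob l 0 (0 : 𝓢(ℝ, ℂ)) = 0 := by
    simpa using sob_const_smul l 0 0 (0 : 𝓢(ℝ, ℂ))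
  have ht : Tendsto (fun f => C * sob l 0 (f - g)) (𝓝 g) (𝓝 0) := by
    have h1 : Tendsto (fun f => sob l 0 (f - g)) (𝓝 g) (𝓝 0) := by
      have : Continuous (fun f : 𝓢(ℝ, ℂ) => sob l 0 (f - g)) :=
        (continuous_sob_zero l).comp (continuous_id.sub continuous_const)
      simpa [h0] using this.tendsto g
    simpa using ENNReal.Tendsto.const_mul h1 (Or.inr hC)
  filter_upwards [(tendsto_order.1 ht).2 δ hδ] with f hf
  have hN : N (f - g) ≤ δ := (hle _).trans hf.le
  refine ⟨tsub_le_iff_right.2 ?_, ?_⟩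
  · calc N g = N (f + -(f - g)) := by congr 1; abel
      _ ≤ N f + N (-(f - g)) := hadd _ _
      _ ≤ N f + δ := by rw [hneg]; gcongr
  · calc N f = N (g + (f - g)) := by congr 1; abel
      _ ≤ N g + N (f - g) := hadd _ _
      _ ≤ N g + δ := by gcongr

lemma sob_neg (l θ : ℝ) (f : 𝓢(ℝ, ℂ)) : sob l θ (-f) = sob l θ f := by
  simpa using sob_const_smul l θ (-1) f

lemma sob_le_sob_zero {l θ : ℝ} (hl : 0 < l) (hθ : θ ≤ 0) (f : 𝓢(ℝ, ℂ)) :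
    sob l θ f ≤ ENNReal.ofReal (l ^ θ) * sob l 0 f := by
  unfold sob
  rw [← l2_const_mul _ (by fun_prop)]
  refine l2_mono fun ξ => ?_
  rw [japPow_zero, mul_one, mul_comm]
  gcongr
  exact ENNReal.ofReal_le_ofReal (Real.rpow_le_rpow_of_nonpos hl (le_jap l ξ) hθ)

lemma continuous_sob {l θ : ℝ} (hl : 0 < l) (hθ : θ ≤ 0) : Continuous (sob l θ) :=
  continuous_of_subadditive ENNReal.ofReal_ne_top (sob_add_le l θ) (sob_neg l θ)
    (sob_le_sob_zero hl hθ)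

lemma continuous_of_hasSchwartzDerivAt {q : ℝ → 𝓢(ℝ, ℂ)}
    (h : ∀ t, ∃ v, HasSchwartzDerivAt q v t) : Continuous q := by
  refine continuous_iff_continuousAt.2 fun t => ?_
  obtain ⟨v, hv⟩ := h t
  rw [continuousAt_iff_punctured_nhds]
  have h1 : Tendsto (fun τ : ℝ => τ - t) (𝓝[≠] t) (𝓝[≠] 0) := by
    refine tendsto_nhdsWithin_iff.2 ⟨?_, ?_⟩
    · have : Tendsto (fun τ : ℝ => τ - t) (𝓝 t) (𝓝 (t - t)) := tendsto_id.sub_const t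
      rw [sub_self] at this
      exact this.mono_left nhdsWithin_le_nhds
    · filter_upwards [self_mem_nhdsWithin] with τ hτ
      exact sub_ne_zero.2 hτ
  simpa using (hv.tendsto_sub.comp h1).add_const (q t)

lemma re_conj_mul_fourier_resolv {l : ℝ} (hl : 0 < l) (q : 𝓢(ℝ, ℂ)) (ξ : ℝ) :
    ((starRingEnd ℂ) (𝓕 q ξ) * 𝓕 (resolv l q) ξ).re = ‖𝓕 q ξ‖ ^ 2 * (l / jap l ξ ^ 2) := by
  rw [fourier_resolv hl, mul_left_comm, ← Complex.normSq_eq_conj_mul_self,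
    Complex.normSq_eq_norm_sq, mul_comm, Complex.re_ofReal_mul, Complex.inv_re,
    Complex.normSq_eq_norm_sq, ← jap]
  simp [resSymbol]

lemma integrable_conj_mul_fourier_resolv (l : ℝ) (q : 𝓢(ℝ, ℂ)) :
    Integrable (fun ξ => (starRingEnd ℂ) (𝓕 q ξ) * 𝓕 (resolv l q) ξ) :=
  (schwartzMul (schwartzConj (𝓕 q)) (𝓕 (resolv l q))).integrable

lemma integral_conj_mul_resolv {l : ℝ} (hl : 0 < l) (q : 𝓢(ℝ, ℂ)) :
    (∫ x, schwartzConj q x * resolv l q x).re = ∫ ξ, ‖𝓕 q ξ‖ ^ 2 * (l / jap l ξ ^ 2) := by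
  have h1 : ∫ x, schwartzConj q x * resolv l q x =
      ∫ ξ, (starRingEnd ℂ) (𝓕 q ξ) * 𝓕 (resolv l q) ξ := by
    have := integral_inner_fourier_fourier q (resolv l q)
    simp only [RCLike.inner_apply] at this
    simp only [schwartzConj_apply]
    simp_rw [mul_comm ((starRingEnd ℂ) _)]
    exact this.symm
  rw [h1]
  have := integral_re (integrable_conj_mul_fourier_resolv l q)
  simp only [RCLike.re_to_complex] at this
  rw [← this]
  simp_rw [re_conj_mul_fourier_resolv hl]

/-- Plancherel, together with Re (l + 2πiξ)⁻¹ = l / `jap l ξ`². -/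
lemma leadNorm_sq {l : ℝ} (hl : 0 < l) (q : 𝓢(ℝ, ℂ)) :
    leadNorm l q ^ 2 = ENNReal.ofReal (l * (∫ x, schwartzConj q x * resolv l q x).re) := by
  have hi : Integrable (fun ξ => ‖𝓕 q ξ‖ ^ 2 * (l / jap l ξ ^ 2)) := by
    refine (integrable_conj_mul_fourier_resolv l q).re.congr (ae_of_all _ fun ξ => ?_)
    exact re_conj_mul_fourier_resolv hl q ξ
  rw [integral_conj_mul_resolv hl, ENNReal.ofReal_mul hl.le,
    ofReal_integral_eq_lintegral_ofReal hi (ae_of_all _ fun ξ => by positivity), leadNorm, mul_pow,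
    ← ENNReal.rpow_two (x := sob _ _ _), sob, l2_sq, sq, mul_assoc,
    ← lintegral_const_mul _ (by fun_prop)]
  congr 2
  ext ξ
  rw [ENNReal.rpow_two, mul_pow, japPow, ← ofReal_norm, ← ENNReal.ofReal_pow (norm_nonneg _),
    ← ENNReal.ofReal_pow (Real.rpow_nonneg (jap_nonneg _ _) _),
    ← ENNReal.ofReal_mul (by positivity), ← ENNReal.ofReal_mul hl.le]
  congr 1
  rw [Real.rpow_neg_one]
  ring

/-- The prefactor l · l^{2σ-1} equals (l^σ)², so the remainder becomes 32 (`embConst` · `sob`)²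
`errNorm`², and the smallness hypothesis bounds it by (η `errNorm`)². -/
lemma leadNorm_sq_approx {l σ : ℝ} (hl : 0 < l) {ε : ℝ}
    (hε : ε = 1 ∨ ε = -1) {η : ℝ≥0∞} (q : 𝓢(ℝ, ℂ))
    (hq : 16 * (embConst l σ * sob l (-σ) q) ≤ η) {w : ℝ → ℂ}
    (hw : ‖(∫ x, conjPot ε q x * w x) - ∫ x, conjPot ε q x * resolv l q x‖ₑ ≤
        32 * ENNReal.ofReal (l ^ (2 * σ - 1)) * (embConst l σ * sob l (-σ) q) ^ 2 *
          sob l (-σ) q ^ 2) :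
    leadNorm l q ^ 2 ≤ ENNReal.ofReal (l * (ε * (∫ x, conjPot ε q x * w x).re)) +
        (η * errNorm l σ q) ^ 2 ∧
      ENNReal.ofReal (l * (ε * (∫ x, conjPot ε q x * w x).re)) ≤
        leadNorm l q ^ 2 + (η * errNorm l σ q) ^ 2 := by
  have hεε : ε * ε = 1 := by rcases hε with rfl | rfl <;> norm_num
  set A := ∫ x, conjPot ε q x * w x with hA
  set B := ∫ x, conjPot ε q x * resolv l q x with hB
  set Q := ∫ x, schwartzConj q x * resolv l q x with hQ
  have hBQ : B = ε * Q := by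
    rw [hB, hQ, ← integral_const_mul]
    congr 1
    ext x
    rw [conjPot_apply, schwartzConj_apply, mul_assoc]
  have hQre : Q.re = ε * B.re := by
    rw [hBQ, Complex.re_ofReal_mul, ← mul_assoc, hεε, one_mul]
  have hbound : ENNReal.ofReal (l * ‖A - B‖) ≤ (η * errNorm l σ q) ^ 2 := by
    rw [ENNReal.ofReal_mul hl.le, ofReal_norm]
    have e : ENNReal.ofReal l * ENNReal.ofReal (l ^ (2 * σ - 1)) = ENNReal.ofReal (l ^ σ) ^ 2 := by
      rw [← ENNReal.ofReal_mul hl.le, ← ENNReal.ofReal_pow (by positivity)]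
      congr 1
      rw [← Real.rpow_natCast (l ^ σ), ← Real.rpow_mul hl.le]
      nth_rewrite 1 [← Real.rpow_one l]
      rw [← Real.rpow_add hl]
      congr 1
      push_cast
      ring
    calc _ ≤ ENNReal.ofReal l * (32 * ENNReal.ofReal (l ^ (2 * σ - 1)) *
          (embConst l σ * sob l (-σ) q) ^ 2 * sob l (-σ) q ^ 2) := by gcongr
      _ = 32 * (embConst l σ * sob l (-σ) q) ^ 2 *
          ((ENNReal.ofReal l * ENNReal.ofReal (l ^ (2 * σ - 1))) * sob l (-σ) q ^ 2) := by ring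
      _ = 32 * (embConst l σ * sob l (-σ) q) ^ 2 * errNorm l σ q ^ 2 := by
        rw [e, errNorm, mul_pow (ENNReal.ofReal _)]
      _ ≤ 256 * (embConst l σ * sob l (-σ) q) ^ 2 * errNorm l σ q ^ 2 := by
        gcongr
        norm_num
      _ = (16 * (embConst l σ * sob l (-σ) q)) ^ 2 * errNorm l σ q ^ 2 := by ring
      _ ≤ η ^ 2 * errNorm l σ q ^ 2 := by gcongr
      _ = _ := by ring
  have habs : |l * (ε * A.re) - l * Q.re| ≤ l * ‖A - B‖ := by
    have e1 : l * (ε * A.re) - l * Q.re = l * (ε * (A - B).re) := by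
      rw [hQre, Complex.sub_re]; ring
    have e2 : |ε| = 1 := by rcases hε with rfl | rfl <;> simp
    rw [e1, abs_mul, abs_mul, e2, one_mul, abs_of_pos hl]
    gcongr
    exact Complex.abs_re_le_norm _
  rw [leadNorm_sq hl, ← hQ]
  constructor
  · calc _ ≤ ENNReal.ofReal (l * (ε * A.re) + l * ‖A - B‖) :=
          ENNReal.ofReal_le_ofReal (by linarith [(abs_le.1 habs).1])
      _ ≤ _ := ENNReal.ofReal_add_le
      _ ≤ _ := by gcongr
  · calc _ ≤ ENNReal.ofReal (l * Q.re + l * ‖A - B‖) :=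
          ENNReal.ofReal_le_ofReal (by linarith [(abs_le.1 habs).2])
      _ ≤ _ := ENNReal.ofReal_add_le
      _ ≤ _ := by gcongr

/-- Almost conservation of the leading term as long as the solution stays small at scale `l`. -/
theorem leadNorm_le_of_small {l σ : ℝ} (hl : 0 < l) (h0 : 0 ≤ σ) (h1 : σ < 1 / 2) {ε : ℝ}
    (hε : ε = 1 ∨ ε = -1) {q : ℝ → 𝓢(ℝ, ℂ)}
    (h : IsSchwartzSolutionNLS ε q ∨ IsSchwartzSolutionHirota ε q) {η : ℝ≥0∞} (hη : η < 1) (t : ℝ)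
    (hsmall : ∀ τ ∈ Set.uIcc 0 t, 16 * (embConst l σ * sob l (-σ) (q τ)) ≤ η) :
    leadNorm l (q t) ≤ leadNorm l (q 0) + η * (errNorm l σ (q 0) + errNorm l σ (q t)) := by
  have hc : embConst l σ ≠ ∞ := by
    rw [embConst_eq hl]
    exact ENNReal.mul_ne_top ENNReal.ofReal_ne_top (embConst_one_lt_top h1).ne
  have hw (τ : ℝ) : ∃ w : ℝ → ℂ, 16 * (embConst l σ * sob l (-σ) (q τ)) ≤ 1 →
      IsDecayingRiccati l (conjPot ε (q τ)) (q τ) w ∧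
      ‖(∫ x, conjPot ε (q τ) x * w x) - ∫ x, conjPot ε (q τ) x * resolv l (q τ) x‖ₑ ≤
        32 * ENNReal.ofReal (l ^ (2 * σ - 1)) * (embConst l σ * sob l (-σ) (q τ)) ^ 2 *
          sob l (-σ) (q τ) ^ 2 := by
    by_cases hτ : 16 * (embConst l σ * sob l (-σ) (q τ)) ≤ 1
    · obtain ⟨w, hw⟩ := exists_isDecayingRiccati hl h0 h1.le (sob_conjPot l (-σ) hε (q τ)).le le_rfl hτ
      exact ⟨w, fun _ => hw⟩
    · exact ⟨0, fun h => absurd h hτ⟩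
  choose w hw using hw
  have cq : Continuous q := continuous_of_hasSchwartzDerivAt fun τ => by
    obtain ⟨v, hv, -⟩ := exists_isZeroCurvature h l τ
    exact ⟨v, hv⟩
  have cs : Continuous fun τ => 16 * (embConst l σ * sob l (-σ) (q τ)) := by
    have := (continuous_sob hl (neg_nonpos.2 h0)).comp cq
    exact ENNReal.continuous_const_mul (by norm_num) |>.comp
      ((ENNReal.continuous_const_mul hc).comp this)
  have hderiv (τ : ℝ) (hτ : τ ∈ Set.uIcc 0 t) :
      HasDerivAt (fun τ => ∫ x, conjPot ε (q τ) x * w τ x) 0 τ := by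
    obtain ⟨v, hv, α, a, b, c, hz⟩ := exists_isZeroCurvature h l τ
    -- Because η < 1, the condition that provides w persists in a full neighbourhood of τ by
    -- continuity, even at the endpoints of the interval.
    refine hasDerivAt_integral_density hl (hv.conjPot ε) hv ?_ hz
    filter_upwards [(cs.tendsto τ).eventually (gt_mem_nhds ((hsmall τ hτ).trans_lt hη))] with τ' hτ'
    exact (hw τ' hτ'.le).1
  have hconst : (∫ x, conjPot ε (q t) x * w t x) = ∫ x, conjPot ε (q 0) x * w 0 x := by
    have := (convex_uIcc (0 : ℝ) t).norm_image_sub_le_of_norm_hasDerivWithin_le (C := 0)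
      (fun τ hτ => (hderiv τ hτ).hasDerivWithinAt) (by simp) Set.left_mem_uIcc Set.right_mem_uIcc
    rw [zero_mul, norm_le_zero_iff, sub_eq_zero] at this
    exact this
  have s0 := hsmall 0 Set.left_mem_uIcc
  have st := hsmall t Set.right_mem_uIcc
  have k0 := (leadNorm_sq_approx hl hε (q 0) s0 (hw 0 (s0.trans hη.le)).2).2
  have kt := (leadNorm_sq_approx hl hε (q t) st (hw t (st.trans hη.le)).2).1
  rw [hconst] at kt
  have hsq : leadNorm l (q t) ^ 2 ≤
      (leadNorm l (q 0) + η * (errNorm l σ (q 0) + errNorm l σ (q t))) ^ 2 := by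
    calc _ ≤ leadNorm l (q 0) ^ 2 + (η * errNorm l σ (q 0)) ^ 2 + (η * errNorm l σ (q t)) ^ 2 :=
          kt.trans (by gcongr)
      _ ≤ leadNorm l (q 0) ^ 2 + (η * errNorm l σ (q 0)) ^ 2 + (η * errNorm l σ (q t)) ^ 2 +
          2 * (leadNorm l (q 0) * (η * (errNorm l σ (q 0) + errNorm l σ (q t))) +
            (η * errNorm l σ (q 0)) * (η * errNorm l σ (q t))) := le_self_add
      _ = _ := by ring
  exact (ENNReal.pow_le_pow_left_iff two_ne_zero).1 hsq

/-! ### Sequence norms and Young's inequality -/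

/-- The `ℓ^r` norm of a nonnegative sequence on `ℤ`. -/
noncomputable def seqNorm (r : ℝ≥0∞) (x : ℤ → ℝ≥0∞) : ℝ≥0∞ :=
  if r = ∞ then ⨆ k, x k else (∑' k, x k ^ r.toReal) ^ (1 / r.toReal)

lemma one_le_toReal {r : ℝ≥0∞} (hr : 1 ≤ r) (h : r ≠ ∞) : 1 ≤ r.toReal := by
  simpa using ENNReal.toReal_mono h hr

lemma seqNorm_mono {r : ℝ≥0∞} {x y : ℤ → ℝ≥0∞} (h : ∀ k, x k ≤ y k) :
    seqNorm r x ≤ seqNorm r y := by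
  unfold seqNorm
  split_ifs with hr
  · exact iSup_mono h
  · gcongr with k
    exact h k

lemma le_seqNorm {r : ℝ≥0∞} (hr : 1 ≤ r) (x : ℤ → ℝ≥0∞) (k : ℤ) : x k ≤ seqNorm r x := by
  unfold seqNorm
  split_ifs with h
  · exact le_iSup x k
  · have h1 := one_le_toReal hr h
    calc x k = (x k ^ r.toReal) ^ (1 / r.toReal) := by
          rw [← ENNReal.rpow_mul, mul_one_div_cancel (by linarith), ENNReal.rpow_one]
      _ ≤ _ := by
          gcongr
          exact ENNReal.le_tsum (f := fun k => x k ^ r.toReal) k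

lemma seqNorm_const_mul {r : ℝ≥0∞} (hr : 1 ≤ r) (c : ℝ≥0∞) (x : ℤ → ℝ≥0∞) :
    seqNorm r (fun k => c * x k) = c * seqNorm r x := by
  unfold seqNorm
  split_ifs with h
  · rw [ENNReal.mul_iSup]
  · have h1 := one_le_toReal hr h
    simp_rw [ENNReal.mul_rpow_of_nonneg _ _ (by linarith : 0 ≤ r.toReal)]
    rw [ENNReal.tsum_mul_left, ENNReal.mul_rpow_of_nonneg _ _ (by positivity), ← ENNReal.rpow_mul,
      mul_one_div_cancel (by linarith), ENNReal.rpow_one]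

lemma seqNorm_add_le {r : ℝ≥0∞} (hr : 1 ≤ r) (x y : ℤ → ℝ≥0∞) :
    seqNorm r (fun k => x k + y k) ≤ seqNorm r x + seqNorm r y := by
  unfold seqNorm
  split_ifs with h
  · exact iSup_le fun k => add_le_add (le_iSup x k) (le_iSup y k)
  · have := ENNReal.lintegral_Lp_add_le (μ := (Measure.count : Measure ℤ)) (f := x) (g := y)
      (Measurable.of_discrete).aemeasurable (Measurable.of_discrete).aemeasurable
      (one_le_toReal hr h)
    simpa only [lintegral_count, Pi.add_apply] using this

/-- Hölder's inequality after splitting the weight as G^{1/q} G^{1/p}. -/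
lemma tsum_mul_rpow_le {ι : Type*} {p : ℝ} (hp : 1 ≤ p) (G x : ι → ℝ≥0∞) :
    (∑' i, G i * x i) ^ p ≤ (∑' i, G i) ^ (p - 1) * ∑' i, G i * x i ^ p := by
  rcases hp.eq_or_lt with rfl | hp
  · simp
  · let _ : MeasurableSpace ι := ⊤
    have hpq := (Real.HolderConjugate.conjExponent hp).symm
    set q := p.conjExponent with hq
    have hq0 : 0 < q := hpq.pos
    have hp0 : 0 < p := by linarith
    have h := ENNReal.lintegral_mul_le_Lp_mul_Lq (Measure.count : Measure ι) hpq
      (f := fun i => G i ^ (1 / q)) (g := fun i => G i ^ (1 / p) * x i)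
      (Measurable.of_discrete).aemeasurable (Measurable.of_discrete).aemeasurable
    simp only [lintegral_count, Pi.mul_apply] at h
    have e1 (i : ι) : G i ^ (1 / q) * (G i ^ (1 / p) * x i) = G i * x i := by
      rw [← mul_assoc, ← ENNReal.rpow_add_of_nonneg _ _ (by positivity) (by positivity)]
      rw [one_div, one_div, hpq.inv_add_inv_eq_one, ENNReal.rpow_one]
    have e2 (i : ι) : (G i ^ (1 / q)) ^ q = G i := by
      rw [← ENNReal.rpow_mul, one_div_mul_cancel hq0.ne', ENNReal.rpow_one]
    have e3 (i : ι) : (G i ^ (1 / p) * x i) ^ p = G i * x i ^ p := by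
      rw [ENNReal.mul_rpow_of_nonneg _ _ hp0.le, ← ENNReal.rpow_mul, one_div_mul_cancel hp0.ne',
        ENNReal.rpow_one]
    simp_rw [e1, e2, e3] at h
    calc _ ≤ ((∑' i, G i) ^ (1 / q) * (∑' i, G i * x i ^ p) ^ (1 / p)) ^ p := by gcongr
      _ = _ := by
        rw [ENNReal.mul_rpow_of_nonneg _ _ hp0.le, ← ENNReal.rpow_mul, ← ENNReal.rpow_mul,
          one_div_mul_cancel hp0.ne', ENNReal.rpow_one]
        congr 2
        have := hpq.inv_add_inv_eq_one
        field_simp at this ⊢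
        linarith

/-- Young's inequality for superpositions of shifts. -/
lemma seqNorm_le_of_shifts {ι : Type*} {r : ℝ≥0∞} (hr : 1 ≤ r) (G : ι → ℝ≥0∞) (m : ι → ℤ)
    (x y : ℤ → ℝ≥0∞) (h : ∀ k, y k ≤ ∑' i, G i * x (k + m i)) :
    seqNorm r y ≤ (∑' i, G i) * seqNorm r x := by
  refine (seqNorm_mono h).trans ?_
  unfold seqNorm
  split_ifs with hrt
  · refine iSup_le fun k => ?_
    rw [← ENNReal.tsum_mul_right]
    exact ENNReal.tsum_le_tsum fun i => by gcongr; exact le_iSup x (k + m i)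
  · have hp := one_le_toReal hr hrt
    set p := r.toReal
    have hp0 : 0 < p := by linarith
    have key : ∑' k, (∑' i, G i * x (k + m i)) ^ p ≤ (∑' i, G i) ^ p * ∑' k, x k ^ p := by
      calc _ ≤ ∑' k, (∑' i, G i) ^ (p - 1) * ∑' i, G i * x (k + m i) ^ p :=
            ENNReal.tsum_le_tsum fun k => tsum_mul_rpow_le hp G fun i => x (k + m i)
        _ = (∑' i, G i) ^ (p - 1) * ∑' i, G i * ∑' k, x k ^ p := by
            rw [ENNReal.tsum_mul_left, ENNReal.tsum_comm]
            congr 2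
            ext i
            rw [ENNReal.tsum_mul_left]
            congr 1
            exact (Equiv.addRight (m i)).tsum_eq fun k => x k ^ p
        _ = _ := by
            rw [ENNReal.tsum_mul_right, ← mul_assoc]
            congr 1
            nth_rewrite 2 [← ENNReal.rpow_one (∑' i, G i)]
            rw [← ENNReal.rpow_add_of_nonneg _ _ (by linarith) (by norm_num), sub_add_cancel]
    calc _ ≤ ((∑' i, G i) ^ p * ∑' k, x k ^ p) ^ (1 / p) := by gcongr
      _ = _ := by
        rw [ENNReal.mul_rpow_of_nonneg _ _ (by positivity), ← ENNReal.rpow_mul,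
          mul_one_div_cancel hp0.ne', ENNReal.rpow_one]

lemma tsum_rpow_half_le {ι : Type*} (x : ι → ℝ≥0∞) :
    (∑' i, x i ^ (2 : ℝ)) ^ (1 / 2 : ℝ) ≤ ∑' i, x i := by
  have : ∑' i, x i ^ (2 : ℝ) ≤ (∑' i, x i) ^ (2 : ℝ) := by
    simp_rw [ENNReal.rpow_two]
    rw [sq, ← ENNReal.tsum_mul_left]
    refine ENNReal.tsum_le_tsum fun i => ?_
    rw [sq]
    gcongr
    exact ENNReal.le_tsum i
  calc _ ≤ ((∑' i, x i) ^ (2 : ℝ)) ^ (1 / 2 : ℝ) := by gcongr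
    _ = _ := by rw [← ENNReal.rpow_mul]; norm_num

/-! ### Dyadic shells and the Besov norm -/

/-- The dyadic frequency shells: `|ξ| ≤ 1` for `j = 0` and `2^(j-1) < |ξ| ≤ 2^j` for `j ≥ 1`. -/
def shell : ℕ → Set ℝ
  | 0 => {ξ | |ξ| ≤ 1}
  | j + 1 => {ξ | 2 ^ j < |ξ| ∧ |ξ| ≤ 2 * 2 ^ j}

lemma measurableSet_shell (j : ℕ) : MeasurableSet (shell j) := by
  have h1 (c : ℝ) : IsClosed {ξ : ℝ | |ξ| ≤ c} := isClosed_le continuous_abs continuous_const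
  have h2 (c : ℝ) : IsOpen {ξ : ℝ | c < |ξ|} := isOpen_lt continuous_const continuous_abs
  cases j with
  | zero => exact (h1 1).measurableSet
  | succ j => exact (h2 (2 ^ j)).measurableSet.inter (h1 (2 * 2 ^ j)).measurableSet

lemma iUnion_shell : ⋃ j, shell j = Set.univ := by
  refine Set.eq_univ_of_forall fun ξ => Set.mem_iUnion.2 ?_
  have hex : ∃ n : ℕ, |ξ| ≤ 2 ^ n :=
    (pow_unbounded_of_one_lt |ξ| one_lt_two).imp fun _ h => h.le
  rcases hn : Nat.find hex with _ | j
  · have := Nat.find_spec hex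
    rw [hn, pow_zero] at this
    exact ⟨0, this⟩
  · have h1 := Nat.find_spec hex
    have h2 := Nat.find_min hex (m := j) (by omega)
    rw [hn, pow_succ'] at h1
    exact ⟨j + 1, not_le.1 h2, h1⟩

lemma abs_le_of_mem_shell {j : ℕ} {ξ : ℝ} (h : ξ ∈ shell j) : |ξ| ≤ 2 ^ j := by
  cases j with
  | zero => simpa [shell] using h
  | succ j => rw [pow_succ']; exact h.2

/-- The weighted dyadic pieces whose `ℓ^r` norm is the Besov norm. -/
noncomputable def besovSeq (s : ℝ) (f : ℝ → ℂ) : ℤ → ℝ≥0∞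
  | Int.ofNat 0 => freqNorm f (shell 0)
  | Int.ofNat (j + 1) => ((2 : ℝ≥0∞) ^ j) ^ s * freqNorm f (shell (j + 1))
  | Int.negSucc _ => 0

lemma besovNorm_eq_seqNorm (s : ℝ) {r : ℝ≥0∞} (hr : 1 ≤ r) (f : ℝ → ℂ) :
    besovNorm s r f = seqNorm r (besovSeq s f) := by
  unfold besovNorm seqNorm
  split_ifs with h
  · apply le_antisymm
    · refine max_le ?_ (iSup_le fun k => ?_)
      · exact le_iSup (besovSeq s f) (Int.ofNat 0)
      · exact le_iSup (besovSeq s f) (Int.ofNat (k + 1))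
    · refine iSup_le fun k => ?_
      rcases k with (_ | k) | k
      · exact le_max_left _ _
      · exact le_max_of_le_right (le_iSup (fun k : ℕ => ((2 : ℝ≥0∞) ^ k) ^ s *
          freqNorm f {ξ | 2 ^ k < |ξ| ∧ |ξ| ≤ 2 * 2 ^ k}) k)
      · exact bot_le
  · have hp := one_le_toReal hr h
    congr 1
    have h1 : ∑' k : ℤ, besovSeq s f k ^ r.toReal =
        ∑' k : ℕ, besovSeq s f (k : ℤ) ^ r.toReal := by
      refine (Nat.cast_injective.tsum_eq ?_).symm
      intro k hk
      rcases k with k | k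
      · exact ⟨k, rfl⟩
      · exfalso
        apply hk
        simp only [besovSeq]
        exact ENNReal.zero_rpow_of_pos (by linarith)
    rw [h1, tsum_eq_zero_add' (f := fun k : ℕ => besovSeq s f (k : ℤ) ^ r.toReal) ENNReal.summable]
    refine congrArg₂ (fun a b : ℝ≥0∞ => a + b) rfl (tsum_congr fun k => ?_)
    change _ = (((2 : ℝ≥0∞) ^ k) ^ s * freqNorm f (shell (k + 1))) ^ r.toReal
    rw [ENNReal.mul_rpow_of_nonneg _ _ (by linarith), ← ENNReal.rpow_mul, mul_comm s]
    rfl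

lemma fourierHat_two_pi_mul (f : 𝓢(ℝ, ℂ)) (η : ℝ) :
    fourierHat f (2 * Real.pi * η) = ((1 / Real.sqrt (2 * Real.pi) : ℝ) : ℂ) * 𝓕 f η := by
  rw [fourierHat, fourier_coe, Real.fourier_eq']
  congr 2
  ext x
  rw [smul_eq_mul]
  congr 2
  simp
  ring

/-- The change to ordinary frequency has Jacobian (2π)⁻¹, which cancels the square of the prefactor
(2π)^{-1/2}. -/
lemma freqNorm_sq (f : 𝓢(ℝ, ℂ)) {A : Set ℝ} (hA : MeasurableSet A) :
    freqNorm f A ^ (2 : ℝ) =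
      ∫⁻ η in (fun η => 2 * Real.pi * η) ⁻¹' A, ‖𝓕 f η‖ₑ ^ (2 : ℝ) := by
  have hpi := Real.two_pi_pos
  have h1 : freqNorm f A ^ (2 : ℝ) = ∫⁻ ξ in A, ‖fourierHat f ξ‖ₑ ^ (2 : ℝ) := by
    rw [freqNorm, eLpNorm_eq_lintegral_rpow_enorm_toReal (by norm_num) (by norm_num),
      ENNReal.toReal_ofNat, ← ENNReal.rpow_mul]
    norm_num
  have h2 := lintegral_comp_mul_left_real hpi
    (A.indicator fun ξ => ‖fourierHat f ξ‖ₑ ^ (2 : ℝ))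
  rw [lintegral_indicator hA, ← h1] at h2
  have h3 (η : ℝ) : (A.indicator fun ξ => ‖fourierHat f ξ‖ₑ ^ (2 : ℝ)) (2 * Real.pi * η) =
      ENNReal.ofReal (2 * Real.pi)⁻¹ * ((fun η => 2 * Real.pi * η) ⁻¹' A).indicator
        (fun η => ‖𝓕 f η‖ₑ ^ (2 : ℝ)) η := by
    by_cases h : 2 * Real.pi * η ∈ A
    · rw [Set.indicator_of_mem h, Set.indicator_of_mem (by exact h), fourierHat_two_pi_mul,
        enorm_mul, ENNReal.mul_rpow_of_nonneg _ _ (by norm_num)]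
      congr 1
      rw [← ofReal_norm, Complex.norm_real, Real.norm_eq_abs, abs_of_pos (by positivity),
        ENNReal.ofReal_rpow_of_nonneg (by positivity) (by norm_num), Real.rpow_two, div_pow,
        Real.sq_sqrt hpi.le, one_pow, one_div]
    · rw [Set.indicator_of_notMem h, Set.indicator_of_notMem (by exact h), mul_zero]
  simp_rw [h3] at h2
  have hm : MeasurableSet ((fun η => 2 * Real.pi * η) ⁻¹' A) :=
    (measurable_const_mul (2 * Real.pi)) hA
  rw [lintegral_const_mul _ (Measurable.indicator (by fun_prop) hm), lintegral_indicator hm] at h2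
  have hne : ENNReal.ofReal (2 * Real.pi)⁻¹ ≠ 0 := by
    rw [Ne, ENNReal.ofReal_eq_zero, not_le]; positivity
  exact ((ENNReal.mul_right_inj hne ENNReal.ofReal_ne_top).1 h2).symm

/-! ### Comparing leading, error and shell norms -/

lemma errNorm_eq {l : ℝ} (hl : 0 < l) (σ : ℝ) (f : 𝓢(ℝ, ℂ)) :
    errNorm l σ f = l2 (fun η => ‖𝓕 f η‖ₑ * ENNReal.ofReal ((l / jap l η) ^ σ)) := by
  rw [errNorm, sob, ← l2_const_mul _ (by fun_prop)]
  congr 1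
  ext η
  rw [mul_left_comm, japPow, ← ENNReal.ofReal_mul (by positivity),
    Real.div_rpow hl.le (jap_nonneg _ _), Real.rpow_neg (jap_nonneg _ _), div_eq_mul_inv]

lemma leadNorm_eq_errNorm (l : ℝ) (f : 𝓢(ℝ, ℂ)) : leadNorm l f = errNorm l 1 f := by
  rw [leadNorm, errNorm, Real.rpow_one]

lemma leadNorm_eq {l : ℝ} (hl : 0 < l) (f : 𝓢(ℝ, ℂ)) :
    leadNorm l f = l2 (fun η => ‖𝓕 f η‖ₑ * ENNReal.ofReal (l / jap l η)) := by
  rw [leadNorm_eq_errNorm, errNorm_eq hl]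
  simp_rw [Real.rpow_one]

lemma div_jap_le_one {l : ℝ} (hl : 0 < l) (η : ℝ) : l / jap l η ≤ 1 :=
  (div_le_one (jap_pos hl η)).2 (le_jap l η)

lemma abs_le_jap (l η : ℝ) : |2 * Real.pi * η| ≤ jap l η := by
  refine abs_le_of_sq_le_sq ?_ (jap_nonneg _ _)
  rw [jap_sq]
  nlinarith [sq_nonneg l]

lemma one_le_two_mul_div_jap {l η : ℝ} (hl : 0 < l) (h : |2 * Real.pi * η| ≤ l / 2) :
    1 ≤ 2 * (l / jap l η) := by
  rw [← mul_div_assoc, one_le_div (jap_pos hl η)]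
  refine le_of_abs_le (abs_le_of_sq_le_sq ?_ (by positivity))
  rw [jap_sq]
  have := sq_le_sq' (by linarith [abs_nonneg (2 * Real.pi * η)]) h
  rw [sq_abs] at this
  nlinarith

lemma l2_le_tsum_shell (f : 𝓢(ℝ, ℂ)) {φ : ℝ → ℝ≥0∞} {W : ℕ → ℝ≥0∞}
    (h : ∀ j η, 2 * Real.pi * η ∈ shell j → φ η ≤ W j) :
    l2 (fun η => ‖𝓕 f η‖ₑ * φ η) ≤ ∑' j, W j * freqNorm f (shell j) := by
  refine le_trans ?_ (tsum_rpow_half_le _)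
  unfold l2
  gcongr
  rw [← setLIntegral_univ, ← Set.preimage_univ (f := fun η => 2 * Real.pi * η), ← iUnion_shell,
    Set.preimage_iUnion]
  refine (lintegral_iUnion_le _ _).trans (ENNReal.tsum_le_tsum fun j => ?_)
  rw [ENNReal.mul_rpow_of_nonneg _ _ (by norm_num), freqNorm_sq f (measurableSet_shell j),
    ← lintegral_const_mul _ (by fun_prop)]
  have hm : MeasurableSet ((fun η => 2 * Real.pi * η) ⁻¹' shell j) :=
    (measurable_const_mul (2 * Real.pi)) (measurableSet_shell j)
  refine setLIntegral_mono' hm fun η hη => ?_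
  rw [ENNReal.mul_rpow_of_nonneg _ _ (by norm_num), mul_comm]
  gcongr
  exact h j η hη

/-- On shell j the multiplier l / `jap` is at most 1, and for j ≥ 1 also at most l / 2^{j-1}. -/
lemma leadNorm_le_tsum_shell (f : 𝓢(ℝ, ℂ)) (k : ℕ) :
    leadNorm (2 * 2 ^ k) f ≤
      ∑' j : ℕ, ENNReal.ofReal (4 * min 1 ((2 : ℝ) ^ k / 2 ^ j)) * freqNorm f (shell j) := by
  have hl : (0 : ℝ) < 2 * 2 ^ k := by positivity
  rw [leadNorm_eq hl]
  refine l2_le_tsum_shell f fun j η hη => ENNReal.ofReal_le_ofReal ?_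
  have h1 := div_jap_le_one hl η
  have h2 : 2 * 2 ^ k / jap (2 * 2 ^ k) η ≤ 4 * ((2 : ℝ) ^ k / 2 ^ j) := by
    cases j with
    | zero =>
      have : (1 : ℝ) ≤ 2 ^ k := one_le_pow₀ (by norm_num)
      rw [pow_zero, div_one]
      linarith
    | succ j =>
      have hη' : (2 : ℝ) ^ j < jap (2 * 2 ^ k) η := lt_of_lt_of_le hη.1 (abs_le_jap _ η)
      calc 2 * 2 ^ k / jap (2 * 2 ^ k) η ≤ 2 * 2 ^ k / 2 ^ j := by gcongr
        _ = _ := by rw [pow_succ]; field_simp; norm_num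
  rw [mul_min_of_nonneg _ _ (by norm_num), le_min_iff]
  exact ⟨by linarith, h2⟩

/-- Angular frequencies up to 2^k, half of the spectral parameter, are seen by the leading
multiplier with weight at least 1/2. -/
lemma freqNorm_le_leadNorm (f : 𝓢(ℝ, ℂ)) {A : Set ℝ} (hA : MeasurableSet A) {k : ℕ}
    (h : ∀ ξ ∈ A, |ξ| ≤ 2 ^ k) : freqNorm f A ≤ 2 * leadNorm (2 * 2 ^ k) f := by
  have hl : (0 : ℝ) < 2 * 2 ^ k := by positivity
  have hsq : freqNorm f A ^ (2 : ℝ) ≤ (2 * leadNorm (2 * 2 ^ k) f) ^ (2 : ℝ) := by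
    have hcj := (continuous_jap (2 * 2 ^ k)).measurable
    rw [leadNorm_eq hl, ← l2_const_mul _ (by fun_prop), l2_sq, freqNorm_sq f hA]
    have hm : MeasurableSet ((fun η => 2 * Real.pi * η) ⁻¹' A) :=
      (measurable_const_mul (2 * Real.pi)) hA
    refine (setLIntegral_mono' hm fun η hη => ?_).trans (setLIntegral_le_lintegral _ _)
    gcongr
    have h1 := one_le_two_mul_div_jap (η := η) hl (by
      rw [mul_div_cancel_left₀ _ two_ne_zero]; exact h _ hη)
    have h2 := ENNReal.ofReal_le_ofReal h1
    rw [ENNReal.ofReal_mul (by norm_num), ENNReal.ofReal_one, ENNReal.ofReal_ofNat] at h2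
    calc ‖𝓕 f η‖ₑ = ‖𝓕 f η‖ₑ * 1 := (mul_one _).symm
      _ ≤ ‖𝓕 f η‖ₑ * (2 * ENNReal.ofReal (2 * 2 ^ k / jap (2 * 2 ^ k) η)) := by gcongr
      _ = _ := by ring
  exact (ENNReal.rpow_le_rpow_iff (by norm_num)).1 hsq

/-- Take the least m for which the frequency is at most 2^{k+m}. The leading multiplier at scale k +
m is then at least 1/2, while for m > 0 the minimality makes the multiplier at scale k of size
2^{-m}. -/
lemma exists_div_jap_rpow_le {σ : ℝ} (h0 : 0 ≤ σ) (h1 : σ ≤ 1) (k : ℕ) (η : ℝ) :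
    ∃ m : ℕ, ((2 * 2 ^ k) / jap (2 * 2 ^ k) η) ^ σ ≤
      8 * (2 : ℝ) ^ (-σ * m) * (2 * 2 ^ (k + m) / jap (2 * 2 ^ (k + m)) η) := by
  have hl (k : ℕ) : (0 : ℝ) < 2 * 2 ^ k := by positivity
  have low (n : ℕ) (h : |2 * Real.pi * η| ≤ 2 ^ n) : 1 ≤ 2 * (2 * 2 ^ n / jap (2 * 2 ^ n) η) :=
    one_le_two_mul_div_jap (hl n) (by rwa [mul_div_cancel_left₀ _ two_ne_zero])
  have hex : ∃ m : ℕ, |2 * Real.pi * η| ≤ 2 ^ (k + m) := by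
    obtain ⟨n, hn⟩ := pow_unbounded_of_one_lt |2 * Real.pi * η| one_lt_two
    exact ⟨n, hn.le.trans (pow_le_pow_right₀ one_le_two (Nat.le_add_left n k))⟩
  refine ⟨Nat.find hex, ?_⟩
  have hfind := low _ (Nat.find_spec hex)
  have hpos : 0 ≤ 2 * 2 ^ k / jap (2 * 2 ^ k) η := div_nonneg (hl k).le (jap_nonneg _ _)
  have hbound : ((2 * 2 ^ k) / jap (2 * 2 ^ k) η) ^ σ ≤ 4 * (2 : ℝ) ^ (-σ * Nat.find hex) := by
    rcases hm : Nat.find hex with _ | m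
    · have := Real.rpow_le_one hpos (div_jap_le_one (hl k) η) h0
      simp
      linarith
    · have h2 := Nat.find_min hex (m := m) (by omega)
      have h3 : (2 : ℝ) ^ (k + m) ≤ jap (2 * 2 ^ k) η := (not_le.1 h2).le.trans (abs_le_jap _ η)
      have h4 : 2 * 2 ^ k / jap (2 * 2 ^ k) η ≤ 4 * (2 : ℝ) ^ (-((m + 1 : ℕ) : ℝ)) := by
        calc _ ≤ 2 * 2 ^ k / (2 : ℝ) ^ (k + m) := by gcongr
          _ = _ := by
            rw [Real.rpow_neg (by norm_num), Real.rpow_natCast, pow_add, pow_succ]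
            field_simp
            norm_num
      calc _ ≤ (4 * (2 : ℝ) ^ (-((m + 1 : ℕ) : ℝ))) ^ σ := Real.rpow_le_rpow hpos h4 h0
        _ = 4 ^ σ * (2 : ℝ) ^ (-σ * (m + 1 : ℕ)) := by
          rw [Real.mul_rpow (by norm_num) (by positivity), ← Real.rpow_mul (by norm_num)]
          congr 2
          ring
        _ ≤ 4 ^ (1 : ℝ) * (2 : ℝ) ^ (-σ * (m + 1 : ℕ)) := by
          gcongr
          norm_num
        _ = _ := by rw [Real.rpow_one]
  calc _ ≤ 4 * (2 : ℝ) ^ (-σ * Nat.find hex) * 1 := by rw [mul_one]; exact hbound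
    _ ≤ 4 * (2 : ℝ) ^ (-σ * Nat.find hex) *
        (2 * (2 * 2 ^ (k + Nat.find hex) / jap (2 * 2 ^ (k + Nat.find hex)) η)) := by gcongr
    _ = _ := by ring

/-- At each frequency one term of the sum already dominates; summing squares and using ℓ¹ ⊂ ℓ² gives
the bound. Only scales at or above k occur, so the estimates restricted to k ≥ k₀ close on
themselves. -/
lemma errNorm_le_tsum_leadNorm {σ : ℝ} (h0 : 0 ≤ σ) (h1 : σ ≤ 1) (f : 𝓢(ℝ, ℂ)) (k : ℕ) :
    errNorm (2 * 2 ^ k) σ f ≤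
      ∑' m : ℕ, ENNReal.ofReal (8 * (2 : ℝ) ^ (-σ * m)) * leadNorm (2 * 2 ^ (k + m)) f := by
  have hl (k : ℕ) : (0 : ℝ) < 2 * 2 ^ k := by positivity
  refine le_trans ?_ (tsum_rpow_half_le _)
  rw [errNorm_eq (hl k)]
  unfold l2
  gcongr
  have hmeas (m : ℕ) : Measurable fun η => ENNReal.ofReal (8 * (2 : ℝ) ^ (-σ * m)) *
      (‖𝓕 f η‖ₑ * ENNReal.ofReal (2 * 2 ^ (k + m) / jap (2 * 2 ^ (k + m)) η)) := by
    have := (continuous_jap (2 * 2 ^ (k + m))).measurable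
    fun_prop
  have e (m : ℕ) : (ENNReal.ofReal (8 * (2 : ℝ) ^ (-σ * m)) * leadNorm (2 * 2 ^ (k + m)) f) ^
      (2 : ℝ) = ∫⁻ η, (ENNReal.ofReal (8 * (2 : ℝ) ^ (-σ * m)) *
      (‖𝓕 f η‖ₑ * ENNReal.ofReal (2 * 2 ^ (k + m) / jap (2 * 2 ^ (k + m)) η))) ^ (2 : ℝ) := by
    have := (continuous_jap (2 * 2 ^ (k + m))).measurable
    rw [leadNorm_eq (hl _), ← l2_const_mul _ (by fun_prop), l2_sq]
  simp_rw [e]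
  rw [← lintegral_tsum fun m => ((hmeas m).pow_const _).aemeasurable]
  refine lintegral_mono fun η => ?_
  obtain ⟨m, hm⟩ := exists_div_jap_rpow_le h0 h1 k η
  refine le_trans ?_ (ENNReal.le_tsum m)
  refine ENNReal.rpow_le_rpow ?_ (by norm_num)
  have := ENNReal.ofReal_le_ofReal hm
  rw [ENNReal.ofReal_mul (by positivity)] at this
  rw [mul_left_comm]
  exact mul_le_mul_right this _

/-! ### Weighted tails over dyadic scales -/

lemma two_rpow_add (a b : ℝ) : (2 : ℝ≥0∞) ^ (a + b) = 2 ^ a * 2 ^ b :=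
  ENNReal.rpow_add a b two_ne_zero ENNReal.ofNat_ne_top

lemma two_rpow_ne_top (a : ℝ) : (2 : ℝ≥0∞) ^ a ≠ ∞ := by
  rw [Ne, ENNReal.rpow_eq_top_iff]
  simp

lemma tsum_two_rpow_ne_top {a : ℝ} (ha : 0 < a) : ∑' n : ℕ, (2 : ℝ≥0∞) ^ (-a * n) ≠ ∞ := by
  have h : (2 : ℝ≥0∞) ^ (-a) < 1 :=
    ENNReal.rpow_lt_one_of_one_lt_of_neg ENNReal.one_lt_two (by linarith)
  simp_rw [ENNReal.rpow_mul, ENNReal.rpow_natCast]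
  rw [ENNReal.tsum_geometric, Ne, ENNReal.inv_eq_top, tsub_eq_zero_iff_le, not_le]
  exact h

lemma tsum_int_le (F : ℤ → ℝ≥0∞) : ∑' m, F m ≤ (∑' n : ℕ, F n) + ∑' n : ℕ, F (-n) := by
  have := HasSum.of_nat_of_neg_add_one (f := F) (ENNReal.summable (f := fun n : ℕ => F n)).hasSum
    (ENNReal.summable (f := fun n : ℕ => F (-(n + 1)))).hasSum
  rw [this.tsum_eq]
  refine add_le_add le_rfl ?_
  have := ENNReal.tsum_comp_le_tsum_of_injective Nat.succ_injective (fun n : ℕ => F (-n))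
  simpa using this

/-- The sequence `2^(s k) x k` for `k ≥ k₀`, extended by zero to `ℤ`. -/
noncomputable def tailSeq (s : ℝ) (k₀ : ℕ) (x : ℕ → ℝ≥0∞) (k : ℤ) : ℝ≥0∞ :=
  if (k₀ : ℤ) ≤ k then 2 ^ (s * (k : ℝ)) * x k.toNat else 0

lemma tailSeq_natCast {s : ℝ} {k₀ k : ℕ} (h : k₀ ≤ k) (x : ℕ → ℝ≥0∞) :
    tailSeq s k₀ x k = 2 ^ (s * (k : ℝ)) * x k := by
  rw [tailSeq, if_pos (by exact_mod_cast h), Int.toNat_natCast, Int.cast_natCast]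

/-- Conjugating the kernel A (j - k) by the weight 2^{sk} multiplies it by 2^{-s(j-k)}, after which
Young's inequality for shifts applies. -/
lemma seqNorm_tailSeq_le {r : ℝ≥0∞} (hr : 1 ≤ r) (s : ℝ) {k₀ k₁ : ℕ} {x y : ℕ → ℝ≥0∞}
    {A : ℤ → ℝ≥0∞}
    (h : ∀ k, k₀ ≤ k → y k ≤ ∑' j : ℕ, A ((j : ℤ) - k) * if k₁ ≤ j then x j else 0) :
    seqNorm r (tailSeq s k₀ y) ≤
      (∑' m : ℤ, A m * 2 ^ (-s * (m : ℝ))) * seqNorm r (tailSeq s k₁ x) := by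
  refine seqNorm_le_of_shifts hr _ id _ _ fun k => ?_
  by_cases hk : (k₀ : ℤ) ≤ k
  swap
  · rw [tailSeq, if_neg hk]
    exact bot_le
  obtain ⟨k, rfl⟩ := Int.eq_ofNat_of_zero_le ((Int.natCast_nonneg k₀).trans hk)
  have hk' : k₀ ≤ k := by exact_mod_cast hk
  rw [tailSeq_natCast hk']
  have hinj : Function.Injective fun j : ℕ => (j : ℤ) - k := fun a b hab => by
    simpa using hab
  refine le_trans ?_ (ENNReal.tsum_comp_le_tsum_of_injective hinj
    fun m => A m * 2 ^ (-s * (m : ℝ)) * tailSeq s k₁ x ((k : ℤ) + id m))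
  refine (mul_le_mul_right (h k hk') _).trans ?_
  rw [← ENNReal.tsum_mul_left]
  refine ENNReal.tsum_le_tsum fun j => ?_
  simp only [id, add_sub_cancel]
  split_ifs with hj
  · rw [tailSeq_natCast hj]
    have e : (2 : ℝ≥0∞) ^ (s * (k : ℝ)) =
        2 ^ (-s * (((j : ℤ) - (k : ℤ) : ℤ) : ℝ)) * 2 ^ (s * (j : ℝ)) := by
      rw [← two_rpow_add]
      congr 1
      push_cast
      ring
    rw [e]
    exact le_of_eq (by ring)
  · simp

/-- The leading norms at the dyadic spectral parameters. -/
noncomputable def leadSeq (f : 𝓢(ℝ, ℂ)) (k : ℕ) : ℝ≥0∞ := leadNorm (2 * 2 ^ k) f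

/-- The error norms at the dyadic spectral parameters. -/
noncomputable def errSeq (σ : ℝ) (f : 𝓢(ℝ, ℂ)) (k : ℕ) : ℝ≥0∞ := errNorm (2 * 2 ^ k) σ f

/-- The conjugated kernel is 8 · 2^{-(σ+s)m} on m ≥ 0, summable exactly because σ > -s. -/
lemma exists_seqNorm_errSeq_le {r : ℝ≥0∞} (hr : 1 ≤ r) {s σ : ℝ} (h0 : 0 ≤ σ) (h1 : σ ≤ 1)
    (hσ : 0 < σ + s) : ∃ C : ℝ≥0, ∀ (f : 𝓢(ℝ, ℂ)) (k₀ : ℕ),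
      seqNorm r (tailSeq s k₀ (errSeq σ f)) ≤ C * seqNorm r (tailSeq s k₀ (leadSeq f)) := by
  let A : ℤ → ℝ≥0∞ := fun m => if 0 ≤ m then 8 * 2 ^ (-σ * (m : ℝ)) else 0
  have hA : ∑' m : ℤ, A m * 2 ^ (-s * (m : ℝ)) ≠ ∞ := by
    refine ne_top_of_le_ne_top ?_ (tsum_int_le _)
    refine ENNReal.add_ne_top.2 ⟨?_, ?_⟩
    · have e (n : ℕ) : A n * 2 ^ (-s * ((n : ℤ) : ℝ)) = 8 * 2 ^ (-(σ + s) * (n : ℝ)) := by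
        simp only [A, if_pos (Int.natCast_nonneg n), Int.cast_natCast]
        rw [mul_assoc, ← two_rpow_add]
        congr 2
        ring
      simp_rw [e]
      rw [ENNReal.tsum_mul_left]
      exact ENNReal.mul_ne_top (by norm_num) (tsum_two_rpow_ne_top hσ)
    · rw [tsum_eq_single 0]
      · simp [A]
      · intro n hn
        have : ¬ (0 : ℤ) ≤ -(n : ℤ) := by omega
        simp only [A, if_neg this, zero_mul]
  refine ⟨(∑' m : ℤ, A m * 2 ^ (-s * (m : ℝ))).toNNReal, fun f k₀ => ?_⟩
  rw [ENNReal.coe_toNNReal hA]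
  refine seqNorm_tailSeq_le hr s fun k hk => ?_
  refine (errNorm_le_tsum_leadNorm h0 h1 f k).trans ?_
  refine le_trans (ENNReal.tsum_le_tsum fun m => ?_)
    (ENNReal.tsum_comp_le_tsum_of_injective (add_right_injective k)
      fun j : ℕ => A ((j : ℤ) - k) * if k₀ ≤ j then leadSeq f j else 0)
  rw [if_pos (by omega)]
  have e : ((k + m : ℕ) : ℤ) - k = m := by push_cast; ring
  simp only [e, A, if_pos (Int.natCast_nonneg m), leadSeq, Int.cast_natCast]
  rw [ENNReal.ofReal_mul (by norm_num), ← ENNReal.ofReal_rpow_of_pos (by norm_num)]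
  norm_num

lemma besovSeq_le (s : ℝ) (hs : s < 0) (f : 𝓢(ℝ, ℂ)) (k : ℤ) :
    besovSeq s f k ≤ 2 ^ (-s) * tailSeq s 0 (fun j => freqNorm f (shell j)) k := by
  rcases k with (_ | k) | k
  · have : (1 : ℝ≥0∞) ≤ 2 ^ (-s) :=
      ENNReal.one_le_rpow ENNReal.one_lt_two.le (by linarith)
    simpa [besovSeq, tailSeq] using le_mul_of_one_le_left (by simp) this
  · change ((2 : ℝ≥0∞) ^ k) ^ s * _ ≤ _ * tailSeq s 0 _ ((k + 1 : ℕ) : ℤ)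
    rw [tailSeq_natCast (Nat.zero_le _), ← mul_assoc, ← two_rpow_add, ← ENNReal.rpow_natCast,
      ← ENNReal.rpow_mul]
    refine le_of_eq ?_
    congr 2
    push_cast
    ring
  · exact bot_le

lemma tailSeq_le_besovSeq (s : ℝ) (hs : s ≤ 0) (f : 𝓢(ℝ, ℂ)) (k : ℤ) :
    tailSeq s 0 (fun j => freqNorm f (shell j)) k ≤ besovSeq s f k := by
  rcases k with (_ | k) | k
  · simp [besovSeq, tailSeq]
  · change tailSeq s 0 _ ((k + 1 : ℕ) : ℤ) ≤ ((2 : ℝ≥0∞) ^ k) ^ s * freqNorm f (shell (k + 1))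
    rw [tailSeq_natCast (Nat.zero_le _), ← ENNReal.rpow_natCast, ← ENNReal.rpow_mul]
    gcongr ?_ * _
    refine ENNReal.rpow_le_rpow_of_exponent_le ENNReal.one_lt_two.le ?_
    push_cast
    nlinarith
  · have : ¬ (((0 : ℕ) : ℤ) ≤ Int.negSucc k) := by simp
    rw [tailSeq, if_neg this]
    exact bot_le

/-- The conjugated kernel decays like 2^{-(1+s)m} for m > 0 and like 2^{-|s||m|} for m < 0, so both
bounds on s are needed. -/
lemma exists_seqNorm_leadSeq_le {r : ℝ≥0∞} (hr : 1 ≤ r) {s : ℝ} (hs₁ : -1 < s) (hs₂ : s < 0) :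
    ∃ C : ℝ≥0, ∀ (f : 𝓢(ℝ, ℂ)) (k₀ : ℕ),
      seqNorm r (tailSeq s k₀ (leadSeq f)) ≤ C * besovNorm s r f := by
  let A : ℤ → ℝ≥0∞ := fun m => 4 * min 1 (2 ^ (-(m : ℝ)))
  have hA : ∑' m : ℤ, A m * 2 ^ (-s * (m : ℝ)) ≠ ∞ := by
    refine ne_top_of_le_ne_top ?_ (tsum_int_le _)
    refine ENNReal.add_ne_top.2 ⟨?_, ?_⟩
    · have e (n : ℕ) : A n * 2 ^ (-s * ((n : ℤ) : ℝ)) ≤ 4 * 2 ^ (-(1 + s) * (n : ℝ)) := by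
        calc _ ≤ 4 * 2 ^ (-((n : ℤ) : ℝ)) * (2 : ℝ≥0∞) ^ (-s * ((n : ℤ) : ℝ)) := by
              exact mul_le_mul_left (mul_le_mul_right (min_le_right _ _) _) _
          _ = _ := by
              rw [mul_assoc, ← two_rpow_add]
              congr 2
              push_cast
              ring
      refine ne_top_of_le_ne_top ?_ (ENNReal.tsum_le_tsum e)
      rw [ENNReal.tsum_mul_left]
      exact ENNReal.mul_ne_top (by norm_num) (tsum_two_rpow_ne_top (by linarith))
    · have e (n : ℕ) : A (-n) * 2 ^ (-s * ((-n : ℤ) : ℝ)) ≤ 4 * 2 ^ (-(-s) * (n : ℝ)) := by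
        calc _ ≤ 4 * 1 * (2 : ℝ≥0∞) ^ (-s * ((-n : ℤ) : ℝ)) := by
              exact mul_le_mul_left (mul_le_mul_right (min_le_left _ _) _) _
          _ = _ := by
              rw [mul_one]
              congr 2
              push_cast
              ring
      refine ne_top_of_le_ne_top ?_ (ENNReal.tsum_le_tsum e)
      rw [ENNReal.tsum_mul_left]
      exact ENNReal.mul_ne_top (by norm_num) (tsum_two_rpow_ne_top (by linarith))
  refine ⟨(∑' m : ℤ, A m * 2 ^ (-s * (m : ℝ))).toNNReal, fun f k₀ => ?_⟩
  rw [ENNReal.coe_toNNReal hA, besovNorm_eq_seqNorm s hr]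
  refine (seqNorm_tailSeq_le (k₁ := 0) (A := A) (x := fun j => freqNorm f (shell j)) hr s
    fun k hk => ?_).trans (mul_le_mul_right (seqNorm_mono (tailSeq_le_besovSeq s hs₂.le f)) _)
  refine (leadNorm_le_tsum_shell f k).trans (ENNReal.tsum_le_tsum fun j => ?_)
  rw [if_pos (Nat.zero_le _)]
  gcongr
  have e : (2 : ℝ) ^ k / 2 ^ j = 2 ^ (-(((j : ℤ) - k : ℤ) : ℝ)) := by
    rw [← Real.rpow_natCast, ← Real.rpow_natCast, ← Real.rpow_sub (by norm_num)]
    congr 1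
    push_cast
    ring
  rw [ENNReal.ofReal_mul (by norm_num), ENNReal.ofReal_min, e,
    ← ENNReal.ofReal_rpow_of_pos (by norm_num)]
  simp [A]

/-- Shell j is controlled by the leading norm at scale max(j, k₀). For j < k₀ the change of weight
costs 2^{-s(k₀-j)}; the geometric sum of these losses is of size 2^{-s k₀}. -/
lemma exists_besovNorm_le {r : ℝ≥0∞} (hr : 1 ≤ r) {s : ℝ} (hs : s < 0) :
    ∃ C : ℝ≥0, ∀ (f : 𝓢(ℝ, ℂ)) (k₀ : ℕ),
      besovNorm s r f ≤ C * 2 ^ (-s * (k₀ : ℝ)) * seqNorm r (tailSeq s k₀ (leadSeq f)) := by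
  have hG : 2 ^ (-s) * (2 * (∑' n : ℕ, (2 : ℝ≥0∞) ^ (-(-s) * (n : ℝ)))) ≠ ∞ :=
    ENNReal.mul_ne_top (two_rpow_ne_top _)
      (ENNReal.mul_ne_top (by norm_num) (tsum_two_rpow_ne_top (by linarith)))
  refine ⟨(2 ^ (-s) * (2 * (∑' n : ℕ, (2 : ℝ≥0∞) ^ (-(-s) * (n : ℝ))))).toNNReal, fun f k₀ => ?_⟩
  rw [ENNReal.coe_toNNReal hG, besovNorm_eq_seqNorm s hr]
  refine (seqNorm_mono (besovSeq_le s hs f)).trans ?_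
  rw [seqNorm_const_mul hr]
  let A : ℤ → ℝ≥0∞ := fun m => if 0 ≤ m ∧ m ≤ k₀ then 2 else 0
  have h1 : seqNorm r (tailSeq s 0 fun j => freqNorm f (shell j)) ≤
      (∑' m : ℤ, A m * 2 ^ (-s * (m : ℝ))) * seqNorm r (tailSeq s k₀ (leadSeq f)) := by
    refine seqNorm_tailSeq_le hr s fun j _ => ?_
    refine le_trans ?_ (ENNReal.le_tsum (max j k₀))
    have hm : 0 ≤ ((max j k₀ : ℕ) : ℤ) - j ∧ ((max j k₀ : ℕ) : ℤ) - j ≤ k₀ := by omega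
    rw [if_pos (le_max_right _ _)]
    simp only [A, if_pos hm]
    exact freqNorm_le_leadNorm f (measurableSet_shell j) fun ξ hξ =>
      (abs_le_of_mem_shell hξ).trans (pow_le_pow_right₀ one_le_two (le_max_left _ _))
  have h2 : ∑' m : ℤ, A m * 2 ^ (-s * (m : ℝ)) ≤
      2 * (∑' n : ℕ, (2 : ℝ≥0∞) ^ (-(-s) * (n : ℝ))) * 2 ^ (-s * (k₀ : ℝ)) := by
    -- Reversing the summation, m = k₀ - n, extracts the largest term and leaves a convergent
    -- geometric series.
    rw [← (Equiv.subLeft (k₀ : ℤ)).tsum_eq, ← Nat.cast_injective.tsum_eq]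
    · rw [← ENNReal.tsum_mul_left, ← ENNReal.tsum_mul_right]
      refine ENNReal.tsum_le_tsum fun n => ?_
      simp only [Equiv.subLeft_apply]
      calc _ ≤ 2 * (2 : ℝ≥0∞) ^ (-s * (((k₀ : ℤ) - (n : ℤ) : ℤ) : ℝ)) := by
            gcongr
            simp only [A]
            split_ifs <;> simp
        _ = _ := by
            rw [mul_assoc, ← two_rpow_add]
            congr 2
            push_cast
            ring
    · intro m hm
      rcases m with m | m
      · exact ⟨m, rfl⟩
      · exfalso
        apply hm
        have : ¬ (0 ≤ (k₀ : ℤ) - Int.negSucc m ∧ (k₀ : ℤ) - Int.negSucc m ≤ k₀) := by omega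
        simp only [Equiv.subLeft_apply, A, if_neg this, zero_mul]
  calc _ ≤ 2 ^ (-s) * (2 * (∑' n : ℕ, (2 : ℝ≥0∞) ^ (-(-s) * (n : ℝ))) * 2 ^ (-s * (k₀ : ℝ)) *
        seqNorm r (tailSeq s k₀ (leadSeq f))) :=
        mul_le_mul_right (h1.trans (mul_le_mul_left h2 _)) _
    _ = _ := by ring

lemma leadNorm_le_sob_zero {l : ℝ} (hl : 0 < l) (f : 𝓢(ℝ, ℂ)) : leadNorm l f ≤ sob l 0 f := by
  calc _ ≤ ENNReal.ofReal l * (ENNReal.ofReal (l ^ (-1 : ℝ)) * sob l 0 f) := by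
        unfold leadNorm
        gcongr
        exact sob_le_sob_zero hl (by norm_num) f
    _ = _ := by
        rw [← mul_assoc, ← ENNReal.ofReal_mul hl.le, Real.rpow_neg_one, mul_inv_cancel₀ hl.ne']
        simp

/-- The constant sequence is the unit mass at 0 spread upwards by the kernel 1 on m ≤ 0, so the
kernel bound settles all r at once. -/
lemma seqNorm_tailSeq_one_ne_top {r : ℝ≥0∞} (hr : 1 ≤ r) {s : ℝ} (hs : s < 0) (k₀ : ℕ) :
    seqNorm r (tailSeq s k₀ fun _ => 1) ≠ ∞ := by
  let A : ℤ → ℝ≥0∞ := fun m => if m ≤ 0 then 1 else 0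
  have hA : ∑' m : ℤ, A m * 2 ^ (-s * (m : ℝ)) ≠ ∞ := by
    refine ne_top_of_le_ne_top ?_ (tsum_int_le _)
    refine ENNReal.add_ne_top.2 ⟨?_, ?_⟩
    · rw [tsum_eq_single 0]
      · simp [A]
      · intro n hn
        have : ¬ (n : ℤ) ≤ 0 := by omega
        simp only [A, if_neg this, zero_mul]
    · have e (n : ℕ) : A (-n) * 2 ^ (-s * ((-n : ℤ) : ℝ)) = 2 ^ (-(-s) * (n : ℝ)) := by
        have : -(n : ℤ) ≤ 0 := by omega
        simp only [A, if_pos this, one_mul]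
        congr 1
        push_cast
        ring
      simp_rw [e]
      exact tsum_two_rpow_ne_top (by linarith)
  let δ : ℕ → ℝ≥0∞ := fun j => if j = 0 then 1 else 0
  have hδ : seqNorm r (tailSeq s 0 δ) ≤ 1 := by
    have h0 : tailSeq s 0 δ 0 = 1 := by simp [tailSeq, δ]
    have hne (k : ℤ) (hk : k ≠ 0) : tailSeq s 0 δ k = 0 := by
      unfold tailSeq
      split_ifs with h
      · have : k.toNat ≠ 0 := by omega
        simp [δ, this]
      · rfl
    unfold seqNorm
    split_ifs with h
    · refine iSup_le fun k => ?_
      by_cases hk : k = 0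
      · rw [hk, h0]
      · rw [hne k hk]
        exact zero_le_one
    · have h1 := one_le_toReal hr h
      rw [tsum_eq_single 0 fun k hk => by
        rw [hne k hk, ENNReal.zero_rpow_of_pos (by linarith)], h0]
      simp
  have h := seqNorm_tailSeq_le (k₀ := k₀) (k₁ := 0) (x := δ) (y := fun _ => 1) (A := A) hr s
    fun k _ => by
      refine le_trans ?_ (ENNReal.le_tsum 0)
      simp [A, δ]
  exact ne_top_of_le_ne_top (ENNReal.mul_ne_top hA (ne_top_of_le_ne_top ENNReal.one_ne_top hδ)) h

lemma continuous_seqNorm_leadSeq {r : ℝ≥0∞} (hr : 1 ≤ r) {s : ℝ} (hs : s < 0) (k₀ : ℕ) :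
    Continuous fun f : 𝓢(ℝ, ℂ) => seqNorm r (tailSeq s k₀ (leadSeq f)) := by
  refine continuous_of_subadditive (l := 1) (seqNorm_tailSeq_one_ne_top hr hs k₀) ?_ ?_ ?_
  · intro f g
    refine le_trans (seqNorm_mono fun k => ?_) (seqNorm_add_le hr _ _)
    unfold tailSeq
    split_ifs
    · rw [← mul_add]
      gcongr
      simp only [leadSeq, leadNorm]
      rw [← mul_add]
      gcongr
      exact sob_add_le _ _ _ _
    · simp
  · intro f
    congr 1
    ext k
    simp only [tailSeq, leadSeq, leadNorm, sob_neg]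
  · intro f
    rw [mul_comm, ← seqNorm_const_mul hr]
    refine seqNorm_mono fun k => ?_
    unfold tailSeq
    split_ifs
    · rw [mul_one, mul_comm]
      gcongr
      refine (leadNorm_le_sob_zero (by positivity) f).trans (le_of_eq ?_)
      rw [sob_zero_eq, sob_zero_eq]
    · simp

/-! ### Bootstrap, choice of the starting scale and conclusion -/

lemma le_of_continuous_bootstrap {F : ℝ → ℝ≥0∞} (hF : Continuous F) {B M : ℝ≥0∞} (hBM : B < M)
    (h0 : F 0 ≤ B) (h : ∀ T, (∀ τ ∈ Set.uIcc 0 T, F τ ≤ M) → F T ≤ B) (T : ℝ) : F T ≤ B := by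
  have hF' (θ : ℝ) : Continuous fun τ => F (θ * τ) := by fun_prop
  -- Asking for the bound along the whole segment from 0 to τ treats both time directions together.
  -- The set is clopen, with openness from the gap B < M and compactness of [0, 1].
  let S : Set ℝ := {τ | ∀ θ ∈ Set.Icc (0 : ℝ) 1, F (θ * τ) ≤ B}
  have hclosed : IsClosed S := by
    simp only [S, Set.ofPred_forall]
    exact isClosed_biInter fun θ _ => isClosed_le (hF' θ) continuous_const
  have hopen : IsOpen S := by
    refine isOpen_iff_mem_nhds.2 fun τ hτ => ?_
    have hev : ∀ᶠ τ' in 𝓝 τ, ∀ θ ∈ Set.Icc (0 : ℝ) 1, F (θ * τ') < M := by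
      refine isCompact_Icc.eventually_forall_of_forall_eventually fun θ hθ => ?_
      have hc : Continuous fun z : ℝ × ℝ => F (z.2 * z.1) := by fun_prop
      exact hc.continuousAt.eventually (gt_mem_nhds ((hτ θ hθ).trans_lt hBM))
    filter_upwards [hev] with τ' hτ' θ hθ
    refine h _ fun x hx => ?_
    rw [← segment_eq_uIcc, segment_eq_image] at hx
    obtain ⟨θ', hθ', rfl⟩ := hx
    have e : (1 - θ') • (0 : ℝ) + θ' • (θ * τ') = θ' * θ * τ' := by
      simp [mul_assoc]
    simp only [e]
    exact (hτ' (θ' * θ) ⟨mul_nonneg hθ'.1 hθ.1, mul_le_one₀ hθ'.2 hθ.1 hθ.2⟩).le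
  have huniv : S = Set.univ :=
    IsClopen.eq_univ ⟨hclosed, hopen⟩ ⟨0, fun θ _ => by simpa using h0⟩
  have hT : T ∈ S := huniv ▸ Set.mem_univ T
  simpa using hT 1 (by simp)

lemma exists_nat_two_rpow_ge {α β : ℝ} (hα : 0 < α) (hβ : 0 ≤ β) {W : ℝ≥0} (hW : 1 ≤ W) :
    ∃ k : ℕ, W ≤ 2 ^ (α * (k : ℝ)) ∧ (2 : ℝ≥0) ^ (β * (k : ℝ)) ≤ 2 ^ β * W ^ (β / α) := by
  obtain ⟨n, hn1, hn2⟩ := exists_nat_pow_near (x := W ^ (1 / α)) (y := 2)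
    (NNReal.one_le_rpow hW (by positivity)) one_lt_two
  refine ⟨n + 1, ?_, ?_⟩
  · calc W = (W ^ (1 / α)) ^ α := by
          rw [← NNReal.rpow_mul, one_div_mul_cancel hα.ne', NNReal.rpow_one]
      _ ≤ (2 ^ (n + 1)) ^ α := NNReal.rpow_le_rpow hn2.le hα.le
      _ = _ := by rw [← NNReal.rpow_natCast, ← NNReal.rpow_mul, mul_comm]
  · calc (2 : ℝ≥0) ^ (β * ((n + 1 : ℕ) : ℝ)) = 2 ^ β * (2 ^ n) ^ β := by
          rw [← NNReal.rpow_natCast, ← NNReal.rpow_mul, ← NNReal.rpow_add two_ne_zero]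
          congr 1
          push_cast
          ring
      _ ≤ 2 ^ β * (W ^ (1 / α)) ^ β := by gcongr
      _ = _ := by
          rw [← NNReal.rpow_mul]
          congr 2
          ring

lemma embConst_mul_sob_eq {l : ℝ} (hl : 0 < l) (σ : ℝ) (f : 𝓢(ℝ, ℂ)) :
    embConst l σ * sob l (-σ) f =
      embConst 1 σ * (ENNReal.ofReal (l ^ (-(1 / 2) : ℝ)) * errNorm l σ f) := by
  have e : l ^ (σ - 1 / 2) = l ^ (-(1 / 2) : ℝ) * l ^ σ := by
    rw [← Real.rpow_add hl]
    congr 1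
    ring
  rw [embConst_eq hl, errNorm, e, ENNReal.ofReal_mul (by positivity)]
  ring

/-- By scaling, the smallness quantity is l^{-1/2} `errNorm` up to a constant. One term of the tail
costs 2^{-sk}, and the net gain 2^{-(1/2+s)k} is at its weakest at k = k₀. -/
lemma embConst_mul_sob_le {r : ℝ≥0∞} (hr : 1 ≤ r) {s : ℝ} (hs : -(1 / 2) ≤ s) (σ : ℝ)
    (f : 𝓢(ℝ, ℂ)) {k₀ k : ℕ} (hk : k₀ ≤ k) :
    2 ^ ((1 / 2 + s) * (k₀ : ℝ)) * (embConst (2 * 2 ^ k) σ * sob (2 * 2 ^ k) (-σ) f) ≤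
      embConst 1 σ * seqNorm r (tailSeq s k₀ (errSeq σ f)) := by
  rw [embConst_mul_sob_eq (by positivity)]
  have h1 := le_seqNorm hr (tailSeq s k₀ (errSeq σ f)) k
  rw [tailSeq_natCast hk] at h1
  have h2 : ENNReal.ofReal ((2 * 2 ^ k : ℝ) ^ (-(1 / 2) : ℝ)) ≤ 2 ^ (-(1 / 2) * (k : ℝ)) := by
    have h3 : (2 * 2 ^ k : ℝ) ^ (-(1 / 2) : ℝ) ≤ (2 : ℝ) ^ (-(1 / 2) * (k : ℝ)) := by
      rw [mul_comm (-(1 / 2) : ℝ), Real.rpow_mul (by norm_num), Real.rpow_natCast]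
      exact Real.rpow_le_rpow_of_nonpos (by positivity)
        (by linarith [show (0 : ℝ) < 2 ^ k by positivity]) (by norm_num)
    refine (ENNReal.ofReal_le_ofReal h3).trans (le_of_eq ?_)
    rw [← ENNReal.ofReal_rpow_of_pos (by norm_num), ENNReal.ofReal_ofNat]
  have h4 : (2 : ℝ≥0∞) ^ ((1 / 2 + s) * (k₀ : ℝ)) ≤ 2 ^ ((1 / 2 + s) * (k : ℝ)) := by
    refine ENNReal.rpow_le_rpow_of_exponent_le ENNReal.one_lt_two.le ?_
    have : (k₀ : ℝ) ≤ k := by exact_mod_cast hk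
    exact mul_le_mul_of_nonneg_left this (by linarith)
  calc _ ≤ 2 ^ ((1 / 2 + s) * (k : ℝ)) * (embConst 1 σ *
        (2 ^ (-(1 / 2) * (k : ℝ)) * errNorm (2 * 2 ^ k) σ f)) := by gcongr
    _ = embConst 1 σ * (2 ^ ((1 / 2 + s) * (k : ℝ)) * 2 ^ (-(1 / 2) * (k : ℝ)) *
        errNorm (2 * 2 ^ k) σ f) := by ring
    _ = embConst 1 σ * (2 ^ (s * (k : ℝ)) * errSeq σ f k) := by
        rw [← two_rpow_add, errSeq]
        congr 3
        ring_nf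
    _ ≤ _ := by gcongr

lemma seqNorm_leadSeq_le_of_small {r : ℝ≥0∞} (hr : 1 ≤ r) {s σ : ℝ} (hs : -(1 / 2) ≤ s)
    (h0 : 0 ≤ σ) (h1 : σ < 1 / 2) {ε : ℝ} {q : ℝ → 𝓢(ℝ, ℂ)} (hε : ε = 1 ∨ ε = -1)
    (h : IsSchwartzSolutionNLS ε q ∨ IsSchwartzSolutionHirota ε q) {η : ℝ≥0∞} (hη : η < 1)
    {k₀ : ℕ} {T : ℝ}
    (hsmall : ∀ τ ∈ Set.uIcc 0 T, 16 * (embConst 1 σ *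
      seqNorm r (tailSeq s k₀ (errSeq σ (q τ)))) ≤ η * 2 ^ ((1 / 2 + s) * (k₀ : ℝ))) :
    seqNorm r (tailSeq s k₀ (leadSeq (q T))) ≤ seqNorm r (tailSeq s k₀ (leadSeq (q 0))) +
      η * (seqNorm r (tailSeq s k₀ (errSeq σ (q 0))) +
        seqNorm r (tailSeq s k₀ (errSeq σ (q T)))) := by
  have hk (k : ℕ) (hk : k₀ ≤ k) : leadSeq (q T) k ≤
      leadSeq (q 0) k + η * (errSeq σ (q 0) k + errSeq σ (q T) k) := by
    refine leadNorm_le_of_small (by positivity) h0 h1 hε h hη T fun τ hτ => ?_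
    have e := (mul_le_mul_right (embConst_mul_sob_le hr hs σ (q τ) hk) 16).trans (hsmall τ hτ)
    have hne : (2 : ℝ≥0∞) ^ ((1 / 2 + s) * (k₀ : ℝ)) ≠ 0 := by
      rw [Ne, ENNReal.rpow_eq_zero_iff]
      simp
    rw [mul_left_comm, mul_comm] at e
    exact (ENNReal.mul_le_mul_iff_left hne (two_rpow_ne_top _)).1 e
  have hadd := seqNorm_add_le hr (tailSeq s k₀ (errSeq σ (q 0))) (tailSeq s k₀ (errSeq σ (q T)))
  refine le_trans (seqNorm_mono (y := fun k => tailSeq s k₀ (leadSeq (q 0)) k + η *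
    (tailSeq s k₀ (errSeq σ (q 0)) k + tailSeq s k₀ (errSeq σ (q T)) k)) fun k => ?_)
    ((seqNorm_add_le hr _ _).trans ?_)
  · unfold tailSeq
    split_ifs with hk0
    · refine (mul_le_mul_right (hk k.toNat (by omega)) _).trans (le_of_eq ?_)
      ring
    · exact bot_le
  · rw [seqNorm_const_mul hr]
    gcongr

lemma le_two_mul_of_le_add {a b c : ℝ≥0∞} (ha : a ≠ ∞) (hb : b ≠ ∞) (hc : 3 * c ≤ 1)
    (h : a ≤ b + c * (b + a)) : a ≤ 2 * b := by
  have hc' : c ≠ ∞ := by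
    rintro rfl
    simp at hc
  lift a to ℝ≥0 using ha
  lift b to ℝ≥0 using hb
  lift c to ℝ≥0 using hc'
  norm_cast at *
  have hc2 : 3 * (c : ℝ) ≤ 1 := by exact_mod_cast hc
  have h2 : (a : ℝ) ≤ b + c * (b + a) := by exact_mod_cast h
  have : (a : ℝ) ≤ 2 * b := by nlinarith [a.coe_nonneg, b.coe_nonneg]
  exact_mod_cast this

/-- Under the bootstrap bound on the leading tail, the error tail meets the smallness condition at
every scale k ≥ k₀; almost conservation, with the error absorbed, then improves that bound. -/
lemma exists_seqNorm_leadSeq_bound {r : ℝ≥0∞} (hr : 1 ≤ r) {s : ℝ} (hs₁ : -(1 / 2) < s)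
    (hs₂ : s < 0) : ∃ D C : ℝ≥0, ∀ (ε : ℝ) (q : ℝ → 𝓢(ℝ, ℂ)), (ε = 1 ∨ ε = -1) →
      (IsSchwartzSolutionNLS ε q ∨ IsSchwartzSolutionHirota ε q) → ∀ (x : ℝ≥0) (k₀ : ℕ),
      besovNorm s r (q 0) = x →
      (D + 1) * (1 + x ^ 2) ^ (1 / 2 : ℝ) ≤ 2 ^ ((1 / 2 + s) * (k₀ : ℝ)) →
      ∀ t, seqNorm r (tailSeq s k₀ (leadSeq (q t))) ≤ C * x := by
  -- The midpoint of |s| and 1/2: σ > |s| makes the error kernel summable, and σ < 1/2 makes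
  -- `embConst` finite.
  set σ : ℝ := 1 / 4 - s / 2 with hσ
  have hσ0 : 0 ≤ σ := by linarith
  have hσ1 : σ < 1 / 2 := by linarith
  obtain ⟨CH, hCH⟩ := exists_seqNorm_errSeq_le hr hσ0 (by linarith) (by linarith : 0 < σ + s)
  obtain ⟨CU, hCU⟩ := exists_seqNorm_leadSeq_le hr (by linarith : -1 < s) hs₂
  obtain ⟨c, hc⟩ := WithTop.ne_top_iff_exists.1 (embConst_one_lt_top hσ1).ne
  -- Chosen so that 3 η CH ≤ 1, which lets the error be absorbed.
  set η : ℝ≥0 := (3 * CH + 3)⁻¹ with hη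
  have hη0 : 0 < η := by positivity
  have hη1 : η < 1 := inv_lt_one_of_one_lt₀ (by
    calc (1 : ℝ≥0) < 3 := by norm_num
      _ ≤ _ := le_add_self)
  have hηCH : 3 * (η * CH) ≤ 1 := by
    rw [hη, ← div_eq_inv_mul, ← mul_div_assoc, div_le_one (by positivity)]
    exact le_self_add
  -- Here 64 = 16 · 4, from the smallness condition and the bootstrap threshold 4 (CU + 1) Y.
  set D : ℝ≥0 := 64 * c * CH * (CU + 1) / η with hD
  refine ⟨D, 2 * CU, fun ε q hε h x k₀ hx hk₀ => ?_⟩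
  set Y : ℝ≥0 := (1 + x ^ 2) ^ (1 / 2 : ℝ) with hY
  have hYsq : Y ^ 2 = 1 + x ^ 2 := by
    rw [hY, ← NNReal.rpow_natCast, ← NNReal.rpow_mul]
    norm_num
  have hY1 : 1 ≤ Y := NNReal.one_le_rpow le_self_add (by norm_num)
  have hxY : x ≤ Y := by
    refine (sq_le_sq₀ (by positivity) (by positivity)).1 ?_
    rw [hYsq]
    exact le_add_self
  have hcont : Continuous q := continuous_of_hasSchwartzDerivAt fun t => by
    rcases h with h | h
    · exact (h t).imp fun _ hv => hv.1
    · exact (h t).imp fun _ hv => hv.1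
  have hZ0 : seqNorm r (tailSeq s k₀ (leadSeq (q 0))) ≤ (CU * x : ℝ≥0) := by
    rw [ENNReal.coe_mul, ← hx]
    exact hCU (q 0) k₀
  refine le_of_continuous_bootstrap (B := ((2 * CU : ℝ≥0) : ℝ≥0∞) * x)
    (M := ((4 * (CU + 1) * Y : ℝ≥0) : ℝ≥0∞)) ((continuous_seqNorm_leadSeq hr hs₂ k₀).comp hcont)
    ?_ ?_ fun T hT => ?_
  · rw [← ENNReal.coe_mul, ENNReal.coe_lt_coe]
    calc 2 * CU * x ≤ 2 * CU * Y := by gcongr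
      _ < 4 * (CU + 1) * Y := by
        have : 0 < Y := by positivity
        gcongr ?_ * Y
        rw [← NNReal.coe_lt_coe]
        push_cast
        linarith [CU.coe_nonneg]
  · refine hZ0.trans ?_
    rw [← ENNReal.coe_mul, ENNReal.coe_le_coe, mul_assoc]
    exact le_mul_of_one_le_left (by positivity) (by norm_num)
  · have hlead := seqNorm_leadSeq_le_of_small (T := T) (k₀ := k₀) hr hs₁.le hσ0 hσ1 hε h
      (η := (η : ℝ≥0∞)) (by exact_mod_cast hη1) fun τ hτ => by
        calc _ ≤ 16 * (embConst 1 σ * (CH * (4 * (CU + 1) * Y : ℝ≥0))) := by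
              gcongr
              exact (hCH (q τ) k₀).trans (mul_le_mul_right (hT τ hτ) _)
          _ = ((16 * (c * (CH * (4 * (CU + 1) * Y))) : ℝ≥0) : ℝ≥0∞) := by
              rw [← hc]
              push_cast
              rfl
          _ ≤ ((η * 2 ^ ((1 / 2 + s) * (k₀ : ℝ)) : ℝ≥0) : ℝ≥0∞) := by
              rw [ENNReal.coe_le_coe]
              calc _ = η * (D * Y) := by
                    rw [hD]
                    field_simp
                    ring
                _ ≤ η * ((D + 1) * Y) := by
                    gcongr
                    exact le_self_add
                _ ≤ _ := by gcongr
          _ = _ := by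
              rw [ENNReal.coe_mul, ENNReal.coe_rpow_of_ne_zero two_ne_zero]
              rfl
    -- Finiteness, needed for the absorption, comes from the bootstrap hypothesis itself.
    have hfin : seqNorm r (tailSeq s k₀ (leadSeq (q T))) ≠ ∞ :=
      ne_top_of_le_ne_top ENNReal.coe_ne_top (hT T Set.right_mem_uIcc)
    have hfin0 : seqNorm r (tailSeq s k₀ (leadSeq (q 0))) ≠ ∞ :=
      ne_top_of_le_ne_top ENNReal.coe_ne_top hZ0
    refine (le_two_mul_of_le_add (c := η * CH) hfin hfin0 (by exact_mod_cast hηCH)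
      (hlead.trans ?_)).trans ?_
    · rw [mul_assoc, mul_add (CH : ℝ≥0∞)]
      gcongr
      · exact hCH _ _
      · exact hCH _ _
    · refine (mul_le_mul_right hZ0 _).trans (le_of_eq ?_)
      push_cast
      ring

theorem theorem4p5 (s : ℝ) (hs₁ : -(1 / 2) < s) (hs₂ : s < 0) (r : ℝ≥0∞) (hr : 1 ≤ r) :
    ∃ C : ℝ≥0, ∀ (ε : ℝ) (q : ℝ → 𝓢(ℝ, ℂ)), (ε = 1 ∨ ε = -1) →
      (IsSchwartzSolutionNLS ε q ∨ IsSchwartzSolutionHirota ε q) →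
      ∀ t : ℝ, besovNorm s r (q t) ≤
        C * besovNorm s r (q 0) * (1 + besovNorm s r (q 0) ^ 2) ^ (|s| / (1 - 2 * |s|)) := by
  obtain ⟨CB, hCB⟩ := exists_besovNorm_le hr hs₂
  obtain ⟨D, CZ, hCZ⟩ := exists_seqNorm_leadSeq_bound hr hs₁ hs₂
  have hα : 0 < 1 / 2 + s := by linarith
  have habs : |s| = -s := abs_of_neg hs₂
  have hden : 0 < 1 - 2 * |s| := by rw [habs]; linarith
  have hp : 0 < |s| / (1 - 2 * |s|) := div_pos (abs_pos.2 hs₂.ne) hden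
  set C : ℝ≥0 := CB * (2 ^ (-s) * (D + 1) ^ (-s / (1 / 2 + s))) * CZ with hC
  -- The added 1 keeps the constant positive, so that the right side is ∞ when the initial norm is;
  -- finiteness of Besov norms then need not be proved.
  refine ⟨C + 1, fun ε q hε h t => ?_⟩
  rcases eq_or_ne (besovNorm s r (q 0)) ∞ with hX | hX
  · rw [hX, ENNReal.mul_top (by positivity), ENNReal.top_pow two_ne_zero, add_top,
      ENNReal.top_rpow_of_pos hp, ENNReal.top_mul_top]
    exact le_top
  obtain ⟨x, hx⟩ := WithTop.ne_top_iff_exists.1 hX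
  set Y : ℝ≥0 := (1 + x ^ 2) ^ (1 / 2 : ℝ) with hY
  have hY1 : 1 ≤ Y := NNReal.one_le_rpow le_self_add (by norm_num)
  obtain ⟨k₀, hk₀, hk₁⟩ := exists_nat_two_rpow_ge (β := -s) hα (by linarith)
    -- The threshold is (D + 1) Y; using D + 1 guarantees that it is at least 1.
    (one_le_mul le_add_self hY1 : 1 ≤ (D + 1) * Y)
  have hYp : Y ^ (-s / (1 / 2 + s)) = (1 + x ^ 2) ^ (|s| / (1 - 2 * |s|)) := by
    rw [hY, ← NNReal.rpow_mul]
    -- The exponent identity: half of -s/(1/2 + s) is |s|/(1 - 2|s|).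
    congr 1
    rw [habs] at hden ⊢
    field_simp
    ring
  rw [NNReal.mul_rpow, hYp] at hk₁
  have hpow : (2 : ℝ≥0∞) ^ (-s * (k₀ : ℝ)) = ((2 ^ (-s * (k₀ : ℝ)) : ℝ≥0) : ℝ≥0∞) := by
    rw [ENNReal.coe_rpow_of_ne_zero two_ne_zero]
    rfl
  calc besovNorm s r (q t) ≤ _ := hCB (q t) k₀
    _ ≤ CB * ((2 ^ (-s * (k₀ : ℝ)) : ℝ≥0) : ℝ≥0∞) * (CZ * x) := by
      rw [hpow]
      gcongr
      exact hCZ ε q hε h x k₀ hx.symm hk₀ t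
    _ ≤ ((C * x * (1 + x ^ 2) ^ (|s| / (1 - 2 * |s|)) : ℝ≥0) : ℝ≥0∞) := by
      rw [← ENNReal.coe_mul, ← ENNReal.coe_mul, ← ENNReal.coe_mul, ENNReal.coe_le_coe]
      calc _ ≤ CB * (2 ^ (-s) * ((D + 1) ^ (-s / (1 / 2 + s)) *
            (1 + x ^ 2) ^ (|s| / (1 - 2 * |s|)))) * (CZ * x) := by gcongr
        _ = _ := by rw [hC]; ring
    _ ≤ _ := by
      rw [← hx, ENNReal.coe_mul, ENNReal.coe_mul, ENNReal.coe_rpow_of_nonneg _ hp.le]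
      have hC1 : (C : ℝ≥0∞) ≤ ((C + 1 : ℝ≥0) : ℝ≥0∞) := ENNReal.coe_le_coe.2 le_self_add
      exact mul_le_mul_left (mul_le_mul_left hC1 _) _
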